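/- Manifolds are smooth, finite-dimensional, without boundary, Hausdorff and second countable. Let $\mathcal G\rightrightarrows M$ be a Lie groupoid with source $s$, target $t$ (surjective submersions), units $\mathrm{Id}_m$ and product $g.h$ defined for $s(g)=t(h)$. Let $\pi_{\mathcal P}\colon\mathcal P\to\Sigma$ be a principaloid $\mathcal G$-bundle over a non-empty manifold $\Sigma$: a fibre bundle with typical fibre the arrow manifold $\mathcal G$ and with a fibre-preserving right $\mathcal G$-action $\varrho$ with moment map $\mu\colon\mathcal P\to M$, which over the sets $O_i$ of an open cover of $\Sigma$ has $\mathcal G$-equivariant smooth trivialisations $\pi_{\mathcal P}^{-1}(O_i)\cong O_i\times\mathcal G$, where $\mathcal G$ acts on its arrow manifold by right translations with moment map $s$. Write $[(\sigma,g,i)]\in\mathcal P$ for the point with coordinates $(\sigma,g)$ in the $i$-th trivialisation. Then $[(\sigma,g,j)]=[(\sigma,\beta_{ij}(\sigma)\vartriangleright g,i)]$ over $O_{ij}=O_i\cap O_j$, for a 1-cocycle of bisections $\beta_{ij}(\sigma)\colon M\to\mathcal G$ of $\mathcal G$ (sections of $s$), with $\beta\vartriangleright g=\beta(t(g)).g$;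 put $g\vartriangleleft\beta^{-1}=g.\beta(s(g))^{-1}$. The shadow bundle $\pi_{\mathcal F}\colon\mathcal F\to\Sigma$ is $\bigsqcup_i(O_i\times M)/\!\sim$ with $(\sigma,m,j)\sim(\sigma,t(\beta_{ij}(\sigma)(m)),i)$, and the sitting-duck map is $\mathcal D\colon\mathcal P\to\mathcal F$, $[(\sigma,g,i)]\mapsto[(\sigma,t(g),i)]$. The Atiyah--Ehresmann groupoid $\mathrm{At}(\mathcal P)\rightrightarrows\mathcal F$ has the arrow manifold $\bigsqcup_{i,j}(O_i\times\mathcal G\times O_j)/\!\sim$ with $(\sigma_1,g,\sigma_2,i,j)\sim(\sigma_1,\beta_{ki}(\sigma_1)\vartriangleright g\vartriangleleft\beta_{lj}(\sigma_2)^{-1},\sigma_2,k,l)$, which is diffeomorphic, through $[(\sigma_1,g,\sigma_2,i,j)]\mapsto[([(\sigma_1,g,i)],\sigma_2,j)]$, to the bundle over $\Sigma$ with typical fibre $\mathcal P$ associated with $\mathcal P$, in which $(p,\sigma,j)\sim(\varrho(p,\beta_{lj}(\sigma)(\mu(p))^{-1}),\sigma,l)$. Its structure maps are $\mathsf S[(\sigma_1,g,\sigma_2,i,j)]=[(\sigma_2,s(g),j)]$,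 $\mathsf T[(\sigma_1,g,\sigma_2,i,j)]=[(\sigma_1,t(g),i)]$, units $[(\sigma,m,i)]\mapsto[(\sigma,\mathrm{Id}_m,\sigma,i,i)]$, inverse $[(\sigma_1,g,\sigma_2,i,j)]\mapsto[(\sigma_2,g^{-1},\sigma_1,j,i)]$ and product $[(\sigma_1,g,\sigma_2,i,j)].[(\sigma_2,h,\sigma_3,k,l)]=[(\sigma_1,g.(\beta_{jk}(\sigma_2)\vartriangleright h),\sigma_3,i,l)]$; with these it is a Lie groupoid. Then: 1. $\mathcal P$ is a left $\mathrm{At}(\mathcal P)$-module with moment map $\mathcal D$ and action $\lambda_{\mathcal P}\bigl([(\sigma_1,g,\sigma_2,i,j)],[(\sigma_2,h,k)]\bigr)=[(\sigma_1,g.(\beta_{jk}(\sigma_2)\vartriangleright h),i)]$, for $\sigma_1\in O_i$ and $\sigma_2\in O_{jk}$. 2. This structure covers the canonical left module structure of the pair groupoid $\mathrm{Pair}(\Sigma)$ on $\Sigma$ (moment map $\mathrm{id}_\Sigma$, action $((\sigma_1,\sigma_2),\sigma_2)\mapsto\sigma_1$): the projections of $\mathrm{At}(\mathcal P)$, $\mathcal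 F$, $\mathcal P$ to $\Sigma\times\Sigma$, $\Sigma$, $\Sigma$ form a morphism of left modules of Lie groupoids. 3. $\mathcal F$ is a left $\mathrm{At}(\mathcal P)$-module with moment map $\mathrm{id}_{\mathcal F}$ and action $\lambda_{\mathcal F}\bigl([(\sigma_1,g,\sigma_2,i,j)],[(\sigma_2,m,k)]\bigr)=[(\sigma_1,t(g),i)]$. 4. $\mathcal D$ intertwines the two actions: $\mathcal D=\mu_{\mathcal F}\circ\mathcal D$ for the moment map $\mu_{\mathcal F}=\mathrm{id}_{\mathcal F}$, and $\lambda_{\mathcal F}(a,\mathcal D(p))=\mathcal D(\lambda_{\mathcal P}(a,p))$ whenever $\mathsf S(a)=\mathcal D(p)$. 5. $(\mathrm{At}(\mathcal P),\mathcal P,\mathcal G;\Sigma,\mathcal G)$ is a trident, that is: (a) $\mathcal P$ is a principal $(\mathrm{At}(\mathcal P),\mathcal G)$-bibundle: the actions $\lambda_{\mathcal P}$ and $\varrho$ commute, $\mu$ is $\lambda_{\mathcal P}$-invariant and $\mathcal D$ is $\varrho$-invariant, $\mathcal D$ and $\mu$ are surjective submersions, $(\lambda_{\mathcal P},\mathrm{pr}_2)\colon\mathrm{At}(\mathcal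 P)\,{}_{\mathsf S}\!\times_{\mathcal D}\mathcal P\to\mathcal P\,{}_\mu\!\times_\mu\mathcal P$ is a diffeomorphism (so $\lambda_{\mathcal P}$ is principal over $M$), and $(\mathrm{pr}_1,\varrho)\colon\mathcal P\,{}_\mu\!\times_t\mathcal G\to\mathcal P\,{}_{\mathcal D}\!\times_{\mathcal D}\mathcal P$ is a diffeomorphism (so $\varrho$ is principal over $\mathcal F$); (b) $\pi_{\mathcal P}$ is a fibre bundle with typical fibre $\mathcal G$, and $\varrho$ preserves its fibres; (c) $\mathrm{At}(\mathcal P)\rightrightarrows\mathcal F$ is a fibre-bundle object in Lie groupoids with base $\mathrm{Pair}(\Sigma)$ and typical fibre $\mathcal G\rightrightarrows M$: the projections to $\Sigma\times\Sigma$ and $\Sigma$ form a morphism of Lie groupoids consisting of surjective submersions, and in smooth local trivialisations over $O_i\times O_j$ and $O_i$ the structure maps become those of the product of $\mathrm{Pair}(\Sigma)$ with $\mathcal G$; (d) the $\mathrm{At}(\mathcal P)$-module structure on $\mathcal P$ covers the $\mathrm{Pair}(\Sigma)$-module $\Sigma$, and in local trivialisations its moment map and action are $t$ and the left multiplication of $\mathcal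 G$ on its arrow manifold. -/

import Mathlib

open Set Function Manifold Bundle
open scoped Manifold ContDiff

namespace Principaloid

/-! ## Smooth manifolds, submersions, diffeomorphisms of subsets, fibre bundles -/

section Basic

variable {E : Type*} [NormedAddCommGroup E] [NormedSpace ℝ E] {H : Type*} [TopologicalSpace H]
variable {E' : Type*} [NormedAddCommGroup E'] [NormedSpace ℝ E'] {H' : Type*} [TopologicalSpace H']
variable {E'' : Type*} [NormedAddCommGroup E''] [NormedSpace ℝ E'']
  {H'' : Type*} [TopologicalSpace H'']

/-- `X`, with its given atlas, is a smooth manifold: finite-dimensional, without boundary,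
Hausdorff and second countable. -/
structure IsSmoothManifold (I : ModelWithCorners ℝ E H) (X : Type*) [TopologicalSpace X]
    [ChartedSpace H X] : Prop where
  finiteDimensional : FiniteDimensional ℝ E
  boundaryless : I.Boundaryless
  isManifold : IsManifold I ∞ X
  t2Space : T2Space X
  secondCountable : SecondCountableTopology X

/-- A surjective submersion between smooth finite-dimensional manifolds. -/
structure IsSurjSubmersion (I : ModelWithCorners ℝ E H) (I' : ModelWithCorners ℝ E' H')
    {X Y : Type*} [TopologicalSpace X] [ChartedSpace H X] [TopologicalSpace Y] [ChartedSpace H' Y]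
    (f : X → Y) : Prop where
  contMDiff : ContMDiff I I' ∞ f
  surjective : Surjective f
  surjective_mfderiv : ∀ x, Surjective (mfderiv I I' f x)

/-- `f` restricts to a diffeomorphism from `A` onto `C`. It is used only for fibred products
`A ⊆ X` and `C ⊆ Y`, which are embedded submanifolds; for maps on those, smoothness for the
submanifold structure is smoothness within the subset. -/
def IsDiffeoBetween (I : ModelWithCorners ℝ E H) (I' : ModelWithCorners ℝ E' H')
    {X Y : Type*} [TopologicalSpace X] [ChartedSpace H X] [TopologicalSpace Y] [ChartedSpace H' Y]
    (A : Set X) (C : Set Y) (f : X → Y) : Prop :=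
  ContMDiffOn I I' ∞ f A ∧ MapsTo f A C ∧
    ∃ f' : Y → X, ContMDiffOn I' I ∞ f' C ∧ MapsTo f' C A ∧ LeftInvOn f' f A ∧ RightInvOn f' f C

/-- A (topological) local trivialization that is a diffeomorphism. -/
structure IsSmoothTrivialization (IX : ModelWithCorners ℝ E H) (IB : ModelWithCorners ℝ E' H')
    (IF : ModelWithCorners ℝ E'' H'') {X B F : Type*}
    [TopologicalSpace X] [ChartedSpace H X] [TopologicalSpace B] [ChartedSpace H' B]
    [TopologicalSpace F] [ChartedSpace H'' F] {proj : X → B} (e : Trivialization F proj) :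
    Prop where
  contMDiffOn : ContMDiffOn IX (IB.prod IF) ∞ e e.source
  contMDiffOn_symm :
    ContMDiffOn (IB.prod IF) IX ∞ e.toOpenPartialHomeomorph.symm e.target

/-- `proj : X → B` is a smooth fibre bundle with typical fibre `F`. -/
structure IsSmoothFibreBundle (IX : ModelWithCorners ℝ E H) (IB : ModelWithCorners ℝ E' H')
    (IF : ModelWithCorners ℝ E'' H'') {X B : Type*} (F : Type*)
    [TopologicalSpace X] [ChartedSpace H X] [TopologicalSpace B] [ChartedSpace H' B]
    [TopologicalSpace F] [ChartedSpace H'' F] (proj : X → B) : Prop where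
  isSurjSubmersion : IsSurjSubmersion IX IB proj
  exists_trivialization : ∀ b : B, ∃ e : Trivialization F proj,
    b ∈ e.baseSet ∧ IsSmoothTrivialization IX IB IF e

end Basic

/-! ## Lie groupoids -/

/-- The structure maps of a groupoid with object set `M` and arrow set `G`. The product `mul g h`
is meaningful only if `src g = tgt h`; its other values are irrelevant and never used. -/
structure GroupoidMaps (M G : Type*) where
  src : G → M
  tgt : G → M
  one : M → G
  inv : G → G
  mul : G → G → G

/-- The pairs of composable arrows. -/
def GroupoidMaps.composable {M G : Type*} (𝒢 : GroupoidMaps M G) : Set (G × G) :=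
  {q | 𝒢.src q.1 = 𝒢.tgt q.2}

/-- The pair groupoid of `B`: an arrow `(b₁, b₂)` goes from `b₂` to `b₁`. -/
def pairGroupoid (B : Type*) : GroupoidMaps B (B × B) where
  src := Prod.snd
  tgt := Prod.fst
  one b := (b, b)
  inv := Prod.swap
  mul x y := (x.1, y.2)

section Groupoid

variable {EM : Type*} [NormedAddCommGroup EM] [NormedSpace ℝ EM] {HM : Type*} [TopologicalSpace HM]
variable {EG : Type*} [NormedAddCommGroup EG] [NormedSpace ℝ EG] {HG : Type*} [TopologicalSpace HG]
variable {EN : Type*} [NormedAddCommGroup EN] [NormedSpace ℝ EN] {HN : Type*} [TopologicalSpace HN]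
variable {EK : Type*} [NormedAddCommGroup EK] [NormedSpace ℝ EK] {HK : Type*} [TopologicalSpace HK]
variable {M : Type*} [TopologicalSpace M] [ChartedSpace HM M]
variable {G : Type*} [TopologicalSpace G] [ChartedSpace HG G]
variable {N : Type*} [TopologicalSpace N] [ChartedSpace HN N]
variable {K : Type*} [TopologicalSpace K] [ChartedSpace HK K]

/-- The axioms of a Lie groupoid. -/
structure IsLieGroupoid (IM : ModelWithCorners ℝ EM HM) (IG : ModelWithCorners ℝ EG HG)
    (𝒢 : GroupoidMaps M G) : Prop where
  manifold_obj : IsSmoothManifold IM M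
  manifold_arr : IsSmoothManifold IG G
  src_submersion : IsSurjSubmersion IG IM 𝒢.src
  tgt_submersion : IsSurjSubmersion IG IM 𝒢.tgt
  contMDiff_one : ContMDiff IM IG ∞ 𝒢.one
  contMDiff_inv : ContMDiff IG IG ∞ 𝒢.inv
  contMDiffOn_mul :
    ContMDiffOn (IG.prod IG) IG ∞ (fun q : G × G => 𝒢.mul q.1 q.2) 𝒢.composable
  src_one : ∀ m, 𝒢.src (𝒢.one m) = m
  tgt_one : ∀ m, 𝒢.tgt (𝒢.one m) = m
  src_mul : ∀ g h, 𝒢.src g = 𝒢.tgt h → 𝒢.src (𝒢.mul g h) = 𝒢.src h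
  tgt_mul : ∀ g h, 𝒢.src g = 𝒢.tgt h → 𝒢.tgt (𝒢.mul g h) = 𝒢.tgt g
  mul_assoc : ∀ g h k, 𝒢.src g = 𝒢.tgt h → 𝒢.src h = 𝒢.tgt k →
    𝒢.mul (𝒢.mul g h) k = 𝒢.mul g (𝒢.mul h k)
  one_mul : ∀ g, 𝒢.mul (𝒢.one (𝒢.tgt g)) g = g
  mul_one : ∀ g, 𝒢.mul g (𝒢.one (𝒢.src g)) = g
  src_inv : ∀ g, 𝒢.src (𝒢.inv g) = 𝒢.tgt g
  tgt_inv : ∀ g, 𝒢.tgt (𝒢.inv g) = 𝒢.src g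
  mul_inv : ∀ g, 𝒢.mul g (𝒢.inv g) = 𝒢.one (𝒢.tgt g)
  inv_mul : ∀ g, 𝒢.mul (𝒢.inv g) g = 𝒢.one (𝒢.src g)

/-- A morphism of Lie groupoids (a smooth functor), with arrow component `Φ` and object
component `Φ₀`. -/
structure IsLieGroupoidMorphism (IM : ModelWithCorners ℝ EM HM) (IG : ModelWithCorners ℝ EG HG)
    (IN : ModelWithCorners ℝ EN HN) (IK : ModelWithCorners ℝ EK HK)
    (𝒢 : GroupoidMaps M G) (𝒦 : GroupoidMaps N K) (Φ : G → K) (Φ₀ : M → N) : Prop where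
  contMDiff_arr : ContMDiff IG IK ∞ Φ
  contMDiff_obj : ContMDiff IM IN ∞ Φ₀
  src_map : ∀ g, 𝒦.src (Φ g) = Φ₀ (𝒢.src g)
  tgt_map : ∀ g, 𝒦.tgt (Φ g) = Φ₀ (𝒢.tgt g)
  map_one : ∀ m, Φ (𝒢.one m) = 𝒦.one (Φ₀ m)
  map_inv : ∀ g, Φ (𝒢.inv g) = 𝒦.inv (Φ g)
  map_mul : ∀ g h, 𝒢.src g = 𝒢.tgt h → Φ (𝒢.mul g h) = 𝒦.mul (Φ g) (Φ h)

/-- A Lie groupoid with object manifold `M` and arrow manifold `G`. -/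
structure LieGroupoid (IM : ModelWithCorners ℝ EM HM) (M : Type*) [TopologicalSpace M]
    [ChartedSpace HM M] (IG : ModelWithCorners ℝ EG HG) (G : Type*) [TopologicalSpace G]
    [ChartedSpace HG G] extends GroupoidMaps M G where
  isLieGroupoid : IsLieGroupoid IM IG toGroupoidMaps

theorem IsLieGroupoid.inv_one {IM : ModelWithCorners ℝ EM HM} {IG : ModelWithCorners ℝ EG HG}
    {𝒢 : GroupoidMaps M G} (h : IsLieGroupoid IM IG 𝒢) (m : M) :
    𝒢.inv (𝒢.one m) = 𝒢.one m := by
  have h1 := h.mul_inv (𝒢.one m)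
  have h2 := h.one_mul (𝒢.inv (𝒢.one m))
  rw [h.tgt_inv, h.src_one] at h2
  rw [h2, h.tgt_one] at h1
  exact h1

theorem IsLieGroupoid.inv_mul_inv {IM : ModelWithCorners ℝ EM HM}
    {IG : ModelWithCorners ℝ EG HG} {𝒢 : GroupoidMaps M G} (h : IsLieGroupoid IM IG 𝒢) (x y : G)
    (hxy : 𝒢.src x = 𝒢.tgt y) : 𝒢.mul (𝒢.inv y) (𝒢.inv x) = 𝒢.inv (𝒢.mul x y) := by
  have e1 : 𝒢.src (𝒢.inv y) = 𝒢.tgt (𝒢.inv x) := by rw [h.src_inv, h.tgt_inv, hxy]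
  have e2 : 𝒢.src (𝒢.inv x) = 𝒢.tgt (𝒢.mul x y) := by rw [h.src_inv, h.tgt_mul _ _ hxy]
  have e3 : 𝒢.src (𝒢.mul x y) = 𝒢.tgt (𝒢.inv (𝒢.mul x y)) := by rw [h.tgt_inv]
  have h1 : 𝒢.mul (𝒢.mul (𝒢.inv y) (𝒢.inv x)) (𝒢.mul x y) = 𝒢.one (𝒢.src y) := by
    rw [h.mul_assoc _ _ _ e1 e2, ← h.mul_assoc (𝒢.inv x) x y (h.src_inv x) hxy, h.inv_mul, hxy,
      h.one_mul, h.inv_mul]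
  have h2 := h.mul_assoc (𝒢.mul (𝒢.inv y) (𝒢.inv x)) (𝒢.mul x y) (𝒢.inv (𝒢.mul x y))
    (by rw [h.src_mul _ _ e1, e2]) e3
  have e4 : 𝒢.src y = 𝒢.tgt (𝒢.inv (𝒢.mul x y)) := by rw [h.tgt_inv, h.src_mul _ _ hxy]
  have e5 : 𝒢.tgt (𝒢.mul x y) = 𝒢.src (𝒢.mul (𝒢.inv y) (𝒢.inv x)) := by
    rw [h.src_mul _ _ e1, e2]
  rw [h1, h.mul_inv, e4, h.one_mul, e5, h.mul_one] at h2
  exact h2.symm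

end Groupoid

/-! ## Groupoid modules, principal bundles and bibundles -/

/-- The moment map `X → M` and action map of a left action of `G ⇉ M` on `X`. The value `act g x`
is meaningful only if the source of `g` is `moment x`. -/
structure LeftActionMaps (M G X : Type*) where
  moment : X → M
  act : G → X → X

/-- The moment map `X → M` and action map of a right action of `G ⇉ M` on `X`. The value `act x g`
is meaningful only if the target of `g` is `moment x`. -/
structure RightActionMaps (M G X : Type*) where
  moment : X → M
  act : X → G → X

/-- The canonical action of the pair groupoid of `B` on `B`, with moment map the identity. -/
def pairAction (B : Type*) : LeftActionMaps B (B × B) B where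
  moment := id
  act x _ := x.1

section Modules

variable {EM : Type*} [NormedAddCommGroup EM] [NormedSpace ℝ EM] {HM : Type*} [TopologicalSpace HM]
variable {EG : Type*} [NormedAddCommGroup EG] [NormedSpace ℝ EG] {HG : Type*} [TopologicalSpace HG]
variable {EN : Type*} [NormedAddCommGroup EN] [NormedSpace ℝ EN] {HN : Type*} [TopologicalSpace HN]
variable {EK : Type*} [NormedAddCommGroup EK] [NormedSpace ℝ EK] {HK : Type*} [TopologicalSpace HK]
variable {EX : Type*} [NormedAddCommGroup EX] [NormedSpace ℝ EX] {HX : Type*} [TopologicalSpace HX]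
variable {EY : Type*} [NormedAddCommGroup EY] [NormedSpace ℝ EY] {HY : Type*} [TopologicalSpace HY]
variable {M : Type*} [TopologicalSpace M] [ChartedSpace HM M]
variable {G : Type*} [TopologicalSpace G] [ChartedSpace HG G]
variable {N : Type*} [TopologicalSpace N] [ChartedSpace HN N]
variable {K : Type*} [TopologicalSpace K] [ChartedSpace HK K]
variable {X : Type*} [TopologicalSpace X] [ChartedSpace HX X]
variable {Y : Type*} [TopologicalSpace Y] [ChartedSpace HY Y]

/-- `(X, L.moment, L.act)` is a left module of the Lie groupoid `𝒢`. -/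
structure IsLeftModule (IM : ModelWithCorners ℝ EM HM) (IG : ModelWithCorners ℝ EG HG)
    (IX : ModelWithCorners ℝ EX HX) (𝒢 : GroupoidMaps M G) (L : LeftActionMaps M G X) : Prop where
  manifold : IsSmoothManifold IX X
  contMDiff_moment : ContMDiff IX IM ∞ L.moment
  contMDiffOn_act : ContMDiffOn (IG.prod IX) IX ∞ (fun q : G × X => L.act q.1 q.2)
    {q | 𝒢.src q.1 = L.moment q.2}
  moment_act : ∀ g x, 𝒢.src g = L.moment x → L.moment (L.act g x) = 𝒢.tgt g
  one_act : ∀ x, L.act (𝒢.one (L.moment x)) x = x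
  act_act : ∀ h g x, 𝒢.src h = 𝒢.tgt g → 𝒢.src g = L.moment x →
    L.act h (L.act g x) = L.act (𝒢.mul h g) x

/-- `(X, R.moment, R.act)` is a right module of the Lie groupoid `𝒢`. -/
structure IsRightModule (IM : ModelWithCorners ℝ EM HM) (IG : ModelWithCorners ℝ EG HG)
    (IX : ModelWithCorners ℝ EX HX) (𝒢 : GroupoidMaps M G) (R : RightActionMaps M G X) :
    Prop where
  manifold : IsSmoothManifold IX X
  contMDiff_moment : ContMDiff IX IM ∞ R.moment
  contMDiffOn_act : ContMDiffOn (IX.prod IG) IX ∞ (fun q : X × G => R.act q.1 q.2)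
    {q | R.moment q.1 = 𝒢.tgt q.2}
  moment_act : ∀ x g, R.moment x = 𝒢.tgt g → R.moment (R.act x g) = 𝒢.src g
  act_one : ∀ x, R.act x (𝒢.one (R.moment x)) = x
  act_act : ∀ x g h, R.moment x = 𝒢.tgt g → 𝒢.src g = 𝒢.tgt h →
    R.act (R.act x g) h = R.act x (𝒢.mul g h)

/-- `Θ : X → Y`, together with the morphism `(Φ, Φ₀)` of Lie groupoids, is a morphism from the
left `𝒢`-module `X` to the left `𝒦`-module `Y`. -/
structure IsLeftModuleMorphism (IM : ModelWithCorners ℝ EM HM) (IG : ModelWithCorners ℝ EG HG)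
    (IN : ModelWithCorners ℝ EN HN) (IK : ModelWithCorners ℝ EK HK)
    (IX : ModelWithCorners ℝ EX HX) (IY : ModelWithCorners ℝ EY HY)
    (𝒢 : GroupoidMaps M G) (𝒦 : GroupoidMaps N K) (L : LeftActionMaps M G X)
    (L' : LeftActionMaps N K Y) (Φ : G → K) (Φ₀ : M → N) (Θ : X → Y) : Prop where
  isMorphism : IsLieGroupoidMorphism IM IG IN IK 𝒢 𝒦 Φ Φ₀
  contMDiff : ContMDiff IX IY ∞ Θ
  moment_map : ∀ x, L'.moment (Θ x) = Φ₀ (L.moment x)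
  map_act : ∀ g x, 𝒢.src g = L.moment x → Θ (L.act g x) = L'.act (Φ g) (Θ x)

/-- `proj : X → Y` is a left principal `𝒢`-bundle for the action `L`. -/
structure IsLeftPrincipal (IM : ModelWithCorners ℝ EM HM) (IG : ModelWithCorners ℝ EG HG)
    (IX : ModelWithCorners ℝ EX HX) (IY : ModelWithCorners ℝ EY HY) (𝒢 : GroupoidMaps M G)
    (L : LeftActionMaps M G X) (proj : X → Y) : Prop where
  isLieGroupoid : IsLieGroupoid IM IG 𝒢
  manifold_base : IsSmoothManifold IY Y
  submersion : IsSurjSubmersion IX IY proj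
  isModule : IsLeftModule IM IG IX 𝒢 L
  proj_act : ∀ g x, 𝒢.src g = L.moment x → proj (L.act g x) = proj x
  principal : IsDiffeoBetween (IG.prod IX) (IX.prod IX)
    {q : G × X | 𝒢.src q.1 = L.moment q.2} {q : X × X | proj q.1 = proj q.2}
    (fun q => (L.act q.1 q.2, q.2))

/-- `proj : X → Y` is a right principal `𝒢`-bundle for the action `R`. -/
structure IsRightPrincipal (IM : ModelWithCorners ℝ EM HM) (IG : ModelWithCorners ℝ EG HG)
    (IX : ModelWithCorners ℝ EX HX) (IY : ModelWithCorners ℝ EY HY) (𝒢 : GroupoidMaps M G)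
    (R : RightActionMaps M G X) (proj : X → Y) : Prop where
  isLieGroupoid : IsLieGroupoid IM IG 𝒢
  manifold_base : IsSmoothManifold IY Y
  submersion : IsSurjSubmersion IX IY proj
  isModule : IsRightModule IM IG IX 𝒢 R
  proj_act : ∀ x g, R.moment x = 𝒢.tgt g → proj (R.act x g) = proj x
  principal : IsDiffeoBetween (IX.prod IG) (IX.prod IX)
    {q : X × G | R.moment q.1 = 𝒢.tgt q.2} {q : X × X | proj q.1 = proj q.2}
    (fun q => (q.1, R.act q.1 q.2))

/-- `X` is a (bi)principal `(𝒢, 𝒦)`-bibundle: the two actions commute, each moment map is invariant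
under the other action, and each moment map is a principal bundle for the other action. -/
structure IsPrincipalBibundle (IM : ModelWithCorners ℝ EM HM) (IG : ModelWithCorners ℝ EG HG)
    (IN : ModelWithCorners ℝ EN HN) (IK : ModelWithCorners ℝ EK HK)
    (IX : ModelWithCorners ℝ EX HX) (𝒢 : GroupoidMaps M G) (𝒦 : GroupoidMaps N K)
    (L : LeftActionMaps M G X) (R : RightActionMaps N K X) : Prop where
  commute : ∀ g x k, 𝒢.src g = L.moment x → R.moment x = 𝒦.tgt k →
    R.act (L.act g x) k = L.act g (R.act x k)
  left_moment_act : ∀ x k, R.moment x = 𝒦.tgt k → L.moment (R.act x k) = L.moment x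
  right_moment_act : ∀ g x, 𝒢.src g = L.moment x → R.moment (L.act g x) = R.moment x
  left_principal : IsLeftPrincipal IM IG IX IN 𝒢 L R.moment
  right_principal : IsRightPrincipal IN IK IX IM 𝒦 R L.moment

end Modules

/-! ## Fibre-bundle objects in Lie groupoids over a pair groupoid, and tridents -/

section Trident

variable {EB : Type*} [NormedAddCommGroup EB] [NormedSpace ℝ EB] {HB : Type*} [TopologicalSpace HB]
variable {E₀ : Type*} [NormedAddCommGroup E₀] [NormedSpace ℝ E₀] {H₀ : Type*} [TopologicalSpace H₀]
variable {E₁ : Type*} [NormedAddCommGroup E₁] [NormedSpace ℝ E₁] {H₁ : Type*} [TopologicalSpace H₁]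
variable {EN : Type*} [NormedAddCommGroup EN] [NormedSpace ℝ EN] {HN : Type*} [TopologicalSpace HN]
variable {EK : Type*} [NormedAddCommGroup EK] [NormedSpace ℝ EK] {HK : Type*} [TopologicalSpace HK]
variable {EM : Type*} [NormedAddCommGroup EM] [NormedSpace ℝ EM] {HM : Type*} [TopologicalSpace HM]
variable {EG : Type*} [NormedAddCommGroup EG] [NormedSpace ℝ EG] {HG : Type*} [TopologicalSpace HG]
variable {EP : Type*} [NormedAddCommGroup EP] [NormedSpace ℝ EP] {HP : Type*} [TopologicalSpace HP]
variable {B : Type*} [TopologicalSpace B] [ChartedSpace HB B]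
variable {M₁ : Type*} [TopologicalSpace M₁] [ChartedSpace H₀ M₁]
variable {G₁ : Type*} [TopologicalSpace G₁] [ChartedSpace H₁ G₁]
variable {M₂ : Type*} [TopologicalSpace M₂] [ChartedSpace HN M₂]
variable {G₂ : Type*} [TopologicalSpace G₂] [ChartedSpace HK G₂]
variable {M₃ : Type*} [TopologicalSpace M₃] [ChartedSpace HM M₃]
variable {G₃ : Type*} [TopologicalSpace G₃] [ChartedSpace HG G₃]
variable {P : Type*} [TopologicalSpace P] [ChartedSpace HP P]
variable {ι : Type*}

/-- The Lie groupoid `𝒢₁ = (G₁ ⇉ M₁)` is, through the projections `projG` and `projM` and in the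
local trivializations `v i j` and `u i`, a fibre-bundle object in the category of Lie groupoids
with base the pair groupoid of `B` and typical fibre `𝒢₃ = (G₃ ⇉ M₃)`: the pair `(projG, projM)` is
a morphism of Lie groupoids with surjective submersions as components, the domains `O i` of the
`u i` cover `B`, the `v i j` trivialize `projG` over `O i × O j`, and in these trivializations the
structure maps of `𝒢₁` become those of the product of the pair groupoid with `𝒢₃`. -/
structure IsGroupoidBundleOverPair (IB : ModelWithCorners ℝ EB HB)
    (I₀ : ModelWithCorners ℝ E₀ H₀) (I₁ : ModelWithCorners ℝ E₁ H₁)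
    (IM : ModelWithCorners ℝ EM HM) (IG : ModelWithCorners ℝ EG HG)
    (𝒢₁ : GroupoidMaps M₁ G₁) (𝒢₃ : GroupoidMaps M₃ G₃)
    (projG : G₁ → B × B) (projM : M₁ → B)
    (v : ι → ι → Trivialization G₃ projG) (u : ι → Trivialization M₃ projM) : Prop where
  isLieGroupoid_total : IsLieGroupoid I₀ I₁ 𝒢₁
  isLieGroupoid_base : IsLieGroupoid IB (IB.prod IB) (pairGroupoid B)
  isLieGroupoid_fibre : IsLieGroupoid IM IG 𝒢₃
  isMorphism : IsLieGroupoidMorphism I₀ I₁ IB (IB.prod IB) 𝒢₁ (pairGroupoid B) projG projM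
  submersion_arr : IsSurjSubmersion I₁ (IB.prod IB) projG
  submersion_obj : IsSurjSubmersion I₀ IB projM
  smooth_arr : ∀ i j, IsSmoothTrivialization I₁ (IB.prod IB) IG (v i j)
  smooth_obj : ∀ i, IsSmoothTrivialization I₀ IB IM (u i)
  cover : ∀ b, ∃ i, b ∈ (u i).baseSet
  baseSet_arr : ∀ i j, (v i j).baseSet = (u i).baseSet ×ˢ (u j).baseSet
  src_triv : ∀ i j, ∀ a ∈ (v i j).source,
    u j (𝒢₁.src a) = ((projG a).2, 𝒢₃.src (v i j a).2)
  tgt_triv : ∀ i j, ∀ a ∈ (v i j).source,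
    u i (𝒢₁.tgt a) = ((projG a).1, 𝒢₃.tgt (v i j a).2)
  one_triv : ∀ i, ∀ x ∈ (u i).source,
    v i i (𝒢₁.one x) = ((projM x, projM x), 𝒢₃.one (u i x).2)
  inv_triv : ∀ i j, ∀ a ∈ (v i j).source,
    v j i (𝒢₁.inv a) = ((projG a).swap, 𝒢₃.inv (v i j a).2)
  mul_triv : ∀ i j k, ∀ a ∈ (v i j).source, ∀ b ∈ (v j k).source, 𝒢₁.src a = 𝒢₁.tgt b →
    v i k (𝒢₁.mul a b) = (((projG a).1, (projG b).2), 𝒢₃.mul (v i j a).2 (v j k b).2)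

/-- The quintuple `(𝒢₁, P, 𝒢₂; B, 𝒢₃)` is a (left) trident, with left action `L`, right action `R`,
bundle projection `proj : P → B`, groupoid projections `(projG, projM)` from `𝒢₁` to the pair
groupoid of `B`, and local trivializations `v`, `u`, `w` of `G₁`, `M₁`, `P` in which all structures
take their model form. -/
structure IsTrident (IB : ModelWithCorners ℝ EB HB)
    (I₀ : ModelWithCorners ℝ E₀ H₀) (I₁ : ModelWithCorners ℝ E₁ H₁)
    (IN : ModelWithCorners ℝ EN HN) (IK : ModelWithCorners ℝ EK HK)
    (IM : ModelWithCorners ℝ EM HM) (IG : ModelWithCorners ℝ EG HG)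
    (IP : ModelWithCorners ℝ EP HP)
    (𝒢₁ : GroupoidMaps M₁ G₁) (𝒢₂ : GroupoidMaps M₂ G₂) (𝒢₃ : GroupoidMaps M₃ G₃)
    (L : LeftActionMaps M₁ G₁ P) (R : RightActionMaps M₂ G₂ P) (proj : P → B)
    (projG : G₁ → B × B) (projM : M₁ → B)
    (v : ι → ι → Trivialization G₃ projG) (u : ι → Trivialization M₃ projM)
    (w : ι → Trivialization G₃ proj) : Prop where
  bibundle : IsPrincipalBibundle I₀ I₁ IN IK IP 𝒢₁ 𝒢₂ L R
  fibreBundle : IsSmoothFibreBundle IP IB IG G₃ proj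
  proj_right_act : ∀ p k, R.moment p = 𝒢₂.tgt k → proj (R.act p k) = proj p
  groupoidBundle : IsGroupoidBundleOverPair IB I₀ I₁ IM IG 𝒢₁ 𝒢₃ projG projM v u
  covers : IsLeftModuleMorphism I₀ I₁ IB (IB.prod IB) IP IB 𝒢₁ (pairGroupoid B) L (pairAction B)
    projG projM proj
  smooth_triv : ∀ i, IsSmoothTrivialization IP IB IG (w i)
  baseSet_triv : ∀ i, (w i).baseSet = (u i).baseSet
  moment_triv : ∀ i, ∀ p ∈ (w i).source, u i (L.moment p) = (proj p, 𝒢₃.tgt (w i p).2)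
  act_triv : ∀ i j, ∀ a ∈ (v i j).source, ∀ p ∈ (w j).source, 𝒢₁.src a = L.moment p →
    w i (L.act a p) = ((projG a).1, 𝒢₃.mul (v i j a).2 (w j p).2)

end Trident

/-! ## Principaloid bundles -/

section Principaloid

variable {EM : Type*} [NormedAddCommGroup EM] [NormedSpace ℝ EM] {HM : Type*} [TopologicalSpace HM]
variable {EG : Type*} [NormedAddCommGroup EG] [NormedSpace ℝ EG] {HG : Type*} [TopologicalSpace HG]
variable {EB : Type*} [NormedAddCommGroup EB] [NormedSpace ℝ EB] {HB : Type*} [TopologicalSpace HB]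
variable {EP : Type*} [NormedAddCommGroup EP] [NormedSpace ℝ EP] {HP : Type*} [TopologicalSpace HP]
variable {IM : ModelWithCorners ℝ EM HM} {IG : ModelWithCorners ℝ EG HG}
variable {M : Type*} [TopologicalSpace M] [ChartedSpace HM M]
variable {G : Type*} [TopologicalSpace G] [ChartedSpace HG G]

/-- A principaloid `𝒢`-bundle with total space `P` and base `B`: a fibre bundle with typical fibre
the arrow manifold `G`, with a fibrewise right `𝒢`-action on `P`, and with an open cover of the base
with local trivializations `triv i` that are `𝒢`-equivariant diffeomorphisms, for the action of
`𝒢` on `G` by right translations, whose moment map is the source map. The index type of the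
trivializing cover is arbitrary. -/
structure PrincipaloidBundle (𝒢 : LieGroupoid IM M IG G)
    (IB : ModelWithCorners ℝ EB HB) (B : Type*) [TopologicalSpace B] [ChartedSpace HB B]
    (IP : ModelWithCorners ℝ EP HP) (P : Type*) [TopologicalSpace P] [ChartedSpace HP P]
    (ι : Type*) where
  manifold_base : IsSmoothManifold IB B
  proj : P → B
  submersion : IsSurjSubmersion IP IB proj
  right : RightActionMaps M G P
  isRightModule : IsRightModule IM IG IP 𝒢.toGroupoidMaps right
  proj_act : ∀ p g, right.moment p = 𝒢.tgt g → proj (right.act p g) = proj p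
  triv : ι → Trivialization G proj
  smooth_triv : ∀ i, IsSmoothTrivialization IP IB IG (triv i)
  cover : ∀ b, ∃ i, b ∈ (triv i).baseSet
  moment_triv : ∀ i, ∀ p ∈ (triv i).source, right.moment p = 𝒢.src (triv i p).2
  act_triv : ∀ i, ∀ p ∈ (triv i).source, ∀ g, right.moment p = 𝒢.tgt g →
    triv i (right.act p g) = (proj p, 𝒢.mul (triv i p).2 g)

namespace PrincipaloidBundle

variable {𝒢 : LieGroupoid IM M IG G}
variable {IB : ModelWithCorners ℝ EB HB} {B : Type*} [TopologicalSpace B] [ChartedSpace HB B]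
variable {IP : ModelWithCorners ℝ EP HP} {P : Type*} [TopologicalSpace P] [ChartedSpace HP P]
variable {ι : Type*} (Q : PrincipaloidBundle 𝒢 IB B IP P ι)

/-- The domain `Oᵢ` of the `i`-th trivialization. -/
def dom (i : ι) : Set B := (Q.triv i).baseSet

/-- The point `[(b, g, i)]` of `P` with coordinates `(b, g)` in the `i`-th trivialization
(meaningful for `b ∈ Oᵢ`). -/
def pt (i : ι) (b : B) (g : G) : P := (Q.triv i).toOpenPartialHomeomorph.symm (b, g)

/-- The transition cocycle `βᵢⱼ`, as a map `Oᵢ ∩ Oⱼ → M → G`: over `b`, the change of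
trivialization from `j` to `i` is the left multiplication by the bisection `βᵢⱼ(b)`, whose value at
`m` is the image of the unit at `m`. -/
def cocycle (i j : ι) (b : B) (m : M) : G := (Q.triv i (Q.pt j b (𝒢.one m))).2

/-- The shadow action `t_* βᵢⱼ(b)` on `M`. -/
def shadowAct (i j : ι) (b : B) (m : M) : M := 𝒢.tgt (Q.cocycle i j b m)

/-- Left multiplication `βᵢⱼ(b) ▷ g = βᵢⱼ(b)(t g) · g`. -/
def leftMul (i j : ι) (b : B) (g : G) : G := 𝒢.mul (Q.cocycle i j b (𝒢.tgt g)) g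

/-- Right multiplication by the inverse bisection, `g ◁ βᵢⱼ(b)⁻¹ = g · (βᵢⱼ(b)(s g))⁻¹`. -/
def rightMulInv (i j : ι) (b : B) (g : G) : G :=
  𝒢.mul g (𝒢.inv (Q.cocycle i j b (𝒢.src g)))

/-- Some index of a trivialization whose domain contains `b`. -/
noncomputable def index (b : B) : ι := (Q.cover b).choose

theorem mem_dom_index (b : B) : b ∈ Q.dom (Q.index b) := (Q.cover b).choose_spec

theorem triv_pt {i : ι} {b : B} (hb : b ∈ Q.dom i) (g : G) : Q.triv i (Q.pt i b g) = (b, g) :=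
  (Q.triv i).apply_symm_apply' hb

theorem proj_pt {i : ι} {b : B} (hb : b ∈ Q.dom i) (g : G) : Q.proj (Q.pt i b g) = b :=
  (Q.triv i).proj_symm_apply' hb

theorem pt_mem_source {i j : ι} {b : B} (hi : b ∈ Q.dom i) (hj : b ∈ Q.dom j) (g : G) :
    Q.pt j b g ∈ (Q.triv i).source := by
  rw [(Q.triv i).mem_source, Q.proj_pt hj]; exact hi

theorem moment_pt {i : ι} {b : B} (hb : b ∈ Q.dom i) (g : G) :
    Q.right.moment (Q.pt i b g) = 𝒢.src g := by
  rw [Q.moment_triv i _ (Q.pt_mem_source hb hb g), Q.triv_pt hb]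

theorem src_change {i j : ι} {b : B} (hi : b ∈ Q.dom i) (hj : b ∈ Q.dom j) (g : G) :
    𝒢.src (Q.triv i (Q.pt j b g)).2 = 𝒢.src g := by
  rw [← Q.moment_triv i _ (Q.pt_mem_source hi hj g), Q.moment_pt hj]

theorem src_cocycle {i j : ι} {b : B} (hi : b ∈ Q.dom i) (hj : b ∈ Q.dom j) (m : M) :
    𝒢.src (Q.cocycle i j b m) = m := by
  rw [cocycle, Q.src_change hi hj, 𝒢.isLieGroupoid.src_one]

theorem pt_triv {i : ι} {p : P} (hp : Q.proj p ∈ Q.dom i) :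
    Q.pt i (Q.proj p) (Q.triv i p).2 = p :=
  (Q.triv i).symm_apply_mk_proj ((Q.triv i).mem_source.2 hp)

theorem pt_mul {i : ι} {b : B} (hi : b ∈ Q.dom i) (g h : G) (hgh : 𝒢.src g = 𝒢.tgt h) :
    Q.right.act (Q.pt i b g) h = Q.pt i b (𝒢.mul g h) := by
  have hm : Q.right.moment (Q.pt i b g) = 𝒢.tgt h := by rw [Q.moment_pt hi, hgh]
  have hpr : Q.proj (Q.right.act (Q.pt i b g) h) = b := by
    rw [Q.proj_act _ _ hm, Q.proj_pt hi]
  have h1 := Q.pt_triv (i := i) (p := Q.right.act (Q.pt i b g) h) (by rw [hpr]; exact hi)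
  rw [hpr, Q.act_triv i _ (Q.pt_mem_source hi hi g) h hm, Q.triv_pt hi] at h1
  exact h1.symm

/-- The change of trivialization from `j` to `i` is the left multiplication by `βᵢⱼ`. -/
theorem change_eq_leftMul {i j : ι} {b : B} (hi : b ∈ Q.dom i) (hj : b ∈ Q.dom j) (g : G) :
    (Q.triv i (Q.pt j b g)).2 = Q.leftMul i j b g := by
  have hg := 𝒢.isLieGroupoid
  have hc : 𝒢.src (𝒢.one (𝒢.tgt g)) = 𝒢.tgt g := hg.src_one _
  have h1 := Q.pt_mul hj (𝒢.one (𝒢.tgt g)) g hc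
  rw [hg.one_mul] at h1
  rw [← h1, Q.act_triv i _ (Q.pt_mem_source hi hj _) g (by rw [Q.moment_pt hj, hc])]
  rfl

theorem tgt_leftMul {i j : ι} {b : B} (hi : b ∈ Q.dom i) (hj : b ∈ Q.dom j) (g : G) :
    𝒢.tgt (Q.leftMul i j b g) = Q.shadowAct i j b (𝒢.tgt g) :=
  𝒢.isLieGroupoid.tgt_mul _ _ (Q.src_cocycle hi hj _)

theorem src_leftMul {i j : ι} {b : B} (hi : b ∈ Q.dom i) (hj : b ∈ Q.dom j) (g : G) :
    𝒢.src (Q.leftMul i j b g) = 𝒢.src g :=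
  𝒢.isLieGroupoid.src_mul _ _ (Q.src_cocycle hi hj _)

theorem leftMul_self {i : ι} {b : B} (hi : b ∈ Q.dom i) (g : G) : Q.leftMul i i b g = g := by
  rw [← Q.change_eq_leftMul hi hi, Q.triv_pt hi]

theorem leftMul_leftMul {i j k : ι} {b : B} (hi : b ∈ Q.dom i) (hj : b ∈ Q.dom j)
    (hk : b ∈ Q.dom k) (g : G) :
    Q.leftMul i j b (Q.leftMul j k b g) = Q.leftMul i k b g := by
  rw [← Q.change_eq_leftMul hi hj, ← Q.change_eq_leftMul hj hk, ← Q.change_eq_leftMul hi hk]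
  have h1 := Q.pt_triv (i := j) (p := Q.pt k b g) (by rw [Q.proj_pt hk]; exact hj)
  rw [Q.proj_pt hk] at h1
  rw [h1]

theorem leftMul_one {i j : ι} {b : B} (hi : b ∈ Q.dom i) (hj : b ∈ Q.dom j) (m : M) :
    Q.leftMul i j b (𝒢.one m) = Q.cocycle i j b m := by
  rw [← Q.change_eq_leftMul hi hj]; rfl

theorem cocycle_self {i : ι} {b : B} (hi : b ∈ Q.dom i) (m : M) :
    Q.cocycle i i b m = 𝒢.one m := by
  rw [← Q.leftMul_one hi hi, Q.leftMul_self hi]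

theorem cocycle_mul {i j k : ι} {b : B} (hi : b ∈ Q.dom i) (hj : b ∈ Q.dom j)
    (hk : b ∈ Q.dom k) (m : M) :
    𝒢.mul (Q.cocycle i j b (Q.shadowAct j k b m)) (Q.cocycle j k b m) = Q.cocycle i k b m := by
  have h1 := Q.leftMul_leftMul hi hj hk (𝒢.one m)
  rw [Q.leftMul_one hj hk, Q.leftMul_one hi hk] at h1
  exact h1

theorem shadowAct_shadowAct {i j k : ι} {b : B} (hi : b ∈ Q.dom i) (hj : b ∈ Q.dom j)
    (hk : b ∈ Q.dom k) (m : M) :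
    Q.shadowAct i j b (Q.shadowAct j k b m) = Q.shadowAct i k b m := by
  have h1 := congrArg 𝒢.tgt (Q.cocycle_mul hi hj hk m)
  exact (𝒢.isLieGroupoid.tgt_mul _ _ (Q.src_cocycle hi hj _)).symm.trans h1

theorem shadowAct_self {i : ι} {b : B} (hi : b ∈ Q.dom i) (m : M) :
    Q.shadowAct i i b m = m := by
  rw [shadowAct, Q.cocycle_self hi, 𝒢.isLieGroupoid.tgt_one]

theorem tgt_inv_cocycle {i j : ι} {b : B} (hi : b ∈ Q.dom i) (hj : b ∈ Q.dom j) (m : M) :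
    𝒢.tgt (𝒢.inv (Q.cocycle i j b m)) = m := by
  rw [𝒢.isLieGroupoid.tgt_inv, Q.src_cocycle hi hj]

theorem tgt_rightMulInv {i j : ι} {b : B} (hi : b ∈ Q.dom i) (hj : b ∈ Q.dom j) (g : G) :
    𝒢.tgt (Q.rightMulInv i j b g) = 𝒢.tgt g :=
  𝒢.isLieGroupoid.tgt_mul _ _ (Q.tgt_inv_cocycle hi hj _).symm

theorem src_rightMulInv {i j : ι} {b : B} (hi : b ∈ Q.dom i) (hj : b ∈ Q.dom j) (g : G) :
    𝒢.src (Q.rightMulInv i j b g) = Q.shadowAct i j b (𝒢.src g) := by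
  rw [rightMulInv, 𝒢.isLieGroupoid.src_mul _ _ (Q.tgt_inv_cocycle hi hj _).symm,
    𝒢.isLieGroupoid.src_inv]
  rfl

theorem inv_cocycle_mul {i j k : ι} {b : B} (hi : b ∈ Q.dom i) (hj : b ∈ Q.dom j)
    (hk : b ∈ Q.dom k) (m : M) :
    𝒢.mul (𝒢.inv (Q.cocycle j k b m)) (𝒢.inv (Q.cocycle i j b (Q.shadowAct j k b m))) =
      𝒢.inv (Q.cocycle i k b m) := by
  have hg := 𝒢.isLieGroupoid
  rw [← Q.cocycle_mul hi hj hk m]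
  exact hg.inv_mul_inv _ _ (Q.src_cocycle hi hj _)

theorem rightMulInv_rightMulInv {i j k : ι} {b : B} (hi : b ∈ Q.dom i) (hj : b ∈ Q.dom j)
    (hk : b ∈ Q.dom k) (g : G) :
    Q.rightMulInv i j b (Q.rightMulInv j k b g) = Q.rightMulInv i k b g := by
  have hg := 𝒢.isLieGroupoid
  have h1 : 𝒢.src (𝒢.inv (Q.cocycle j k b (𝒢.src g))) =
      𝒢.tgt (𝒢.inv (Q.cocycle i j b (Q.shadowAct j k b (𝒢.src g)))) := by
    rw [hg.src_inv, Q.tgt_inv_cocycle hi hj]; rfl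
  rw [rightMulInv, Q.src_rightMulInv hj hk, rightMulInv,
    hg.mul_assoc _ _ _ (Q.tgt_inv_cocycle hj hk _).symm h1, Q.inv_cocycle_mul hi hj hk]
  rfl

theorem rightMulInv_self {i : ι} {b : B} (hi : b ∈ Q.dom i) (g : G) :
    Q.rightMulInv i i b g = g := by
  rw [rightMulInv, Q.cocycle_self hi, 𝒢.isLieGroupoid.inv_one, 𝒢.isLieGroupoid.mul_one]

theorem leftMul_rightMulInv {i j k l : ι} {b c : B} (hi : b ∈ Q.dom i) (hj : b ∈ Q.dom j)
    (hk : c ∈ Q.dom k) (hl : c ∈ Q.dom l) (g : G) :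
    Q.leftMul i j b (Q.rightMulInv k l c g) = Q.rightMulInv k l c (Q.leftMul i j b g) := by
  rw [leftMul, Q.tgt_rightMulInv hk hl, rightMulInv, rightMulInv, Q.src_leftMul hi hj, leftMul,
    𝒢.isLieGroupoid.mul_assoc _ _ _ (Q.src_cocycle hi hj _) (Q.tgt_inv_cocycle hk hl _).symm]

theorem continuousOn_change (i j : ι) :
    ContinuousOn (fun q : B × G => Q.triv i (Q.pt j q.1 q.2))
      ((Q.dom i ∩ Q.dom j) ×ˢ univ) := by
  have h1 : ContinuousOn (fun q : B × G => Q.pt j q.1 q.2) ((Q.dom i ∩ Q.dom j) ×ˢ univ) :=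
    (Q.triv j).toOpenPartialHomeomorph.symm.continuousOn.mono fun q hq =>
      (Q.triv j).mem_target.2 hq.1.2
  exact (Q.triv i).toOpenPartialHomeomorph.continuousOn.comp h1 fun q hq =>
    Q.pt_mem_source hq.1.1 hq.1.2 _

theorem continuousOn_cocycle (i j : ι) :
    ContinuousOn (fun q : B × M => Q.cocycle i j q.1 q.2) ((Q.dom i ∩ Q.dom j) ×ˢ univ) := by
  have h1 : Continuous fun q : B × M => (q.1, 𝒢.one q.2) :=
    continuous_fst.prodMk (𝒢.isLieGroupoid.contMDiff_one.continuous.comp continuous_snd)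
  exact continuous_snd.comp_continuousOn
    ((Q.continuousOn_change i j).comp h1.continuousOn fun q hq => ⟨hq.1, trivial⟩)

theorem continuousOn_shadowAct (i j : ι) :
    ContinuousOn (fun q : B × M => Q.shadowAct i j q.1 q.2) ((Q.dom i ∩ Q.dom j) ×ˢ univ) :=
  𝒢.isLieGroupoid.tgt_submersion.contMDiff.continuous.comp_continuousOn
    (Q.continuousOn_cocycle i j)

theorem continuousOn_leftMul (i j : ι) :
    ContinuousOn (fun q : B × G => Q.leftMul i j q.1 q.2) ((Q.dom i ∩ Q.dom j) ×ˢ univ) :=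
  (continuous_snd.comp_continuousOn (Q.continuousOn_change i j)).congr fun _ hq =>
    (Q.change_eq_leftMul hq.1.1 hq.1.2 _).symm

theorem continuousOn_inv_cocycle (i j : ι) :
    ContinuousOn (fun q : B × M => 𝒢.inv (Q.cocycle i j q.1 q.2))
      ((Q.dom i ∩ Q.dom j) ×ˢ univ) :=
  𝒢.isLieGroupoid.contMDiff_inv.continuous.comp_continuousOn (Q.continuousOn_cocycle i j)

theorem continuousOn_rightMulInv (i j : ι) :
    ContinuousOn (fun q : B × G => Q.rightMulInv i j q.1 q.2)
      ((Q.dom i ∩ Q.dom j) ×ˢ univ) := by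
  have h1 : Continuous fun q : B × G => (q.1, 𝒢.src q.2) :=
    continuous_fst.prodMk
      (𝒢.isLieGroupoid.src_submersion.contMDiff.continuous.comp continuous_snd)
  have h2 := (Q.continuousOn_inv_cocycle i j).comp (s := (Q.dom i ∩ Q.dom j) ×ˢ univ)
    h1.continuousOn fun q hq => ⟨hq.1, trivial⟩
  refine 𝒢.isLieGroupoid.contMDiffOn_mul.continuousOn.comp
    (continuous_snd.continuousOn.prodMk h2) fun q hq => ?_
  exact (Q.tgt_inv_cocycle hq.1.1 hq.1.2 _).symm

/-! ### The shadow bundle and the sitting-duck map -/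

/-- The clutching data of the shadow bundle: the manifolds `Oᵢ × M` are glued through the shadow
action `t_* βⱼᵢ` (the change of trivialization from `i` to `j`). -/
noncomputable def shadowCore : FiberBundleCore ι B M where
  baseSet := Q.dom
  isOpen_baseSet i := (Q.triv i).open_baseSet
  indexAt := Q.index
  mem_baseSet_at := Q.mem_dom_index
  coordChange i j b m := Q.shadowAct j i b m
  coordChange_self _ _ hb m := Q.shadowAct_self hb m
  continuousOn_coordChange i j :=
    (Q.continuousOn_shadowAct j i).mono fun _ hq => ⟨⟨hq.1.2, hq.1.1⟩, trivial⟩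
  coordChange_comp _ _ _ _ hb m := Q.shadowAct_shadowAct hb.2 hb.1.2 hb.1.1 m

/-- The total space `ℱ` of the shadow bundle. -/
def Shadow : Type _ := Q.shadowCore.TotalSpace

noncomputable instance : TopologicalSpace Q.Shadow := Q.shadowCore.toTopologicalSpace

/-- The smooth atlas of `ℱ`: charts of `B × M` composed with the local trivializations. -/
noncomputable instance : ChartedSpace (ModelProd HB HM) Q.Shadow :=
  letI : ChartedSpace (B × M) Q.Shadow :=
    inferInstanceAs (ChartedSpace (B × M) Q.shadowCore.TotalSpace)
  ChartedSpace.comp (ModelProd HB HM) (B × M) Q.Shadow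

/-- The bundle projection `ℱ → B`. -/
noncomputable def shadowProj : Q.Shadow → B := Q.shadowCore.proj

/-- The local trivializations of `ℱ`. -/
noncomputable def shadowTriv (i : ι) : Trivialization M Q.shadowProj := Q.shadowCore.localTriv i

/-- The point `[(b, m, i)]` of `ℱ` (meaningful for `b ∈ Oᵢ`). -/
noncomputable def shadowPt (i : ι) (b : B) (m : M) : Q.Shadow :=
  (Q.shadowTriv i).toOpenPartialHomeomorph.symm (b, m)

/-- The sitting-duck map `[(b, g, i)] ↦ [(b, t g, i)]`. -/
noncomputable def duck (p : P) : Q.Shadow :=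
  Q.shadowPt (Q.index (Q.proj p)) (Q.proj p) (𝒢.tgt (Q.triv (Q.index (Q.proj p)) p).2)

/-! ### The Atiyah–Ehresmann groupoid -/

/-- The right action of the inverse of the bisection `βᵢⱼ(b)` on `P`, `p ↦ p · (βᵢⱼ(b)(μ p))⁻¹`. -/
def actInv (i j : ι) (b : B) (p : P) : P :=
  Q.right.act p (𝒢.inv (Q.cocycle i j b (Q.right.moment p)))

theorem moment_actInv {i j : ι} {b : B} (hi : b ∈ Q.dom i) (hj : b ∈ Q.dom j) (p : P) :
    Q.right.moment (Q.actInv i j b p) = Q.shadowAct i j b (Q.right.moment p) := by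
  rw [actInv, Q.isRightModule.moment_act _ _ (Q.tgt_inv_cocycle hi hj _).symm,
    𝒢.isLieGroupoid.src_inv]
  rfl

theorem actInv_self {i : ι} {b : B} (hi : b ∈ Q.dom i) (p : P) : Q.actInv i i b p = p := by
  rw [actInv, Q.cocycle_self hi, 𝒢.isLieGroupoid.inv_one, Q.isRightModule.act_one]

theorem actInv_actInv {i j k : ι} {b : B} (hi : b ∈ Q.dom i) (hj : b ∈ Q.dom j)
    (hk : b ∈ Q.dom k) (p : P) : Q.actInv i j b (Q.actInv j k b p) = Q.actInv i k b p := by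
  have h1 : 𝒢.src (𝒢.inv (Q.cocycle j k b (Q.right.moment p))) =
      𝒢.tgt (𝒢.inv (Q.cocycle i j b (Q.shadowAct j k b (Q.right.moment p)))) := by
    rw [𝒢.isLieGroupoid.src_inv, Q.tgt_inv_cocycle hi hj]; rfl
  rw [actInv, Q.moment_actInv hj hk, actInv,
    Q.isRightModule.act_act _ _ _ (Q.tgt_inv_cocycle hj hk _).symm h1,
    Q.inv_cocycle_mul hi hj hk]
  rfl

/-- The clutching data of the Atiyah bundle, the bundle over `B` associated with the principaloid
bundle, with typical fibre `P`: the manifolds `P × Oᵢ` are glued through the right action of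
`βⱼᵢ(b)⁻¹` on `P`. -/
noncomputable def atiyahBundleCore : FiberBundleCore ι B P where
  baseSet := Q.dom
  isOpen_baseSet i := (Q.triv i).open_baseSet
  indexAt := Q.index
  mem_baseSet_at := Q.mem_dom_index
  coordChange i j b p := Q.actInv j i b p
  coordChange_self _ _ hb p := Q.actInv_self hb p
  continuousOn_coordChange i j := by
    have h1 : Continuous fun q : B × P => (q.1, Q.right.moment q.2) :=
      continuous_fst.prodMk (Q.isRightModule.contMDiff_moment.continuous.comp continuous_snd)
    have h2 := (Q.continuousOn_inv_cocycle j i).comp (s := (Q.dom i ∩ Q.dom j) ×ˢ univ)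
      h1.continuousOn fun q hq => ⟨⟨hq.1.2, hq.1.1⟩, trivial⟩
    refine Q.isRightModule.contMDiffOn_act.continuousOn.comp
      (continuous_snd.continuousOn.prodMk h2) fun q hq => ?_
    exact (Q.tgt_inv_cocycle hq.1.2 hq.1.1 _).symm
  coordChange_comp _ _ _ _ hb p := Q.actInv_actInv hb.2 hb.1.2 hb.1.1 p

/-- The total space of the Atiyah bundle with typical fibre `P`. -/
def AtiyahBundle : Type _ := Q.atiyahBundleCore.TotalSpace

noncomputable instance : TopologicalSpace Q.AtiyahBundle := Q.atiyahBundleCore.toTopologicalSpace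

noncomputable instance : ChartedSpace (ModelProd HB HP) Q.AtiyahBundle :=
  letI : ChartedSpace (B × P) Q.AtiyahBundle :=
    inferInstanceAs (ChartedSpace (B × P) Q.atiyahBundleCore.TotalSpace)
  ChartedSpace.comp (ModelProd HB HP) (B × P) Q.AtiyahBundle

/-- The point `[(p, b)]` of the Atiyah bundle represented in `P × Oᵢ` (meaningful for `b ∈ Oᵢ`). -/
noncomputable def atiyahBundlePt (i : ι) (p : P) (b : B) : Q.AtiyahBundle :=
  (Q.atiyahBundleCore.localTriv i).toOpenPartialHomeomorph.symm (b, p)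

/-- The clutching data of `At(P)` in its resolved model: the manifolds `Oᵢ × G × Oⱼ` are glued
through `(b₁, g, b₂, i, j) ∼ (b₁, βₖᵢ(b₁) ▷ g ◁ βₗⱼ(b₂)⁻¹, b₂, k, l)`. -/
noncomputable def atCore : FiberBundleCore (ι × ι) (B × B) G where
  baseSet x := Q.dom x.1 ×ˢ Q.dom x.2
  isOpen_baseSet x := (Q.triv x.1).open_baseSet.prod (Q.triv x.2).open_baseSet
  indexAt b := (Q.index b.1, Q.index b.2)
  mem_baseSet_at b := ⟨Q.mem_dom_index b.1, Q.mem_dom_index b.2⟩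
  coordChange x y b g := Q.rightMulInv y.2 x.2 b.2 (Q.leftMul y.1 x.1 b.1 g)
  coordChange_self x b hb g := by rw [Q.leftMul_self hb.1, Q.rightMulInv_self hb.2]
  continuousOn_coordChange x y := by
    have h1 : Continuous fun q : (B × B) × G => (q.1.1, q.2) := by fun_prop
    have h2 := (Q.continuousOn_leftMul y.1 x.1).comp
      (s := ((Q.dom x.1 ×ˢ Q.dom x.2) ∩ (Q.dom y.1 ×ˢ Q.dom y.2)) ×ˢ univ)
      h1.continuousOn fun q hq => ⟨⟨hq.1.2.1, hq.1.1.1⟩, trivial⟩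
    have h3 : Continuous fun q : (B × B) × G => q.1.2 := by fun_prop
    exact (Q.continuousOn_rightMulInv y.2 x.2).comp (h3.continuousOn.prodMk h2)
      fun q hq => ⟨⟨hq.1.2.2, hq.1.1.2⟩, trivial⟩
  coordChange_comp x y z b hb g := by
    rw [Q.leftMul_rightMulInv hb.2.1 hb.1.2.1 hb.1.2.2 hb.1.1.2,
      Q.leftMul_leftMul hb.2.1 hb.1.2.1 hb.1.1.1,
      Q.rightMulInv_rightMulInv hb.2.2 hb.1.2.2 hb.1.1.2]

/-- The arrow space `At(P)` of the Atiyah–Ehresmann groupoid. -/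
def Atiyah : Type _ := Q.atCore.TotalSpace

noncomputable instance : TopologicalSpace Q.Atiyah := Q.atCore.toTopologicalSpace

/-- The smooth atlas of `At(P)`: charts of `(B × B) × G` composed with the local trivializations. -/
noncomputable instance : ChartedSpace (ModelProd (ModelProd HB HB) HG) Q.Atiyah :=
  letI : ChartedSpace ((B × B) × G) Q.Atiyah :=
    inferInstanceAs (ChartedSpace ((B × B) × G) Q.atCore.TotalSpace)
  ChartedSpace.comp (ModelProd (ModelProd HB HB) HG) ((B × B) × G) Q.Atiyah

/-- The projection `At(P) → B × B`, `[(b₁, g, b₂, i, j)] ↦ (b₁, b₂)`. -/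
noncomputable def atProj : Q.Atiyah → B × B := Q.atCore.proj

/-- The local trivializations of `At(P)`, over `Oᵢ × Oⱼ`. -/
noncomputable def atTriv (i j : ι) : Trivialization G Q.atProj := Q.atCore.localTriv (i, j)

/-- The point `[(b₁, g, b₂, i, j)]` of `At(P)` (meaningful for `b₁ ∈ Oᵢ`, `b₂ ∈ Oⱼ`). -/
noncomputable def atPt (i j : ι) (b₁ : B) (g : G) (b₂ : B) : Q.Atiyah :=
  (Q.atTriv i j).toOpenPartialHomeomorph.symm ((b₁, b₂), g)

/-- The entry `b₁` of `[(b₁, g, b₂, i, j)]`. -/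
noncomputable def leftEnd (a : Q.Atiyah) : B := (Q.atProj a).1

/-- The entry `b₂` of `[(b₁, g, b₂, i, j)]`. -/
noncomputable def rightEnd (a : Q.Atiyah) : B := (Q.atProj a).2

/-- The entry `g` of the representative `(b₁, g, b₂, i, j)` of an element of `At(P)`, for the chosen
indices `i` and `j` at `b₁` and `b₂`. -/
noncomputable def arrow (a : Q.Atiyah) : G :=
  (Q.atTriv (Q.index (Q.leftEnd a)) (Q.index (Q.rightEnd a)) a).2

/-- The structure maps of the Atiyah–Ehresmann groupoid `At(P) ⇉ ℱ`, computed on the chosen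
representatives:
`S [(b₁, g, b₂, i, j)] = [(b₂, s g, j)]`, `T [(b₁, g, b₂, i, j)] = [(b₁, t g, i)]`,
`I [(b, m, i)] = [(b, Id m, b, i, i)]`, `J [(b₁, g, b₂, i, j)] = [(b₂, g⁻¹, b₁, j, i)]` and
`M ([(b₁, g, b₂, i, j)], [(b₂, h, b₃, k, l)]) = [(b₁, g · (βⱼₖ(b₂) ▷ h), b₃, i, l)]`. -/
noncomputable def atGroupoid : GroupoidMaps Q.Shadow Q.Atiyah where
  src a := Q.shadowPt (Q.index (Q.rightEnd a)) (Q.rightEnd a) (𝒢.src (Q.arrow a))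
  tgt a := Q.shadowPt (Q.index (Q.leftEnd a)) (Q.leftEnd a) (𝒢.tgt (Q.arrow a))
  one x := Q.atPt (Q.index (Q.shadowProj x)) (Q.index (Q.shadowProj x)) (Q.shadowProj x)
    (𝒢.one (Q.shadowTriv (Q.index (Q.shadowProj x)) x).2) (Q.shadowProj x)
  inv a := Q.atPt (Q.index (Q.rightEnd a)) (Q.index (Q.leftEnd a)) (Q.rightEnd a)
    (𝒢.inv (Q.arrow a)) (Q.leftEnd a)
  mul a c := Q.atPt (Q.index (Q.leftEnd a)) (Q.index (Q.rightEnd c)) (Q.leftEnd a)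
    (𝒢.mul (Q.arrow a)
      (Q.leftMul (Q.index (Q.rightEnd a)) (Q.index (Q.leftEnd c)) (Q.rightEnd a) (Q.arrow c)))
    (Q.rightEnd c)

/-! ### The actions of the Atiyah–Ehresmann groupoid -/

/-- The moment map `D` and the left action of `At(P)` on `P`,
`([(b₁, g, b₂, i, j)], [(b₂, h, k)]) ↦ [(b₁, g · (βⱼₖ(b₂) ▷ h), i)]`,
computed on the chosen representatives. -/
noncomputable def leftP : LeftActionMaps Q.Shadow Q.Atiyah P where
  moment := Q.duck
  act a p := Q.pt (Q.index (Q.leftEnd a)) (Q.leftEnd a)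
    (𝒢.mul (Q.arrow a) (Q.leftMul (Q.index (Q.rightEnd a)) (Q.index (Q.proj p)) (Q.rightEnd a)
      (Q.triv (Q.index (Q.proj p)) p).2))

/-- The moment map `id` and the left action of `At(P)` on `ℱ`,
`([(b₁, g, b₂, i, j)], [(b₂, m, k)]) ↦ [(b₁, t g, i)]`, computed on the chosen representatives. -/
noncomputable def leftShadow : LeftActionMaps Q.Shadow Q.Atiyah Q.Shadow where
  moment := id
  act a _ := Q.shadowPt (Q.index (Q.leftEnd a)) (Q.leftEnd a) (𝒢.tgt (Q.arrow a))

end PrincipaloidBundle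

end Principaloid

end Principaloid

/-! Equivariance forces every change of trivialisation of `P` to be left translation by a bisection
`βᵢⱼ(b)`, and left translations commute with right multiplications. So in coordinates an arrow of
`At(P)` is a triple `(b₁, g, b₂)`, a point of `P` is a pair `(b, h)`, and all structure is that of
`𝒢` with base points carried along: `D` is `t`, `μ` is `s`, and both the product of `At(P)` and its
action on `P` are the multiplication of `𝒢`. It remains to see that this does not depend on the
trivialisations and that it is smooth.

Independence: a change of trivialisation at an outer end multiplies by a bisection on the far left
or by an inverse bisection on the far right, and passes through products (`leftMul_mul`,
`mul_rightMulInv`). A change at the middle base point inserts `β(m)⁻¹ · β(m)`, which cancels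
(`rightMulInv_mul_leftMul`). This yields the coordinate formulas `duck_pt`, `src_atPt`, `tgt_atPt`,
`one_shadowPt`, `inv_atPt`, `mul_atPt` and `act_atPt_pt` for arbitrary indices, although the
definitions use the indices picked by `index`. Each algebraic axiom follows by choosing
representatives with equal indices over equal base points and quoting the same axiom for `𝒢`.

Smoothness: the clutching maps are smooth because `βᵢⱼ` is read off from smooth trivialisations, so
the glued spaces are manifolds with smooth trivialisations (`IsSmoothCore.isSmoothManifold`,
`IsSmoothCore.isSmoothTrivialization`). The function `index` has no continuity, so a structure map
is examined on open sets where the indices are frozen; there it is a structure map of `𝒢` between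
trivialisations. The submersions are locally products of a submersion of `𝒢` with an identity or a
projection on the base (`IsSmoothTrivialization.contMDiffAt_and_isSubmersiveAt`).

Principality: two points `[(b, g, i)]` and `[(c, h, j)]` with equal moment satisfy `s g = s h`, and
`g · h⁻¹` is the arrow of `At(P)` between them, even for `b ≠ c`. Two points with equal image under
`D` lie in one fibre and satisfy `t g = t h`, and `g⁻¹ · h` is the arrow of `𝒢` between them. These
divisions are smooth and invert the two shear maps (`isDiffeoBetween_left`,
`isDiffeoBetween_right`). -/

namespace Principaloid

/-! ### Smooth manifold structure on a fibre bundle with smooth clutching data -/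

section ComposedCharts

variable {E : Type*} [NormedAddCommGroup E] [NormedSpace ℝ E] {H : Type*} [TopologicalSpace H]
variable {I : ModelWithCorners ℝ E H}

/-- The preferred charts of the model space are identities, so the expression of `f` in extended
charts is `I ∘ f ∘ I.symm` itself. This is the form in which `isManifold_of_contDiffOn` asks for
coordinate changes. -/
theorem contDiffOn_of_contMDiffOn_model {f : H → H} {s : Set H} (hf : ContMDiffOn I I ∞ f s) :
    ContDiffOn ℝ ∞ (I ∘ f ∘ I.symm) (I.symm ⁻¹' s ∩ range I) := by
  rintro x ⟨hx, y, rfl⟩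
  have hy : y ∈ s := by simpa using hx
  have h1 := (contMDiffWithinAt_iff.1 (hf y hy)).2
  simpa only [mfld_simps, Function.comp_def, chartAt_self_eq] using h1

/-- A space with an atlas in a manifold `Y` whose coordinate changes are smooth is a manifold for
the composed charts. -/
theorem isManifold_comp {Y X : Type*} [TopologicalSpace Y] [ChartedSpace H Y] [IsManifold I ∞ Y]
    [TopologicalSpace X] [ChartedSpace Y X]
    (h : ∀ e ∈ atlas Y X, ∀ e' ∈ atlas Y X,
      ContMDiffOn I I ∞ (e.symm ≫ₕ e') (e.symm ≫ₕ e').source) :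
    letI := ChartedSpace.comp H Y X
    IsManifold I ∞ X := by
  let := ChartedSpace.comp H Y X
  refine isManifold_of_contDiffOn I ∞ X ?_
  rintro _ _ ⟨e, he, f, hf, rfl⟩ ⟨e', he', f', hf', rfl⟩
  have h1 : ContMDiffOn I I ∞ f.symm f.target :=
    contMDiffOn_symm_of_mem_maximalAtlas (IsManifold.subset_maximalAtlas hf)
  have h2 : ContMDiffOn I I ∞ f' f'.source :=
    contMDiffOn_of_mem_maximalAtlas (IsManifold.subset_maximalAtlas hf')
  refine contDiffOn_of_contMDiffOn_model
    (f := ((e.trans f).symm ≫ₕ (e'.trans f'))) ?_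
  -- The coordinate change factors as a chart of `Y`, after the change from `e` to `e'` (smooth
  -- between open subsets of `Y`), after an inverse chart of `Y`.
  have h3 := h2.comp' ((h e he e' he').comp' h1)
  refine h3.mono ?_
  intro x hx
  simp only [mfld_simps] at hx ⊢
  tauto

end ComposedCharts

/-! ### Total spaces of fibre bundle cores with smooth clutching maps -/

section Core

variable {EB : Type*} [NormedAddCommGroup EB] [NormedSpace ℝ EB] {HB : Type*} [TopologicalSpace HB]
variable {EF : Type*} [NormedAddCommGroup EF] [NormedSpace ℝ EF] {HF : Type*} [TopologicalSpace HF]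
variable {IB : ModelWithCorners ℝ EB HB} {IF : ModelWithCorners ℝ EF HF}
variable {ι B F : Type*} [TopologicalSpace B] [ChartedSpace HB B]
  [TopologicalSpace F] [ChartedSpace HF F]

/-- The clutching maps of a fibre bundle core are smooth. -/
def IsSmoothCore (IB : ModelWithCorners ℝ EB HB) (IF : ModelWithCorners ℝ EF HF)
    (Z : FiberBundleCore ι B F) : Prop :=
  ∀ i j, ContMDiffOn (IB.prod IF) IF ∞ (fun p : B × F => Z.coordChange i j p.1 p.2)
    ((Z.baseSet i ∩ Z.baseSet j) ×ˢ univ)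

/-- Charts of `B × F` composed with the local trivializations. -/
@[reducible] noncomputable def coreChartedSpace (Z : FiberBundleCore ι B F) :
    ChartedSpace (ModelProd HB HF) Z.TotalSpace :=
  ChartedSpace.comp (ModelProd HB HF) (B × F) Z.TotalSpace

attribute [local instance] coreChartedSpace

/-- A change of local trivialisation fixes the base point and applies the clutching map to the fibre
coordinate, so only the second component carries a hypothesis. -/
theorem IsSmoothCore.contMDiffOn_trivChange {Z : FiberBundleCore ι B F}
    (hZ : IsSmoothCore IB IF Z) (i j : ι) :
    ContMDiffOn (IB.prod IF) (IB.prod IF) ∞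
      ((Z.localTriv i).toOpenPartialHomeomorph.symm ≫ₕ (Z.localTriv j).toOpenPartialHomeomorph)
      ((Z.localTriv i).toOpenPartialHomeomorph.symm ≫ₕ
        (Z.localTriv j).toOpenPartialHomeomorph).source := by
  have h1 : ((Z.localTriv i).toOpenPartialHomeomorph.symm ≫ₕ
      (Z.localTriv j).toOpenPartialHomeomorph).source = (Z.baseSet i ∩ Z.baseSet j) ×ˢ univ :=
    (Z.localTrivAsPartialEquiv_trans i j).1
  rw [h1]
  refine (contMDiffOn_fst.prodMk (hZ i j)).congr fun p hp => ?_
  exact (Z.localTrivAsPartialEquiv_trans i j).2 (by exact h1 ▸ hp)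

theorem IsSmoothCore.isManifold [IsManifold IB ∞ B] [IsManifold IF ∞ F]
    {Z : FiberBundleCore ι B F} (hZ : IsSmoothCore IB IF Z) :
    IsManifold (IB.prod IF) ∞ Z.TotalSpace := by
  refine isManifold_comp ?_
  rintro _ ⟨_, ⟨i, rfl⟩, rfl⟩ _ ⟨_, ⟨j, rfl⟩, rfl⟩
  exact hZ.contMDiffOn_trivChange i j

/-- Near a point the `i`-th trivialisation is the chart there, followed by an inverse chart of `B ×
F` and by the smooth change of trivialisation from `j` to `i`. The inverse trivialisation is treated
by the reversed composite. -/
theorem IsSmoothCore.isSmoothTrivialization [IsManifold IB ∞ B] [IsManifold IF ∞ F]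
    {Z : FiberBundleCore ι B F} (hZ : IsSmoothCore IB IF Z) (i : ι) :
    IsSmoothTrivialization (IB.prod IF) IB IF (Z.localTriv i) := by
  have := hZ.isManifold
  constructor
  · intro x hx
    set j := Z.indexAt x.proj with hj
    have hxj : x ∈ (Z.localTriv j).source := Z.mem_baseSet_at x.proj
    set c := chartAt (ModelProd HB HF) (Z.localTriv j x) with hc
    -- The chart of the total space at `x` is by definition `Z.localTriv j` followed by `c`; this is
    -- the reason for taking `j` to be `Z.indexAt x.proj`.
    have h1 : ContMDiffOn (IB.prod IF) (IB.prod IF) ∞ _ _ :=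
      contMDiffOn_chart (I := IB.prod IF) (n := ∞) (x := x)
    have h2 : ContMDiffOn (IB.prod IF) (IB.prod IF) ∞ c.symm c.target := contMDiffOn_chart_symm
    have h3 := (hZ.contMDiffOn_trivChange j i).comp' (h2.comp' h1)
    have hcx : Z.localTriv j x ∈ c.source := mem_chart_source _ _
    set U : Set Z.TotalSpace := (((Z.localTriv j).toOpenPartialHomeomorph ≫ₕ c).source ∩
      (Z.localTriv i).source)
    have hU : IsOpen U := (OpenPartialHomeomorph.open_source _).inter
      (Z.localTriv i).open_source
    have hxU : x ∈ U := ⟨⟨hxj, hcx⟩, hx⟩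
    have h4 : ContMDiffOn (IB.prod IF) (IB.prod IF) ∞ (Z.localTriv i) U := by
      have key : ∀ y ∈ U, c.symm (c (Z.localTriv j y)) = Z.localTriv j y :=
        fun y hy => c.left_inv hy.1.2
      have key2 : ∀ y ∈ U, (Z.localTriv j).toOpenPartialHomeomorph.symm (Z.localTriv j y) = y :=
        fun y hy => (Z.localTriv j).toOpenPartialHomeomorph.left_inv hy.1.1
      refine (h3.mono fun y hy => ?_).congr fun y hy => ?_
      · refine ⟨⟨hy.1, c.map_source hy.1.2⟩, ?_⟩
        change c.symm (c (Z.localTriv j y)) ∈ ((Z.localTriv j).toOpenPartialHomeomorph.symm ≫ₕ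
          (Z.localTriv i).toOpenPartialHomeomorph).source
        rw [key y hy]
        refine ⟨(Z.localTriv j).toOpenPartialHomeomorph.map_source hy.1.1, ?_⟩
        exact (key2 y hy).symm ▸ hy.2
      · change Z.localTriv i y = Z.localTriv i
          ((Z.localTriv j).toOpenPartialHomeomorph.symm (c.symm (c (Z.localTriv j y))))
        rw [key y hy, key2 y hy]
    exact (h4.contMDiffAt (hU.mem_nhds hxU)).contMDiffWithinAt
  · intro z hz
    set x := (Z.localTriv i).toOpenPartialHomeomorph.symm z with hxdef
    have hx : x ∈ (Z.localTriv i).source :=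
      (Z.localTriv i).toOpenPartialHomeomorph.map_target hz
    set j := Z.indexAt x.proj with hj
    have hxj : x ∈ (Z.localTriv j).source := Z.mem_baseSet_at x.proj
    set c := chartAt (ModelProd HB HF) (Z.localTriv j x) with hc
    set T := ((Z.localTriv i).toOpenPartialHomeomorph.symm ≫ₕ
      (Z.localTriv j).toOpenPartialHomeomorph) with hT
    have h1 : ContMDiffOn (IB.prod IF) (IB.prod IF) ∞ _ _ :=
      contMDiffOn_chart_symm (I := IB.prod IF) (n := ∞) (x := x)
    have h2 : ContMDiffOn (IB.prod IF) (IB.prod IF) ∞ c c.source := contMDiffOn_chart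
    have h3 := h1.comp' (h2.comp' (hZ.contMDiffOn_trivChange i j))
    have hcx : Z.localTriv j x ∈ c.source := mem_chart_source _ _
    have hU : IsOpen (T ≫ₕ c).source := OpenPartialHomeomorph.open_source _
    have hzU : z ∈ (T ≫ₕ c).source := ⟨⟨hz, hxj⟩, hcx⟩
    have h4 : ContMDiffOn (IB.prod IF) (IB.prod IF) ∞
        (Z.localTriv i).toOpenPartialHomeomorph.symm (T ≫ₕ c).source := by
      have key : ∀ y ∈ (T ≫ₕ c).source, c.symm (c (T y)) = T y := fun y hy => c.left_inv hy.2
      have key2 : ∀ y ∈ (T ≫ₕ c).source, (Z.localTriv j).toOpenPartialHomeomorph.symm (T y) =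
          (Z.localTriv i).toOpenPartialHomeomorph.symm y :=
        fun y hy => (Z.localTriv j).toOpenPartialHomeomorph.left_inv hy.1.2
      have hTt : ∀ y ∈ (T ≫ₕ c).source, T y ∈ (Z.localTriv j).target :=
        fun y hy => (Z.localTriv j).toOpenPartialHomeomorph.map_source hy.1.2
      refine (h3.mono fun y hy => ?_).congr fun y hy => ?_
      · refine ⟨⟨hy.1, hy.2⟩, c.map_source hy.2, ?_⟩
        change c.symm (c (T y)) ∈ (Z.localTriv j).target
        rw [key y hy]; exact hTt y hy
      · change _ = (Z.localTriv j).toOpenPartialHomeomorph.symm (c.symm (c (T y)))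
        rw [key y hy, key2 y hy]
    exact (h4.contMDiffAt (hU.mem_nhds hzU)).contMDiffWithinAt

/-- Points of one fibre lie in the domain of one trivialisation and are separated in `B × F`; points
of different fibres are separated in `B`. -/
theorem t2Space_totalSpace [T2Space B] [T2Space F] (Z : FiberBundleCore ι B F) :
    T2Space Z.TotalSpace := by
  refine ⟨fun x y hxy => ?_⟩
  by_cases hp : x.proj = y.proj
  · set e := Z.localTriv (Z.indexAt x.proj)
    have hx : x ∈ e.source := Z.mem_baseSet_at x.proj
    have hy : y ∈ e.source := by
      exact (Z.mem_localTriv_source _ _).2 (hp ▸ Z.mem_baseSet_at x.proj)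
    have hne : e x ≠ e y := fun h => hxy (e.toOpenPartialHomeomorph.injOn hx hy h)
    obtain ⟨u, v, hu, hv, hxu, hyv, huv⟩ := t2_separation hne
    exact ⟨_, _, e.toOpenPartialHomeomorph.isOpen_inter_preimage hu,
      e.toOpenPartialHomeomorph.isOpen_inter_preimage hv, ⟨hx, hxu⟩, ⟨hy, hyv⟩,
      (huv.preimage e).mono inter_subset_right inter_subset_right⟩
  · obtain ⟨u, v, hu, hv, hxu, hyv, huv⟩ := t2_separation hp
    exact ⟨_, _, hu.preimage Z.continuous_proj, hv.preimage Z.continuous_proj, hxu, hyv,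
      huv.preimage _⟩

/-- The index type may be uncountable, but countably many base sets already cover the second
countable space `B`, and the part of the total space over each is homeomorphic to an open subset of
`B × F`. -/
theorem secondCountableTopology_totalSpace [SecondCountableTopology B]
    [SecondCountableTopology F] (Z : FiberBundleCore ι B F) :
    SecondCountableTopology Z.TotalSpace := by
  obtain ⟨s, hs, hcov⟩ := TopologicalSpace.countable_cover_nhds (α := B)
    (f := fun b => Z.baseSet (Z.indexAt b))
    fun b => (Z.isOpen_baseSet _).mem_nhds (Z.mem_baseSet_at b)
  have : Countable s := hs.to_subtype
  have : ∀ b : s, SecondCountableTopology (Z.localTriv (Z.indexAt b)).source := fun b =>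
    (Z.localTriv (Z.indexAt b)).toOpenPartialHomeomorph.toHomeomorphSourceTarget.secondCountableTopology
  refine TopologicalSpace.secondCountableTopology_of_countable_cover
    (U := fun b : s => (Z.localTriv (Z.indexAt b)).source)
    (fun b => (Z.localTriv _).open_source) ?_
  refine eq_univ_of_forall fun x => ?_
  have : x.proj ∈ ⋃ b ∈ s, Z.baseSet (Z.indexAt b) := hcov ▸ mem_univ _
  simp only [mem_iUnion] at this ⊢
  obtain ⟨b, hb, hx⟩ := this
  exact ⟨⟨b, hb⟩, hx⟩

theorem IsSmoothCore.isSmoothManifold (hB : IsSmoothManifold IB B) (hF : IsSmoothManifold IF F)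
    {Z : FiberBundleCore ι B F} (hZ : IsSmoothCore IB IF Z) :
    IsSmoothManifold (IB.prod IF) Z.TotalSpace := by
  obtain ⟨_, _, _, _, _⟩ := hB
  obtain ⟨_, _, _, _, _⟩ := hF
  exact ⟨inferInstance, inferInstance, hZ.isManifold, t2Space_totalSpace Z,
    secondCountableTopology_totalSpace Z⟩

end Core

/-! ### Submersions at a point -/

section Submersive

variable {E : Type*} [NormedAddCommGroup E] [NormedSpace ℝ E] {H : Type*} [TopologicalSpace H]
variable {E' : Type*} [NormedAddCommGroup E'] [NormedSpace ℝ E'] {H' : Type*} [TopologicalSpace H']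
variable {E'' : Type*} [NormedAddCommGroup E''] [NormedSpace ℝ E'']
  {H'' : Type*} [TopologicalSpace H'']
variable {E₃ : Type*} [NormedAddCommGroup E₃] [NormedSpace ℝ E₃] {H₃ : Type*} [TopologicalSpace H₃]
variable {I : ModelWithCorners ℝ E H} {I' : ModelWithCorners ℝ E' H'}
variable {I'' : ModelWithCorners ℝ E'' H''} {I₃ : ModelWithCorners ℝ E₃ H₃}
variable {X : Type*} [TopologicalSpace X] [ChartedSpace H X]
variable {Y : Type*} [TopologicalSpace Y] [ChartedSpace H' Y]
variable {W : Type*} [TopologicalSpace W] [ChartedSpace H'' W]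
variable {V : Type*} [TopologicalSpace V] [ChartedSpace H₃ V]

/-- `f` is differentiable at `x` with surjective differential. -/
def IsSubmersiveAt (I : ModelWithCorners ℝ E H) (I' : ModelWithCorners ℝ E' H') (f : X → Y)
    (x : X) : Prop :=
  MDifferentiableAt I I' f x ∧ Surjective (mfderiv I I' f x)

theorem IsSubmersiveAt.comp {g : Y → W} {f : X → Y} {x : X}
    (hg : IsSubmersiveAt I' I'' g (f x)) (hf : IsSubmersiveAt I I' f x) :
    IsSubmersiveAt I I'' (g ∘ f) x := by
  refine ⟨hg.1.comp x hf.1, ?_⟩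
  rw [mfderiv_comp x hg.1 hf.1]
  exact hg.2.comp hf.2

theorem IsSubmersiveAt.congr {f g : X → Y} {x : X} (hf : IsSubmersiveAt I I' f x)
    (h : g =ᶠ[nhds x] f) : IsSubmersiveAt I I' g x :=
  ⟨hf.1.congr_of_eventuallyEq h, by rw [h.mfderiv_eq]; exact hf.2⟩

/-- A differentiable map with a differentiable local section through `x` is submersive at `x`. -/
theorem isSubmersiveAt_of_section {f : X → Y} {g : Y → X} {x : X}
    (hf : MDifferentiableAt I I' f x) (hg : MDifferentiableAt I' I g (f x)) (hx : g (f x) = x)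
    (h : f ∘ g =ᶠ[nhds (f x)] id) : IsSubmersiveAt I I' f x := by
  refine ⟨hf, fun v => ?_⟩
  -- By the chain rule for `f ∘ g`, which is the identity near `f x`, the differential of `g` is a
  -- right inverse of that of `f`.
  have h1 := mfderiv_comp_apply_of_eq _ hf hg hx v
  rw [h.mfderiv_eq, mfderiv_id] at h1
  exact ⟨mfderiv I' I g (f x) v, h1.symm⟩

theorem IsSubmersiveAt.prodMap {f : X → Y} {g : W → V} {p : X × W}
    (hf : IsSubmersiveAt I I' f p.1) (hg : IsSubmersiveAt I'' I₃ g p.2) :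
    IsSubmersiveAt (I.prod I'') (I'.prod I₃) (Prod.map f g) p := by
  refine ⟨hf.1.prodMap' hg.1, ?_⟩
  rw [mfderiv_prodMap hf.1 hg.1]
  exact hf.2.prodMap hg.2

theorem isSubmersiveAt_id (x : X) : IsSubmersiveAt I I id x :=
  ⟨mdifferentiableAt_id, by rw [mfderiv_id]; exact surjective_id⟩

theorem isSubmersiveAt_fst (p : X × Y) : IsSubmersiveAt (I.prod I') I Prod.fst p :=
  ⟨mdifferentiableAt_fst, by rw [mfderiv_fst]; exact Prod.fst_surjective⟩

theorem isSubmersiveAt_snd (p : X × Y) : IsSubmersiveAt (I.prod I') I' Prod.snd p :=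
  ⟨mdifferentiableAt_snd, by rw [mfderiv_snd]; exact Prod.snd_surjective⟩

theorem IsSurjSubmersion.isSubmersiveAt {f : X → Y} (hf : IsSurjSubmersion I I' f) (x : X) :
    IsSubmersiveAt I I' f x :=
  ⟨(hf.contMDiff x).mdifferentiableAt (by simp), hf.surjective_mfderiv x⟩

theorem isSurjSubmersion_of_isSubmersiveAt {f : X → Y} (hf : ContMDiff I I' ∞ f)
    (hs : Surjective f) (h : ∀ x, IsSubmersiveAt I I' f x) : IsSurjSubmersion I I' f :=
  ⟨hf, hs, fun x => (h x).2⟩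

theorem isSurjSubmersion_fst [Nonempty Y] :
    IsSurjSubmersion (I.prod I') I (Prod.fst : X × Y → X) :=
  isSurjSubmersion_of_isSubmersiveAt contMDiff_fst Prod.fst_surjective isSubmersiveAt_fst

theorem isSurjSubmersion_snd [Nonempty X] :
    IsSurjSubmersion (I.prod I') I' (Prod.snd : X × Y → Y) :=
  isSurjSubmersion_of_isSubmersiveAt contMDiff_snd Prod.snd_surjective isSubmersiveAt_snd

theorem contMDiffOn_of_forall_isOpen {f : X → Y} {s : Set X}
    (h : ∀ x ∈ s, ∃ u, IsOpen u ∧ x ∈ u ∧ ContMDiffOn I I' ∞ f (s ∩ u)) :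
    ContMDiffOn I I' ∞ f s :=
  contMDiffOn_of_locally_contMDiffOn h

theorem contMDiff_of_forall_isOpen {f : X → Y}
    (h : ∀ x, ∃ u, IsOpen u ∧ x ∈ u ∧ ContMDiffOn I I' ∞ f u) : ContMDiff I I' ∞ f := fun x =>
  let ⟨_, hu, hx, hf⟩ := h x
  hf.contMDiffAt (hu.mem_nhds hx)

theorem IsSmoothManifold.prod (hX : IsSmoothManifold I X) (hY : IsSmoothManifold I' Y) :
    IsSmoothManifold (I.prod I') (X × Y) := by
  obtain ⟨_, _, _, _, _⟩ := hX
  obtain ⟨_, _, _, _, _⟩ := hY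
  exact ⟨inferInstance, inferInstance, inferInstance, inferInstance, inferInstance⟩

/-! ### Smooth local trivializations -/

section Trivialization

variable {proj : X → Y} {e : Trivialization W proj}

theorem IsSmoothTrivialization.contMDiffOn_proj (he : IsSmoothTrivialization I I' I'' e) :
    ContMDiffOn I I' ∞ proj e.source :=
  (contMDiff_fst.comp_contMDiffOn he.contMDiffOn).congr fun _ hx => (e.coe_fst hx).symm

theorem IsSmoothTrivialization.contMDiffOn_snd (he : IsSmoothTrivialization I I' I'' e) :
    ContMDiffOn I I'' ∞ (fun x => (e x).2) e.source :=
  contMDiff_snd.comp_contMDiffOn he.contMDiffOn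

theorem IsSmoothTrivialization.contMDiffOn_symm_comp (he : IsSmoothTrivialization I I' I'' e)
    {b : V → Y} {φ : V → W} {s : Set V} (hb : ContMDiffOn I₃ I' ∞ b s)
    (hφ : ContMDiffOn I₃ I'' ∞ φ s) (hs : MapsTo b s e.baseSet) :
    ContMDiffOn I₃ I ∞ (fun z => e.toOpenPartialHomeomorph.symm (b z, φ z)) s :=
  he.contMDiffOn_symm.comp (hb.prodMk hφ) fun _ hz => e.mem_target.2 (hs hz)

theorem IsSmoothTrivialization.contMDiffOn_snd_comp (he : IsSmoothTrivialization I I' I'' e)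
    {f : V → X} {s : Set V} (hf : ContMDiffOn I₃ I ∞ f s) (hs : ∀ z ∈ s, proj (f z) ∈ e.baseSet) :
    ContMDiffOn I₃ I'' ∞ (fun z => (e (f z)).2) s :=
  he.contMDiffOn_snd.comp hf fun z hz => e.mem_source.2 (hs z hz)

/-- The inverse trivialisation is a differentiable local section on the open target. -/
theorem IsSmoothTrivialization.isSubmersiveAt (he : IsSmoothTrivialization I I' I'' e) {x : X}
    (hx : x ∈ e.source) : IsSubmersiveAt I (I'.prod I'') e x := by
  have hx' : e x ∈ e.target := e.toOpenPartialHomeomorph.map_source hx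
  refine isSubmersiveAt_of_section (g := e.toOpenPartialHomeomorph.symm)
    ((he.contMDiffOn.contMDiffAt (e.open_source.mem_nhds hx)).mdifferentiableAt (by simp))
    ((he.contMDiffOn_symm.contMDiffAt (e.open_target.mem_nhds hx')).mdifferentiableAt (by simp))
    (e.toOpenPartialHomeomorph.left_inv hx) ?_
  filter_upwards [e.open_target.mem_nhds hx'] with y hy
  exact e.toOpenPartialHomeomorph.right_inv hy

theorem IsSmoothTrivialization.isSubmersiveAt_symm (he : IsSmoothTrivialization I I' I'' e)
    {y : Y × W} (hy : y ∈ e.target) :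
    IsSubmersiveAt (I'.prod I'') I e.toOpenPartialHomeomorph.symm y := by
  have hy' : e.toOpenPartialHomeomorph.symm y ∈ e.source := e.toOpenPartialHomeomorph.map_target hy
  refine isSubmersiveAt_of_section (g := e)
    ((he.contMDiffOn_symm.contMDiffAt (e.open_target.mem_nhds hy)).mdifferentiableAt (by simp))
    ((he.contMDiffOn.contMDiffAt (e.open_source.mem_nhds hy')).mdifferentiableAt (by simp))
    (e.toOpenPartialHomeomorph.right_inv hy) ?_
  filter_upwards [e.open_source.mem_nhds hy'] with y hy
  exact e.toOpenPartialHomeomorph.left_inv hy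

/-- Locally `proj` is a trivialisation followed by the first projection; a point of the typical
fibre gives a preimage over each base point. -/
theorem isSurjSubmersion_of_trivializations {ι : Type*} [Nonempty W]
    {e : ι → Trivialization W proj} (he : ∀ i, IsSmoothTrivialization I I' I'' (e i))
    (hcov : ∀ b, ∃ i, b ∈ (e i).baseSet) : IsSurjSubmersion I I' proj := by
  refine isSurjSubmersion_of_isSubmersiveAt (contMDiff_of_forall_isOpen fun x => ?_)
    (fun b => ?_) fun x => ?_
  · obtain ⟨i, hi⟩ := hcov (proj x)
    exact ⟨_, (e i).open_source, (e i).mem_source.2 hi, (he i).contMDiffOn_proj⟩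
  · obtain ⟨i, hi⟩ := hcov b
    exact ⟨_, (e i).proj_symm_apply' (b := b) (x := Classical.arbitrary W) hi⟩
  · obtain ⟨i, hi⟩ := hcov (proj x)
    have hx := (e i).mem_source.2 hi
    refine ((isSubmersiveAt_fst _).comp ((he i).isSubmersiveAt hx)).congr ?_
    filter_upwards [(e i).open_source.mem_nhds hx] with y hy
    exact ((e i).coe_fst hy).symm

end Trivialization

end Submersive

/-! ### The pair groupoid -/

section Pair

variable {EB : Type*} [NormedAddCommGroup EB] [NormedSpace ℝ EB] {HB : Type*} [TopologicalSpace HB]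
variable {IB : ModelWithCorners ℝ EB HB}
variable {B : Type*} [TopologicalSpace B] [ChartedSpace HB B]

theorem isLieGroupoid_pairGroupoid (hB : IsSmoothManifold IB B) [Nonempty B] :
    IsLieGroupoid IB (IB.prod IB) (pairGroupoid B) where
  manifold_obj := hB
  manifold_arr := hB.prod hB
  src_submersion := isSurjSubmersion_snd
  tgt_submersion := isSurjSubmersion_fst
  contMDiff_one := contMDiff_id.prodMk contMDiff_id
  contMDiff_inv := contMDiff_snd.prodMk contMDiff_fst
  contMDiffOn_mul :=
    ((contMDiff_fst.comp contMDiff_fst).prodMk (contMDiff_snd.comp contMDiff_snd)).contMDiffOn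
  src_one _ := rfl
  tgt_one _ := rfl
  src_mul _ _ _ := rfl
  tgt_mul _ _ _ := rfl
  mul_assoc _ _ _ _ _ := rfl
  one_mul _ := rfl
  mul_one _ := rfl
  src_inv _ := rfl
  tgt_inv _ := rfl
  mul_inv _ := rfl
  inv_mul _ := rfl

theorem isLeftModule_pairAction (hB : IsSmoothManifold IB B) :
    IsLeftModule IB (IB.prod IB) IB (pairGroupoid B) (pairAction B) where
  manifold := hB
  contMDiff_moment := contMDiff_id
  contMDiffOn_act := (contMDiff_fst.comp contMDiff_fst).contMDiffOn
  moment_act _ _ _ := rfl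
  one_act _ := rfl
  act_act _ _ _ _ _ := rfl

end Pair

/-! ### Smoothness of the clutching maps -/

section Clutching

variable {EM : Type*} [NormedAddCommGroup EM] [NormedSpace ℝ EM] {HM : Type*} [TopologicalSpace HM]
variable {EG : Type*} [NormedAddCommGroup EG] [NormedSpace ℝ EG] {HG : Type*} [TopologicalSpace HG]
variable {EB : Type*} [NormedAddCommGroup EB] [NormedSpace ℝ EB] {HB : Type*} [TopologicalSpace HB]
variable {EP : Type*} [NormedAddCommGroup EP] [NormedSpace ℝ EP] {HP : Type*} [TopologicalSpace HP]
variable {IM : ModelWithCorners ℝ EM HM} {IG : ModelWithCorners ℝ EG HG}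
variable {M : Type*} [TopologicalSpace M] [ChartedSpace HM M]
variable {G : Type*} [TopologicalSpace G] [ChartedSpace HG G]
variable {𝒢 : LieGroupoid IM M IG G}
variable {IB : ModelWithCorners ℝ EB HB} {B : Type*} [TopologicalSpace B] [ChartedSpace HB B]
variable {IP : ModelWithCorners ℝ EP HP} {P : Type*} [TopologicalSpace P] [ChartedSpace HP P]
variable {ι : Type*} (Q : PrincipaloidBundle 𝒢 IB B IP P ι)

namespace PrincipaloidBundle

theorem isOpen_dom (i : ι) : IsOpen (Q.dom i) := (Q.triv i).open_baseSet

theorem contMDiffOn_change (i j : ι) :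
    ContMDiffOn (IB.prod IG) (IB.prod IG) ∞ (fun q : B × G => Q.triv i (Q.pt j q.1 q.2))
      ((Q.dom i ∩ Q.dom j) ×ˢ univ) := by
  have h1 : ContMDiffOn (IB.prod IG) IP ∞ (fun q : B × G => Q.pt j q.1 q.2)
      ((Q.dom i ∩ Q.dom j) ×ˢ univ) :=
    (Q.smooth_triv j).contMDiffOn_symm.mono fun q hq => (Q.triv j).mem_target.2 hq.1.2
  exact (Q.smooth_triv i).contMDiffOn.comp h1 fun q hq => Q.pt_mem_source hq.1.1 hq.1.2 _

/-- The bisection is the value of the change of trivialisation on units, so its smoothness jointly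
in `b` and `m` is inherited from the trivialisations of `P` and the unit map. -/
theorem contMDiffOn_cocycle (i j : ι) :
    ContMDiffOn (IB.prod IM) IG ∞ (fun q : B × M => Q.cocycle i j q.1 q.2)
      ((Q.dom i ∩ Q.dom j) ×ˢ univ) := by
  have h1 : ContMDiff (IB.prod IM) (IB.prod IG) ∞ fun q : B × M => (q.1, 𝒢.one q.2) :=
    contMDiff_fst.prodMk (𝒢.isLieGroupoid.contMDiff_one.comp contMDiff_snd)
  exact contMDiff_snd.comp_contMDiffOn
    ((Q.contMDiffOn_change i j).comp h1.contMDiffOn fun q hq => ⟨hq.1, trivial⟩)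

theorem contMDiffOn_shadowAct (i j : ι) :
    ContMDiffOn (IB.prod IM) IM ∞ (fun q : B × M => Q.shadowAct i j q.1 q.2)
      ((Q.dom i ∩ Q.dom j) ×ˢ univ) :=
  𝒢.isLieGroupoid.tgt_submersion.contMDiff.comp_contMDiffOn (Q.contMDiffOn_cocycle i j)

theorem contMDiffOn_leftMul (i j : ι) :
    ContMDiffOn (IB.prod IG) IG ∞ (fun q : B × G => Q.leftMul i j q.1 q.2)
      ((Q.dom i ∩ Q.dom j) ×ˢ univ) :=
  (contMDiff_snd.comp_contMDiffOn (Q.contMDiffOn_change i j)).congr fun _ hq =>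
    (Q.change_eq_leftMul hq.1.1 hq.1.2 _).symm

theorem contMDiffOn_inv_cocycle (i j : ι) :
    ContMDiffOn (IB.prod IM) IG ∞ (fun q : B × M => 𝒢.inv (Q.cocycle i j q.1 q.2))
      ((Q.dom i ∩ Q.dom j) ×ˢ univ) :=
  𝒢.isLieGroupoid.contMDiff_inv.comp_contMDiffOn (Q.contMDiffOn_cocycle i j)

theorem contMDiffOn_rightMulInv (i j : ι) :
    ContMDiffOn (IB.prod IG) IG ∞ (fun q : B × G => Q.rightMulInv i j q.1 q.2)
      ((Q.dom i ∩ Q.dom j) ×ˢ univ) := by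
  have h1 : ContMDiff (IB.prod IG) (IB.prod IM) ∞ fun q : B × G => (q.1, 𝒢.src q.2) :=
    contMDiff_fst.prodMk (𝒢.isLieGroupoid.src_submersion.contMDiff.comp contMDiff_snd)
  have h2 := (Q.contMDiffOn_inv_cocycle i j).comp (s := (Q.dom i ∩ Q.dom j) ×ˢ univ)
    h1.contMDiffOn fun q hq => ⟨hq.1, trivial⟩
  refine 𝒢.isLieGroupoid.contMDiffOn_mul.comp (contMDiff_snd.contMDiffOn.prodMk h2)
    fun q hq => ?_
  -- The product of `𝒢` is smooth only within the composable pairs, so the two factors have to be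
  -- shown composable.
  exact (Q.tgt_inv_cocycle hq.1.1 hq.1.2 _).symm

theorem contMDiffOn_actInv (i j : ι) :
    ContMDiffOn (IB.prod IP) IP ∞ (fun q : B × P => Q.actInv i j q.1 q.2)
      ((Q.dom i ∩ Q.dom j) ×ˢ univ) := by
  have h1 : ContMDiff (IB.prod IP) (IB.prod IM) ∞ fun q : B × P => (q.1, Q.right.moment q.2) :=
    contMDiff_fst.prodMk (Q.isRightModule.contMDiff_moment.comp contMDiff_snd)
  have h2 := (Q.contMDiffOn_inv_cocycle i j).comp (s := (Q.dom i ∩ Q.dom j) ×ˢ univ)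
    h1.contMDiffOn fun q hq => ⟨hq.1, trivial⟩
  refine Q.isRightModule.contMDiffOn_act.comp (contMDiff_snd.contMDiffOn.prodMk h2)
    fun q hq => ?_
  exact (Q.tgt_inv_cocycle hq.1.1 hq.1.2 _).symm

/-- The order of the indices is reversed: the clutching map from `i` to `j` is the action of `βⱼᵢ`.
-/
theorem isSmoothCore_shadowCore : IsSmoothCore IB IM Q.shadowCore := fun i j =>
  (Q.contMDiffOn_shadowAct j i).mono fun _ hq => ⟨⟨hq.1.2, hq.1.1⟩, trivial⟩

theorem isSmoothCore_atiyahBundleCore : IsSmoothCore IB IP Q.atiyahBundleCore := fun i j =>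
  (Q.contMDiffOn_actInv j i).mono fun _ hq => ⟨⟨hq.1.2, hq.1.1⟩, trivial⟩

theorem isSmoothCore_atCore : IsSmoothCore (IB.prod IB) IG Q.atCore := fun x y => by
  have h1 : ContMDiff ((IB.prod IB).prod IG) (IB.prod IG) ∞
      fun q : (B × B) × G => (q.1.1, q.2) :=
    (contMDiff_fst.comp contMDiff_fst).prodMk contMDiff_snd
  have h2 := (Q.contMDiffOn_leftMul y.1 x.1).comp
    (s := ((Q.dom x.1 ×ˢ Q.dom x.2) ∩ (Q.dom y.1 ×ˢ Q.dom y.2)) ×ˢ univ)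
    h1.contMDiffOn fun q hq => ⟨⟨hq.1.2.1, hq.1.1.1⟩, trivial⟩
  have h3 : ContMDiff ((IB.prod IB).prod IG) IB ∞ fun q : (B × B) × G => q.1.2 :=
    contMDiff_snd.comp contMDiff_fst
  exact (Q.contMDiffOn_rightMulInv y.2 x.2).comp (h3.contMDiffOn.prodMk h2)
    fun q hq => ⟨⟨hq.1.2.2, hq.1.1.2⟩, trivial⟩

theorem isSmoothManifold_shadow : IsSmoothManifold (IB.prod IM) Q.Shadow :=
  Q.isSmoothCore_shadowCore.isSmoothManifold Q.manifold_base 𝒢.isLieGroupoid.manifold_obj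

theorem isSmoothManifold_atiyah : IsSmoothManifold ((IB.prod IB).prod IG) Q.Atiyah :=
  Q.isSmoothCore_atCore.isSmoothManifold (Q.manifold_base.prod Q.manifold_base)
    𝒢.isLieGroupoid.manifold_arr

theorem isSmoothTrivialization_shadowTriv (i : ι) :
    IsSmoothTrivialization (IB.prod IM) IB IM (Q.shadowTriv i) :=
  have := Q.manifold_base.isManifold
  have := 𝒢.isLieGroupoid.manifold_obj.isManifold
  Q.isSmoothCore_shadowCore.isSmoothTrivialization i

theorem isSmoothTrivialization_atTriv (i j : ι) :
    IsSmoothTrivialization ((IB.prod IB).prod IG) (IB.prod IB) IG (Q.atTriv i j) :=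
  have := Q.manifold_base.isManifold
  have := 𝒢.isLieGroupoid.manifold_arr.isManifold
  Q.isSmoothCore_atCore.isSmoothTrivialization (i, j)

/-- The bundle projection of the Atiyah bundle. -/
noncomputable def atiyahBundleProj : Q.AtiyahBundle → B := Q.atiyahBundleCore.proj

/-- The local trivializations of the Atiyah bundle. -/
noncomputable def atiyahBundleTriv (i : ι) : Trivialization P Q.atiyahBundleProj :=
  Q.atiyahBundleCore.localTriv i

theorem isSmoothTrivialization_atiyahBundleTriv (i : ι) :
    IsSmoothTrivialization (IB.prod IP) IB IP (Q.atiyahBundleTriv i) :=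
  have := Q.manifold_base.isManifold
  have := Q.isRightModule.manifold.isManifold
  Q.isSmoothCore_atiyahBundleCore.isSmoothTrivialization i

end PrincipaloidBundle

end Clutching

/-! ### Points in coordinates -/

section Coordinates

variable {EM : Type*} [NormedAddCommGroup EM] [NormedSpace ℝ EM] {HM : Type*} [TopologicalSpace HM]
variable {EG : Type*} [NormedAddCommGroup EG] [NormedSpace ℝ EG] {HG : Type*} [TopologicalSpace HG]
variable {EB : Type*} [NormedAddCommGroup EB] [NormedSpace ℝ EB] {HB : Type*} [TopologicalSpace HB]
variable {EP : Type*} [NormedAddCommGroup EP] [NormedSpace ℝ EP] {HP : Type*} [TopologicalSpace HP]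
variable {IM : ModelWithCorners ℝ EM HM} {IG : ModelWithCorners ℝ EG HG}
variable {M : Type*} [TopologicalSpace M] [ChartedSpace HM M]
variable {G : Type*} [TopologicalSpace G] [ChartedSpace HG G]
variable {𝒢 : LieGroupoid IM M IG G}
variable {IB : ModelWithCorners ℝ EB HB} {B : Type*} [TopologicalSpace B] [ChartedSpace HB B]
variable {IP : ModelWithCorners ℝ EP HP} {P : Type*} [TopologicalSpace P] [ChartedSpace HP P]
variable {ι : Type*} (Q : PrincipaloidBundle 𝒢 IB B IP P ι)

namespace PrincipaloidBundle

variable {Q}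

theorem shadowTriv_shadowPt {i : ι} {b : B} (hb : b ∈ Q.dom i) (m : M) :
    Q.shadowTriv i (Q.shadowPt i b m) = (b, m) :=
  (Q.shadowTriv i).apply_symm_apply' hb

theorem shadowProj_shadowPt {i : ι} {b : B} (hb : b ∈ Q.dom i) (m : M) :
    Q.shadowProj (Q.shadowPt i b m) = b :=
  (Q.shadowTriv i).proj_symm_apply' hb

theorem shadowPt_shadowTriv {i : ι} {x : Q.Shadow} (hx : Q.shadowProj x ∈ Q.dom i) :
    Q.shadowPt i (Q.shadowProj x) (Q.shadowTriv i x).2 = x :=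
  (Q.shadowTriv i).symm_apply_mk_proj ((Q.shadowTriv i).mem_source.2 hx)

/-- This is the gluing relation of `ℱ`. Together with `pt_change` and `atPt_change` it moves a point
from the index chosen by `index` to any other admissible one. -/
theorem shadowPt_change {i j : ι} {b : B} (hi : b ∈ Q.dom i) (hj : b ∈ Q.dom j) (m : M) :
    Q.shadowPt j b m = Q.shadowPt i b (Q.shadowAct i j b m) := by
  have h1 : Q.shadowTriv i (Q.shadowPt j b m) = (b, Q.shadowAct i j b m) :=
    (Q.shadowCore.localTrivAsPartialEquiv_trans j i).2
      ((Q.shadowCore.localTrivAsPartialEquiv_trans j i).1.symm ▸ ⟨⟨hj, hi⟩, trivial⟩)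
  have h2 := shadowPt_shadowTriv (i := i) (x := Q.shadowPt j b m)
    (by rw [shadowProj_shadowPt hj]; exact hi)
  rw [h1, shadowProj_shadowPt hj] at h2
  exact h2.symm

theorem shadowPt_inj {i : ι} {b : B} (hb : b ∈ Q.dom i) {m n : M}
    (h : Q.shadowPt i b m = Q.shadowPt i b n) : m = n := by
  have h1 := congrArg (Q.shadowTriv i) h
  rw [shadowTriv_shadowPt hb, shadowTriv_shadowPt hb] at h1
  exact congrArg Prod.snd h1

theorem pt_change {i j : ι} {b : B} (hi : b ∈ Q.dom i) (hj : b ∈ Q.dom j) (g : G) :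
    Q.pt j b g = Q.pt i b (Q.leftMul i j b g) := by
  have h2 := Q.pt_triv (i := i) (p := Q.pt j b g) (by rw [Q.proj_pt hj]; exact hi)
  rw [Q.change_eq_leftMul hi hj, Q.proj_pt hj] at h2
  exact h2.symm

theorem atTriv_atPt {i j : ι} {b c : B} (hb : b ∈ Q.dom i) (hc : c ∈ Q.dom j) (g : G) :
    Q.atTriv i j (Q.atPt i j b g c) = ((b, c), g) :=
  (Q.atTriv i j).apply_symm_apply' ⟨hb, hc⟩

theorem atProj_atPt {i j : ι} {b c : B} (hb : b ∈ Q.dom i) (hc : c ∈ Q.dom j) (g : G) :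
    Q.atProj (Q.atPt i j b g c) = (b, c) :=
  (Q.atTriv i j).proj_symm_apply' (b := (b, c)) ⟨hb, hc⟩

theorem leftEnd_atPt {i j : ι} {b c : B} (hb : b ∈ Q.dom i) (hc : c ∈ Q.dom j) (g : G) :
    Q.leftEnd (Q.atPt i j b g c) = b :=
  congrArg Prod.fst (atProj_atPt hb hc g)

theorem rightEnd_atPt {i j : ι} {b c : B} (hb : b ∈ Q.dom i) (hc : c ∈ Q.dom j) (g : G) :
    Q.rightEnd (Q.atPt i j b g c) = c :=
  congrArg Prod.snd (atProj_atPt hb hc g)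

theorem atPt_atTriv {i j : ι} {a : Q.Atiyah} (hi : Q.leftEnd a ∈ Q.dom i)
    (hj : Q.rightEnd a ∈ Q.dom j) :
    Q.atPt i j (Q.leftEnd a) (Q.atTriv i j a).2 (Q.rightEnd a) = a :=
  (Q.atTriv i j).symm_apply_mk_proj ((Q.atTriv i j).mem_source.2 ⟨hi, hj⟩)

theorem atPt_change {i j k l : ι} {b c : B} (hi : b ∈ Q.dom i) (hk : b ∈ Q.dom k)
    (hj : c ∈ Q.dom j) (hl : c ∈ Q.dom l) (g : G) :
    Q.atPt i j b g c = Q.atPt k l b (Q.rightMulInv l j c (Q.leftMul k i b g)) c := by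
  have h1 : Q.atTriv k l (Q.atPt i j b g c) =
      ((b, c), Q.rightMulInv l j c (Q.leftMul k i b g)) :=
    (Q.atCore.localTrivAsPartialEquiv_trans (i, j) (k, l)).2
      ((Q.atCore.localTrivAsPartialEquiv_trans (i, j) (k, l)).1.symm ▸
        ⟨⟨⟨hi, hj⟩, ⟨hk, hl⟩⟩, trivial⟩)
  have h2 := atPt_atTriv (i := k) (j := l) (a := Q.atPt i j b g c)
    (by rw [leftEnd_atPt hi hj]; exact hk) (by rw [rightEnd_atPt hi hj]; exact hl)
  rw [h1, leftEnd_atPt hi hj, rightEnd_atPt hi hj] at h2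
  exact h2.symm

theorem atiyahBundleTriv_pt {i : ι} {b : B} (hb : b ∈ Q.dom i) (p : P) :
    Q.atiyahBundleTriv i (Q.atiyahBundlePt i p b) = (b, p) :=
  (Q.atiyahBundleTriv i).apply_symm_apply' hb

theorem atiyahBundleProj_pt {i : ι} {b : B} (hb : b ∈ Q.dom i) (p : P) :
    Q.atiyahBundleProj (Q.atiyahBundlePt i p b) = b :=
  (Q.atiyahBundleTriv i).proj_symm_apply' hb

theorem atiyahBundlePt_triv {i : ι} {x : Q.AtiyahBundle} (hx : Q.atiyahBundleProj x ∈ Q.dom i) :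
    Q.atiyahBundlePt i (Q.atiyahBundleTriv i x).2 (Q.atiyahBundleProj x) = x :=
  (Q.atiyahBundleTriv i).symm_apply_mk_proj ((Q.atiyahBundleTriv i).mem_source.2 hx)

theorem atiyahBundlePt_change {i j : ι} {b : B} (hi : b ∈ Q.dom i) (hj : b ∈ Q.dom j) (p : P) :
    Q.atiyahBundlePt j p b = Q.atiyahBundlePt i (Q.actInv i j b p) b := by
  have h1 : Q.atiyahBundleTriv i (Q.atiyahBundlePt j p b) = (b, Q.actInv i j b p) :=
    (Q.atiyahBundleCore.localTrivAsPartialEquiv_trans j i).2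
      ((Q.atiyahBundleCore.localTrivAsPartialEquiv_trans j i).1.symm ▸ ⟨⟨hj, hi⟩, trivial⟩)
  have h2 := atiyahBundlePt_triv (i := i) (x := Q.atiyahBundlePt j p b)
    (by rw [atiyahBundleProj_pt hj]; exact hi)
  rw [h1, atiyahBundleProj_pt hj] at h2
  exact h2.symm

/-- The right action of `βᵢⱼ(b)⁻¹` in coordinates. -/
theorem actInv_pt {i j k : ι} {b c : B} (hi : c ∈ Q.dom i) (hj : c ∈ Q.dom j) (hk : b ∈ Q.dom k)
    (g : G) : Q.actInv i j c (Q.pt k b g) = Q.pt k b (Q.rightMulInv i j c g) := by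
  rw [actInv, Q.moment_pt hk, Q.pt_mul hk _ _ (Q.tgt_inv_cocycle hi hj _).symm]
  rfl

variable (Q)

/-- Representatives of this kind, for `ℱ`, `P` and `At(P)`, turn identities between points into
identities in `𝒢`. -/
theorem exists_shadowPt (x : Q.Shadow) : ∃ i, ∃ b ∈ Q.dom i, ∃ m, x = Q.shadowPt i b m :=
  ⟨_, _, Q.mem_dom_index _, _, (shadowPt_shadowTriv (Q.mem_dom_index _)).symm⟩

theorem exists_pt (p : P) : ∃ i, ∃ b ∈ Q.dom i, ∃ g, p = Q.pt i b g :=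
  ⟨_, _, Q.mem_dom_index _, _, (Q.pt_triv (Q.mem_dom_index _)).symm⟩

theorem exists_atPt (a : Q.Atiyah) :
    ∃ i, ∃ b ∈ Q.dom i, ∃ j, ∃ c ∈ Q.dom j, ∃ g, a = Q.atPt i j b g c :=
  ⟨_, _, Q.mem_dom_index _, _, _, Q.mem_dom_index _, _,
    (atPt_atTriv (Q.mem_dom_index _) (Q.mem_dom_index _)).symm⟩

end PrincipaloidBundle

end Coordinates

/-! ### The structure maps in coordinates -/

section Structure

variable {EM : Type*} [NormedAddCommGroup EM] [NormedSpace ℝ EM] {HM : Type*} [TopologicalSpace HM]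
variable {EG : Type*} [NormedAddCommGroup EG] [NormedSpace ℝ EG] {HG : Type*} [TopologicalSpace HG]
variable {EB : Type*} [NormedAddCommGroup EB] [NormedSpace ℝ EB] {HB : Type*} [TopologicalSpace HB]
variable {EP : Type*} [NormedAddCommGroup EP] [NormedSpace ℝ EP] {HP : Type*} [TopologicalSpace HP]
variable {IM : ModelWithCorners ℝ EM HM} {IG : ModelWithCorners ℝ EG HG}
variable {M : Type*} [TopologicalSpace M] [ChartedSpace HM M]
variable {G : Type*} [TopologicalSpace G] [ChartedSpace HG G]
variable {𝒢 : LieGroupoid IM M IG G}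
variable {IB : ModelWithCorners ℝ EB HB} {B : Type*} [TopologicalSpace B] [ChartedSpace HB B]
variable {IP : ModelWithCorners ℝ EP HP} {P : Type*} [TopologicalSpace P] [ChartedSpace HP P]
variable {ι : Type*} (Q : PrincipaloidBundle 𝒢 IB B IP P ι)

namespace PrincipaloidBundle

variable {Q}

theorem leftMul_mul {i j : ι} {b : B} (hi : b ∈ Q.dom i) (hj : b ∈ Q.dom j) {g h : G}
    (hgh : 𝒢.src g = 𝒢.tgt h) :
    𝒢.mul (Q.leftMul i j b g) h = Q.leftMul i j b (𝒢.mul g h) := by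
  rw [leftMul, leftMul, 𝒢.isLieGroupoid.mul_assoc _ _ _ (Q.src_cocycle hi hj _) hgh,
    𝒢.isLieGroupoid.tgt_mul _ _ hgh]

theorem mul_rightMulInv {i j : ι} {b : B} (hi : b ∈ Q.dom i) (hj : b ∈ Q.dom j) {g h : G}
    (hgh : 𝒢.src g = 𝒢.tgt h) :
    𝒢.mul g (Q.rightMulInv i j b h) = Q.rightMulInv i j b (𝒢.mul g h) := by
  rw [rightMulInv, rightMulInv,
    𝒢.isLieGroupoid.src_mul _ _ hgh,
    𝒢.isLieGroupoid.mul_assoc _ _ _ hgh (Q.tgt_inv_cocycle hi hj _).symm]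

/-- Since `s g = t h`, both factors use the same value of the bisection, which cancels against its
inverse. Hence products do not depend on the trivialisation at the middle base point. -/
theorem rightMulInv_mul_leftMul {i j : ι} {b : B} (hi : b ∈ Q.dom i) (hj : b ∈ Q.dom j) {g h : G}
    (hgh : 𝒢.src g = 𝒢.tgt h) :
    𝒢.mul (Q.rightMulInv i j b g) (Q.leftMul i j b h) = 𝒢.mul g h := by
  have hg := 𝒢.isLieGroupoid
  have hs := Q.src_cocycle hi hj (𝒢.tgt h)
  rw [rightMulInv, leftMul, hgh]
  rw [hg.mul_assoc g _ _ (by rw [Q.tgt_inv_cocycle hi hj, hgh])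
      (by rw [hg.src_inv, hg.tgt_mul _ _ hs]),
    ← hg.mul_assoc _ _ h (hg.src_inv _) hs, hg.inv_mul, hs, hg.one_mul]

/-- Inversion reverses products, so it exchanges the two ends of an arrow together with their
bisections. This makes the inverse of `At(P)` independent of representatives. -/
theorem inv_rightMulInv_leftMul {i j k l : ι} {b c : B} (hi : b ∈ Q.dom i) (hj : b ∈ Q.dom j)
    (hk : c ∈ Q.dom k) (hl : c ∈ Q.dom l) (g : G) :
    𝒢.inv (Q.rightMulInv k l c (Q.leftMul i j b g)) =
      Q.rightMulInv i j b (Q.leftMul k l c (𝒢.inv g)) := by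
  have hg := 𝒢.isLieGroupoid
  -- Inversion is involutive: both bracketings of `x · x⁻¹ · (x⁻¹)⁻¹` are evaluated.
  have h1 : 𝒢.inv (𝒢.inv (Q.cocycle k l c (𝒢.src g))) = Q.cocycle k l c (𝒢.src g) := by
    have := hg.mul_inv (𝒢.inv (Q.cocycle k l c (𝒢.src g)))
    have h2 := hg.mul_assoc _ _ _ (hg.tgt_inv (Q.cocycle k l c (𝒢.src g))).symm
      (hg.tgt_inv (𝒢.inv (Q.cocycle k l c (𝒢.src g)))).symm
    rw [this, hg.tgt_inv, hg.mul_one, hg.mul_inv] at h2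
    have h3 := hg.one_mul (𝒢.inv (𝒢.inv (Q.cocycle k l c (𝒢.src g))))
    rw [hg.tgt_inv, hg.src_inv] at h3
    exact h3.symm.trans h2
  rw [← Q.leftMul_rightMulInv hi hj hk hl, leftMul, Q.tgt_rightMulInv hk hl,
    ← hg.inv_mul_inv _ _ (by rw [Q.src_cocycle hi hj, Q.tgt_rightMulInv hk hl]), rightMulInv,
    ← hg.inv_mul_inv _ _ (by rw [Q.tgt_inv_cocycle hk hl]), h1, rightMulInv,
    Q.src_leftMul hk hl, hg.src_inv, leftMul, hg.tgt_inv]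

theorem arrow_atPt {i j : ι} {b c : B} (hb : b ∈ Q.dom i) (hc : c ∈ Q.dom j) (g : G) :
    Q.arrow (Q.atPt i j b g c) =
      Q.rightMulInv (Q.index c) j c (Q.leftMul (Q.index b) i b g) := by
  rw [arrow, leftEnd_atPt hb hc, rightEnd_atPt hb hc,
    atPt_change hb (Q.mem_dom_index b) hc (Q.mem_dom_index c),
    atTriv_atPt (Q.mem_dom_index b) (Q.mem_dom_index c)]

/-- `D` is independent of representatives because the target map intertwines left translation by
`βᵢⱼ(b)` with the shadow action. -/
theorem duck_pt {i : ι} {b : B} (hb : b ∈ Q.dom i) (g : G) :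
    Q.duck (Q.pt i b g) = Q.shadowPt i b (𝒢.tgt g) := by
  have hb' := Q.mem_dom_index b
  rw [duck, Q.proj_pt hb, Q.change_eq_leftMul hb' hb, Q.tgt_leftMul hb' hb,
    ← shadowPt_change hb' hb]

/-- The bisection at the left end does not affect `s g`, and the inverse bisection at the right end
moves it by the shadow action, which is the gluing of `ℱ`. -/
theorem src_atPt {i j : ι} {b c : B} (hb : b ∈ Q.dom i) (hc : c ∈ Q.dom j) (g : G) :
    Q.atGroupoid.src (Q.atPt i j b g c) = Q.shadowPt j c (𝒢.src g) := by
  have hb' := Q.mem_dom_index b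
  have hc' := Q.mem_dom_index c
  simp only [atGroupoid]
  rw [rightEnd_atPt hb hc, arrow_atPt hb hc, Q.src_rightMulInv hc' hc,
    Q.src_leftMul hb' hb, ← shadowPt_change hc' hc]

theorem tgt_atPt {i j : ι} {b c : B} (hb : b ∈ Q.dom i) (hc : c ∈ Q.dom j) (g : G) :
    Q.atGroupoid.tgt (Q.atPt i j b g c) = Q.shadowPt i b (𝒢.tgt g) := by
  have hb' := Q.mem_dom_index b
  have hc' := Q.mem_dom_index c
  simp only [atGroupoid]
  rw [leftEnd_atPt hb hc, arrow_atPt hb hc, Q.tgt_rightMulInv hc' hc,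
    Q.tgt_leftMul hb' hb, ← shadowPt_change hb' hb]

/-- Changing both ends of the unit at `m` gives `β(m) · β(m)⁻¹`, the unit at the shadow image of
`m`. -/
theorem one_shadowPt {i : ι} {b : B} (hb : b ∈ Q.dom i) (m : M) :
    Q.atGroupoid.one (Q.shadowPt i b m) = Q.atPt i i b (𝒢.one m) b := by
  have hb' := Q.mem_dom_index b
  have hg := 𝒢.isLieGroupoid
  have hs := Q.src_cocycle hb' hb m
  have ht := Q.tgt_inv_cocycle hb' hb m
  rw [atPt_change hb hb' hb hb', Q.leftMul_one hb' hb, rightMulInv, hs, hg.mul_inv]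
  simp only [atGroupoid]
  rw [shadowProj_shadowPt hb, shadowPt_change hb' hb, shadowTriv_shadowPt hb']
  rfl

theorem inv_atPt {i j : ι} {b c : B} (hb : b ∈ Q.dom i) (hc : c ∈ Q.dom j) (g : G) :
    Q.atGroupoid.inv (Q.atPt i j b g c) = Q.atPt j i c (𝒢.inv g) b := by
  have hb' := Q.mem_dom_index b
  have hc' := Q.mem_dom_index c
  simp only [atGroupoid]
  rw [leftEnd_atPt hb hc, rightEnd_atPt hb hc, arrow_atPt hb hc,
    inv_rightMulInv_leftMul hb' hb hc' hc, ← atPt_change hc hc' hb hb']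

/-- With a common middle index `j`, passing to the chosen indices changes the two factors by inverse
bisections at `c`. These cancel, and the changes at `b` and `d` come out of the product as the
gluing of `At(P)`. -/
theorem mul_atPt {i j k : ι} {b c d : B} (hb : b ∈ Q.dom i) (hc : c ∈ Q.dom j)
    (hd : d ∈ Q.dom k) {g h : G} (hgh : 𝒢.src g = 𝒢.tgt h) :
    Q.atGroupoid.mul (Q.atPt i j b g c) (Q.atPt j k c h d) = Q.atPt i k b (𝒢.mul g h) d := by
  have hb' := Q.mem_dom_index b
  have hc' := Q.mem_dom_index c
  have hd' := Q.mem_dom_index d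
  simp only [atGroupoid]
  rw [leftEnd_atPt hb hc, rightEnd_atPt hb hc, leftEnd_atPt hc hd,
    -- Both arrows now use the index chosen at `c`, so the connecting bisection in the definition of
    -- the product is trivial.
    rightEnd_atPt hc hd, arrow_atPt hb hc, arrow_atPt hc hd, Q.leftMul_self hc',
    mul_rightMulInv hd' hd
      (by rw [Q.src_rightMulInv hc' hc, Q.tgt_leftMul hc' hc, Q.src_leftMul hb' hb, hgh]),
    rightMulInv_mul_leftMul hc' hc (by rw [Q.src_leftMul hb' hb, hgh]),
    leftMul_mul hb' hb hgh, ← atPt_change hb hb' hd hd']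

/-- The computation is that of the product of arrows, without a right end on the second factor. -/
theorem act_atPt_pt {i j : ι} {b c : B} (hb : b ∈ Q.dom i) (hc : c ∈ Q.dom j) {g h : G}
    (hgh : 𝒢.src g = 𝒢.tgt h) :
    Q.leftP.act (Q.atPt i j b g c) (Q.pt j c h) = Q.pt i b (𝒢.mul g h) := by
  have hb' := Q.mem_dom_index b
  have hc' := Q.mem_dom_index c
  simp only [leftP]
  rw [leftEnd_atPt hb hc, rightEnd_atPt hb hc, arrow_atPt hb hc, Q.proj_pt hc,
    Q.change_eq_leftMul hc' hc, Q.leftMul_self hc',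
    rightMulInv_mul_leftMul hc' hc (by rw [Q.src_leftMul hb' hb, hgh]),
    leftMul_mul hb' hb hgh, ← pt_change hb' hb]

theorem shadowProj_duck (p : P) : Q.shadowProj (Q.duck p) = Q.proj p :=
  shadowProj_shadowPt (Q.mem_dom_index _) _

theorem shadowProj_src (a : Q.Atiyah) : Q.shadowProj (Q.atGroupoid.src a) = Q.rightEnd a :=
  shadowProj_shadowPt (Q.mem_dom_index _) _

theorem shadowProj_tgt (a : Q.Atiyah) : Q.shadowProj (Q.atGroupoid.tgt a) = Q.leftEnd a :=
  shadowProj_shadowPt (Q.mem_dom_index _) _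

/-- A point over `[(b, m, i)]` has coordinates `(b, g)` with `t g = m`. -/
theorem exists_pt_of_duck {i : ι} {b : B} (hb : b ∈ Q.dom i) {m : M} {p : P}
    (hp : Q.duck p = Q.shadowPt i b m) : ∃ g, p = Q.pt i b g ∧ 𝒢.tgt g = m := by
  have h1 : Q.proj p = b := by rw [← shadowProj_duck, hp, shadowProj_shadowPt hb]
  subst h1
  have h2 := Q.pt_triv hb
  refine ⟨_, h2.symm, shadowPt_inj hb ?_⟩
  rw [← duck_pt hb, h2, hp]

/-- An arrow with target `[(b, m, i)]` has coordinates `(b, g, c)` with `t g = m`. -/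
theorem exists_atPt_of_tgt {i : ι} {b : B} (hb : b ∈ Q.dom i) {m : M} {a : Q.Atiyah}
    (ha : Q.atGroupoid.tgt a = Q.shadowPt i b m) :
    ∃ j, ∃ c ∈ Q.dom j, ∃ g, a = Q.atPt i j b g c ∧ 𝒢.tgt g = m := by
  have h1 : Q.leftEnd a = b := by rw [← shadowProj_tgt, ha, shadowProj_shadowPt hb]
  subst h1
  have hc := Q.mem_dom_index (Q.rightEnd a)
  have h2 := atPt_atTriv hb hc
  refine ⟨_, _, hc, _, h2.symm, shadowPt_inj hb ?_⟩
  rw [← tgt_atPt hb hc, h2, ha]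

end PrincipaloidBundle

end Structure

/-! ### Submersions in local trivializations -/

section LocalForm

variable {E₁ E₂ E₃ E₄ E₅ E₆ : Type*} [NormedAddCommGroup E₁] [NormedSpace ℝ E₁]
  [NormedAddCommGroup E₂] [NormedSpace ℝ E₂] [NormedAddCommGroup E₃] [NormedSpace ℝ E₃]
  [NormedAddCommGroup E₄] [NormedSpace ℝ E₄] [NormedAddCommGroup E₅] [NormedSpace ℝ E₅]
  [NormedAddCommGroup E₆] [NormedSpace ℝ E₆]
variable {H₁ H₂ H₃ H₄ H₅ H₆ : Type*} [TopologicalSpace H₁] [TopologicalSpace H₂]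
  [TopologicalSpace H₃] [TopologicalSpace H₄] [TopologicalSpace H₅] [TopologicalSpace H₆]
variable {I₁ : ModelWithCorners ℝ E₁ H₁} {I₂ : ModelWithCorners ℝ E₂ H₂}
  {I₃ : ModelWithCorners ℝ E₃ H₃} {I₄ : ModelWithCorners ℝ E₄ H₄}
  {I₅ : ModelWithCorners ℝ E₅ H₅} {I₆ : ModelWithCorners ℝ E₆ H₆}
variable {X B F Y B' F' : Type*} [TopologicalSpace X] [ChartedSpace H₁ X]
  [TopologicalSpace B] [ChartedSpace H₂ B] [TopologicalSpace F] [ChartedSpace H₃ F]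
  [TopologicalSpace Y] [ChartedSpace H₄ Y] [TopologicalSpace B'] [ChartedSpace H₅ B']
  [TopologicalSpace F'] [ChartedSpace H₆ F']

/-- A map that is a smooth submersion in local trivializations is a smooth submersion. -/
theorem IsSmoothTrivialization.contMDiffAt_and_isSubmersiveAt
    {proj : X → B} {proj' : Y → B'} {e : Trivialization F proj} {e' : Trivialization F' proj'}
    (he : IsSmoothTrivialization I₁ I₂ I₃ e) (he' : IsSmoothTrivialization I₄ I₅ I₆ e')
    {φ : B × F → B' × F'} (hφ : ContMDiff (I₂.prod I₃) (I₅.prod I₆) ∞ φ)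
    (hφ' : ∀ z, IsSubmersiveAt (I₂.prod I₃) (I₅.prod I₆) φ z) {f : X → Y} {x : X}
    (hx : x ∈ e.source) (hf : ∀ y ∈ e.source, φ (e y) ∈ e'.target ∧
      f y = e'.toOpenPartialHomeomorph.symm (φ (e y))) :
    ContMDiffAt I₁ I₄ ∞ f x ∧ IsSubmersiveAt I₁ I₄ f x := by
  have h1 : f =ᶠ[nhds x] e'.toOpenPartialHomeomorph.symm ∘ φ ∘ e := by
    filter_upwards [e.open_source.mem_nhds hx] with y hy using (hf y hy).2
  have h2 := (hf x hx).1
  have h3 : IsSubmersiveAt I₁ (I₅.prod I₆) (φ ∘ e) x := (hφ' _).comp (he.isSubmersiveAt hx)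
  have h4 : IsSubmersiveAt (I₅.prod I₆) I₄ e'.toOpenPartialHomeomorph.symm ((φ ∘ e) x) :=
    he'.isSubmersiveAt_symm h2
  refine ⟨ContMDiffAt.congr_of_eventuallyEq ?_ h1, (h4.comp h3).congr h1⟩
  exact (he'.contMDiffOn_symm.contMDiffAt (e'.open_target.mem_nhds h2)).comp x
    ((hφ _).comp x (he.contMDiffOn.contMDiffAt (e.open_source.mem_nhds hx)))

end LocalForm

/-! ### Smoothness in coordinates -/

section Smoothness

variable {EM : Type*} [NormedAddCommGroup EM] [NormedSpace ℝ EM] {HM : Type*} [TopologicalSpace HM]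
variable {EG : Type*} [NormedAddCommGroup EG] [NormedSpace ℝ EG] {HG : Type*} [TopologicalSpace HG]
variable {EB : Type*} [NormedAddCommGroup EB] [NormedSpace ℝ EB] {HB : Type*} [TopologicalSpace HB]
variable {EP : Type*} [NormedAddCommGroup EP] [NormedSpace ℝ EP] {HP : Type*} [TopologicalSpace HP]
variable {IM : ModelWithCorners ℝ EM HM} {IG : ModelWithCorners ℝ EG HG}
variable {M : Type*} [TopologicalSpace M] [ChartedSpace HM M]
variable {G : Type*} [TopologicalSpace G] [ChartedSpace HG G]
variable {𝒢 : LieGroupoid IM M IG G}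
variable {IB : ModelWithCorners ℝ EB HB} {B : Type*} [TopologicalSpace B] [ChartedSpace HB B]
variable {IP : ModelWithCorners ℝ EP HP} {P : Type*} [TopologicalSpace P] [ChartedSpace HP P]
variable {ι : Type*} (Q : PrincipaloidBundle 𝒢 IB B IP P ι)

variable {EV : Type*} [NormedAddCommGroup EV] [NormedSpace ℝ EV] {HV : Type*} [TopologicalSpace HV]
variable {IV : ModelWithCorners ℝ EV HV}
variable {V : Type*} [TopologicalSpace V] [ChartedSpace HV V]
variable {s : Set V}

namespace PrincipaloidBundle

variable {Q}

theorem contMDiffOn_pt {i : ι} {b : V → B} {g : V → G} (hb : ContMDiffOn IV IB ∞ b s)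
    (hg : ContMDiffOn IV IG ∞ g s) (hs : ∀ z ∈ s, b z ∈ Q.dom i) :
    ContMDiffOn IV IP ∞ (fun z => Q.pt i (b z) (g z)) s :=
  (Q.smooth_triv i).contMDiffOn_symm_comp hb hg hs

theorem contMDiffOn_atPt {i j : ι} {b c : V → B} {g : V → G} (hb : ContMDiffOn IV IB ∞ b s)
    (hg : ContMDiffOn IV IG ∞ g s) (hc : ContMDiffOn IV IB ∞ c s) (hbs : ∀ z ∈ s, b z ∈ Q.dom i)
    (hcs : ∀ z ∈ s, c z ∈ Q.dom j) :
    ContMDiffOn IV ((IB.prod IB).prod IG) ∞ (fun z => Q.atPt i j (b z) (g z) (c z)) s :=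
  (Q.isSmoothTrivialization_atTriv i j).contMDiffOn_symm_comp (hb.prodMk hc) hg
    fun z hz => ⟨hbs z hz, hcs z hz⟩

theorem contMDiffOn_atiyahBundlePt {i : ι} {b : V → B} {p : V → P}
    (hp : ContMDiffOn IV IP ∞ p s) (hb : ContMDiffOn IV IB ∞ b s) (hs : ∀ z ∈ s, b z ∈ Q.dom i) :
    ContMDiffOn IV (IB.prod IP) ∞ (fun z => Q.atiyahBundlePt i (p z) (b z)) s :=
  (Q.isSmoothTrivialization_atiyahBundleTriv i).contMDiffOn_symm_comp hb hp hs

theorem contMDiffOn_triv_snd {i : ι} {f : V → P} (hf : ContMDiffOn IV IP ∞ f s)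
    (hs : ∀ z ∈ s, Q.proj (f z) ∈ Q.dom i) :
    ContMDiffOn IV IG ∞ (fun z => (Q.triv i (f z)).2) s :=
  (Q.smooth_triv i).contMDiffOn_snd_comp hf hs

theorem contMDiffOn_atTriv_snd {i j : ι} {f : V → Q.Atiyah}
    (hf : ContMDiffOn IV ((IB.prod IB).prod IG) ∞ f s)
    (hi : ∀ z ∈ s, Q.leftEnd (f z) ∈ Q.dom i) (hj : ∀ z ∈ s, Q.rightEnd (f z) ∈ Q.dom j) :
    ContMDiffOn IV IG ∞ (fun z => (Q.atTriv i j (f z)).2) s :=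
  (Q.isSmoothTrivialization_atTriv i j).contMDiffOn_snd_comp hf fun z hz => ⟨hi z hz, hj z hz⟩

variable (Q)

theorem contMDiff_shadowProj : ContMDiff (IB.prod IM) IB ∞ Q.shadowProj :=
  contMDiff_of_forall_isOpen fun _ => ⟨_, (Q.shadowTriv _).open_source,
    (Q.shadowTriv _).mem_source.2 (Q.mem_dom_index _),
    (Q.isSmoothTrivialization_shadowTriv _).contMDiffOn_proj⟩

theorem contMDiff_atProj : ContMDiff ((IB.prod IB).prod IG) (IB.prod IB) ∞ Q.atProj :=
  contMDiff_of_forall_isOpen fun _ => ⟨_, (Q.atTriv _ _).open_source,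
    (Q.atTriv _ _).mem_source.2 ⟨Q.mem_dom_index _, Q.mem_dom_index _⟩,
    (Q.isSmoothTrivialization_atTriv _ _).contMDiffOn_proj⟩

theorem contMDiff_atiyahBundleProj : ContMDiff (IB.prod IP) IB ∞ Q.atiyahBundleProj :=
  contMDiff_of_forall_isOpen fun _ => ⟨_, (Q.atiyahBundleTriv _).open_source,
    (Q.atiyahBundleTriv _).mem_source.2 (Q.mem_dom_index _),
    (Q.isSmoothTrivialization_atiyahBundleTriv _).contMDiffOn_proj⟩

theorem contMDiff_leftEnd : ContMDiff ((IB.prod IB).prod IG) IB ∞ Q.leftEnd :=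
  contMDiff_fst.comp Q.contMDiff_atProj

theorem contMDiff_rightEnd : ContMDiff ((IB.prod IB).prod IG) IB ∞ Q.rightEnd :=
  contMDiff_snd.comp Q.contMDiff_atProj

theorem contMDiff_proj : ContMDiff IP IB ∞ Q.proj := Q.submersion.contMDiff

theorem nonempty_fibre (Q : PrincipaloidBundle 𝒢 IB B IP P ι) [Nonempty B] : Nonempty G :=
  let ⟨p, _⟩ := Q.submersion.surjective (Classical.arbitrary B)
  ⟨(Q.triv (Q.index (Q.proj p)) p).2⟩

/-- In trivialisations with the same index, `D` is `id × t`, and `t` is a surjective submersion. -/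
theorem isSurjSubmersion_duck : IsSurjSubmersion IP (IB.prod IM) Q.duck := by
  have h : ∀ p, ContMDiffAt IP (IB.prod IM) ∞ Q.duck p ∧ IsSubmersiveAt IP (IB.prod IM) Q.duck p :=
    fun p => by
    have ht := 𝒢.isLieGroupoid.tgt_submersion
    refine (Q.smooth_triv (Q.index (Q.proj p))).contMDiffAt_and_isSubmersiveAt
      (Q.isSmoothTrivialization_shadowTriv (Q.index (Q.proj p)))
      (φ := Prod.map id 𝒢.tgt) (contMDiff_id.prodMap ht.contMDiff)
      (fun z => (isSubmersiveAt_id _).prodMap (ht.isSubmersiveAt _))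
      ((Q.triv _).mem_source.2 (Q.mem_dom_index _)) fun y hy => ?_
    have hy' : Q.proj y ∈ Q.dom (Q.index (Q.proj p)) := (Q.triv _).mem_source.1 hy
    have h1 := duck_pt hy' (Q.triv (Q.index (Q.proj p)) y).2
    rw [Q.pt_triv hy'] at h1
    have h2 := (Q.triv (Q.index (Q.proj p))).coe_fst hy
    refine ⟨(Q.shadowTriv _).mem_target.2 ?_, ?_⟩
    · change (Q.triv (Q.index (Q.proj p)) y).1 ∈ Q.dom _
      rw [h2]; exact hy'
    · rw [h1, ← h2]; rfl
  refine isSurjSubmersion_of_isSubmersiveAt (fun p => (h p).1) (fun x => ?_) fun p => (h p).2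
  obtain ⟨i, b, hb, m, rfl⟩ := Q.exists_shadowPt x
  obtain ⟨g, rfl⟩ := 𝒢.isLieGroupoid.tgt_submersion.surjective m
  exact ⟨_, duck_pt hb g⟩

/-- The moment map is `s` of the fibre coordinate in any trivialisation; left translation does not
change sources, so base points play no role. -/
theorem isSurjSubmersion_moment [Nonempty B] : IsSurjSubmersion IP IM Q.right.moment := by
  have hs := 𝒢.isLieGroupoid.src_submersion
  refine isSurjSubmersion_of_isSubmersiveAt Q.isRightModule.contMDiff_moment (fun m => ?_)
    fun p => ?_
  · obtain ⟨g, rfl⟩ := hs.surjective m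
    exact ⟨_, Q.moment_pt (Q.mem_dom_index (Classical.arbitrary B)) g⟩
  · have hp := (Q.triv (Q.index (Q.proj p))).mem_source.2 (Q.mem_dom_index (Q.proj p))
    refine ((hs.isSubmersiveAt _).comp ((isSubmersiveAt_snd _).comp
      ((Q.smooth_triv (Q.index (Q.proj p))).isSubmersiveAt hp))).congr ?_
    filter_upwards [(Q.triv (Q.index (Q.proj p))).open_source.mem_nhds hp] with y hy
    exact Q.moment_triv _ y hy

theorem atTriv_eq {i j : ι} {a : Q.Atiyah} (ha : a ∈ (Q.atTriv i j).source) :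
    Q.atTriv i j a = ((Q.leftEnd a, Q.rightEnd a), (Q.atTriv i j a).2) :=
  Prod.ext ((Q.atTriv i j).coe_fst ha) rfl

theorem isSurjSubmersion_src [Nonempty B] :
    IsSurjSubmersion ((IB.prod IB).prod IG) (IB.prod IM) Q.atGroupoid.src := by
  have h : ∀ a, ContMDiffAt ((IB.prod IB).prod IG) (IB.prod IM) ∞ Q.atGroupoid.src a ∧
      IsSubmersiveAt ((IB.prod IB).prod IG) (IB.prod IM) Q.atGroupoid.src a := fun a => by
    have ht := 𝒢.isLieGroupoid.src_submersion
    refine (Q.isSmoothTrivialization_atTriv (Q.index (Q.leftEnd a))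
        (Q.index (Q.rightEnd a))).contMDiffAt_and_isSubmersiveAt
      (Q.isSmoothTrivialization_shadowTriv (Q.index (Q.rightEnd a)))
      (φ := Prod.map Prod.snd 𝒢.src) (contMDiff_snd.prodMap ht.contMDiff)
      (fun z => (isSubmersiveAt_snd _).prodMap (ht.isSubmersiveAt _))
      ((Q.atTriv _ _).mem_source.2 ⟨Q.mem_dom_index _, Q.mem_dom_index _⟩) fun y hy => ?_
    obtain ⟨h1, h2⟩ := (Q.atTriv _ _).mem_source.1 hy
    rw [Q.atTriv_eq hy]
    refine ⟨(Q.shadowTriv _).mem_target.2 h2, ?_⟩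
    conv_lhs => rw [← atPt_atTriv h1 h2]
    exact src_atPt h1 h2 _
  refine isSurjSubmersion_of_isSubmersiveAt (fun p => (h p).1) (fun x => ?_) fun p => (h p).2
  obtain ⟨i, b, hb, m, rfl⟩ := Q.exists_shadowPt x
  obtain ⟨g, rfl⟩ := 𝒢.isLieGroupoid.src_submersion.surjective m
  -- The left end of an arrow with prescribed source is free, and any base point serves.
  exact ⟨_, src_atPt (Q.mem_dom_index (Classical.arbitrary B)) hb g⟩

theorem isSurjSubmersion_tgt [Nonempty B] :
    IsSurjSubmersion ((IB.prod IB).prod IG) (IB.prod IM) Q.atGroupoid.tgt := by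
  have h : ∀ a, ContMDiffAt ((IB.prod IB).prod IG) (IB.prod IM) ∞ Q.atGroupoid.tgt a ∧
      IsSubmersiveAt ((IB.prod IB).prod IG) (IB.prod IM) Q.atGroupoid.tgt a := fun a => by
    have ht := 𝒢.isLieGroupoid.tgt_submersion
    refine (Q.isSmoothTrivialization_atTriv (Q.index (Q.leftEnd a))
        (Q.index (Q.rightEnd a))).contMDiffAt_and_isSubmersiveAt
      (Q.isSmoothTrivialization_shadowTriv (Q.index (Q.leftEnd a)))
      (φ := Prod.map Prod.fst 𝒢.tgt) (contMDiff_fst.prodMap ht.contMDiff)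
      (fun z => (isSubmersiveAt_fst _).prodMap (ht.isSubmersiveAt _))
      ((Q.atTriv _ _).mem_source.2 ⟨Q.mem_dom_index _, Q.mem_dom_index _⟩) fun y hy => ?_
    obtain ⟨h1, h2⟩ := (Q.atTriv _ _).mem_source.1 hy
    rw [Q.atTriv_eq hy]
    refine ⟨(Q.shadowTriv _).mem_target.2 h1, ?_⟩
    conv_lhs => rw [← atPt_atTriv h1 h2]
    exact tgt_atPt h1 h2 _
  refine isSurjSubmersion_of_isSubmersiveAt (fun p => (h p).1) (fun x => ?_) fun p => (h p).2
  obtain ⟨i, b, hb, m, rfl⟩ := Q.exists_shadowPt x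
  obtain ⟨g, rfl⟩ := 𝒢.isLieGroupoid.tgt_submersion.surjective m
  exact ⟨_, tgt_atPt hb (Q.mem_dom_index (Classical.arbitrary B)) g⟩

/-- The definition uses `index`, which may jump from point to point. Over the open set `Oᵢ` the
coordinate formula with constant index `i` replaces it, and that formula is visibly smooth. The
other structure maps are handled alike. -/
theorem contMDiff_one : ContMDiff (IB.prod IM) ((IB.prod IB).prod IG) ∞ Q.atGroupoid.one := by
  refine contMDiff_of_forall_isOpen fun x => ?_
  set i := Q.index (Q.shadowProj x)
  refine ⟨Q.shadowProj ⁻¹' Q.dom i, (Q.isOpen_dom i).preimage Q.contMDiff_shadowProj.continuous,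
    Q.mem_dom_index _, ?_⟩
  have hp := Q.contMDiff_shadowProj.contMDiffOn (s := Q.shadowProj ⁻¹' Q.dom i)
  have h1 := (Q.isSmoothTrivialization_shadowTriv i).contMDiffOn_snd_comp
    (contMDiff_id.contMDiffOn (s := Q.shadowProj ⁻¹' Q.dom i)) fun _ hz => hz
  refine (contMDiffOn_atPt (i := i) (j := i) hp
    (𝒢.isLieGroupoid.contMDiff_one.comp_contMDiffOn h1) hp (fun _ hz => hz) fun _ hz => hz).congr
    fun y hy => ?_
  conv_lhs => rw [← shadowPt_shadowTriv hy]
  exact one_shadowPt hy _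

/-- The arrows between fibres over `Oᵢ` and `Oⱼ`. -/
def atDom (i j : ι) : Set Q.Atiyah := {a | Q.leftEnd a ∈ Q.dom i ∧ Q.rightEnd a ∈ Q.dom j}

theorem isOpen_atDom (i j : ι) : IsOpen (Q.atDom i j) :=
  ((Q.isOpen_dom i).preimage Q.contMDiff_leftEnd.continuous).inter
    ((Q.isOpen_dom j).preimage Q.contMDiff_rightEnd.continuous)

theorem mem_atDom_index (a : Q.Atiyah) :
    a ∈ Q.atDom (Q.index (Q.leftEnd a)) (Q.index (Q.rightEnd a)) :=
  ⟨Q.mem_dom_index _, Q.mem_dom_index _⟩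

theorem contMDiff_inv :
    ContMDiff ((IB.prod IB).prod IG) ((IB.prod IB).prod IG) ∞ Q.atGroupoid.inv := by
  refine contMDiff_of_forall_isOpen fun a => ⟨_, Q.isOpen_atDom _ _, Q.mem_atDom_index a, ?_⟩
  refine (contMDiffOn_atPt Q.contMDiff_rightEnd.contMDiffOn
    (𝒢.isLieGroupoid.contMDiff_inv.comp_contMDiffOn
      (contMDiffOn_atTriv_snd contMDiff_id.contMDiffOn (fun _ hz => hz.1) fun _ hz => hz.2))
    Q.contMDiff_leftEnd.contMDiffOn (fun _ hz => hz.2) fun _ hz => hz.1).congr fun y hy => ?_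
  conv_lhs => rw [← atPt_atTriv hy.1 hy.2]
  exact inv_atPt hy.1 hy.2 _

variable {Q}

theorem leftEnd_eq_of_composable {a c : Q.Atiyah} (h : Q.atGroupoid.src a = Q.atGroupoid.tgt c) :
    Q.leftEnd c = Q.rightEnd a := by
  rw [← shadowProj_src, ← shadowProj_tgt, h]

/-- Once the middle index is shared, composability in `At(P)` is composability of the coordinates in
`𝒢`, because a local trivialisation of `ℱ` is injective on each fibre. -/
theorem src_eq_tgt_of_composable {i j k : ι} {a c : Q.Atiyah}
    (h : Q.atGroupoid.src a = Q.atGroupoid.tgt c) (ha : a ∈ Q.atDom i j) (hc : c ∈ Q.atDom j k) :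
    𝒢.src (Q.atTriv i j a).2 = 𝒢.tgt (Q.atTriv j k c).2 := by
  have h1 := src_atPt ha.1 ha.2 (Q.atTriv i j a).2
  have h2 := tgt_atPt hc.1 hc.2 (Q.atTriv j k c).2
  rw [atPt_atTriv ha.1 ha.2] at h1
  rw [atPt_atTriv hc.1 hc.2, leftEnd_eq_of_composable h] at h2
  exact shadowPt_inj ha.2 (h1.symm.trans (h.trans h2))

theorem mul_eq {i j k : ι} {a c : Q.Atiyah}
    (h : Q.atGroupoid.src a = Q.atGroupoid.tgt c) (ha : a ∈ Q.atDom i j) (hc : c ∈ Q.atDom j k) :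
    Q.atGroupoid.mul a c = Q.atPt i k (Q.leftEnd a)
      (𝒢.mul (Q.atTriv i j a).2 (Q.atTriv j k c).2) (Q.rightEnd c) := by
  have h1 := mul_atPt ha.1 ha.2 hc.2 (src_eq_tgt_of_composable h ha hc)
  have h2 := atPt_atTriv hc.1 hc.2
  rw [leftEnd_eq_of_composable h] at h2
  rwa [atPt_atTriv ha.1 ha.2, h2] at h1

variable (Q)

theorem contMDiffOn_mul :
    ContMDiffOn (((IB.prod IB).prod IG).prod ((IB.prod IB).prod IG)) ((IB.prod IB).prod IG) ∞
      (fun q : Q.Atiyah × Q.Atiyah => Q.atGroupoid.mul q.1 q.2) Q.atGroupoid.composable := by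
  refine contMDiffOn_of_forall_isOpen fun ⟨a, c⟩ hq => ?_
  have hq' : Q.atGroupoid.src a = Q.atGroupoid.tgt c := hq
  set i := Q.index (Q.leftEnd a)
  set j := Q.index (Q.rightEnd a) with hj
  set k := Q.index (Q.rightEnd c)
  -- Composable arrows have the same middle base point, so the index chosen for the right end of `a`
  -- also serves for the left end of `c`.
  have hc : c ∈ Q.atDom j k := by
    refine ⟨?_, Q.mem_dom_index _⟩
    rw [leftEnd_eq_of_composable hq']; exact Q.mem_dom_index _
  refine ⟨Q.atDom i j ×ˢ Q.atDom j k, (Q.isOpen_atDom i j).prod (Q.isOpen_atDom j k),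
    ⟨Q.mem_atDom_index a, hc⟩, ?_⟩
  have h1 := contMDiffOn_atTriv_snd (i := i) (j := j)
    (s := Q.atGroupoid.composable ∩ Q.atDom i j ×ˢ Q.atDom j k)
    (contMDiff_fst (I := (IB.prod IB).prod IG) (J := (IB.prod IB).prod IG) (n := ∞)
      (M := Q.Atiyah) (N := Q.Atiyah)).contMDiffOn
    (fun q hq => hq.2.1.1) fun q hq => hq.2.1.2
  have h2 := contMDiffOn_atTriv_snd (i := j) (j := k)
    (s := Q.atGroupoid.composable ∩ Q.atDom i j ×ˢ Q.atDom j k)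
    (contMDiff_snd (I := (IB.prod IB).prod IG) (J := (IB.prod IB).prod IG) (n := ∞)
      (M := Q.Atiyah) (N := Q.Atiyah)).contMDiffOn
    (fun q hq => hq.2.2.1) fun q hq => hq.2.2.2
  have h3 := 𝒢.isLieGroupoid.contMDiffOn_mul.comp (h1.prodMk h2)
    fun q hq => src_eq_tgt_of_composable hq.1 hq.2.1 hq.2.2
  exact (contMDiffOn_atPt (Q.contMDiff_leftEnd.comp contMDiff_fst).contMDiffOn h3
    (Q.contMDiff_rightEnd.comp contMDiff_snd).contMDiffOn (fun q hq => hq.2.1.1)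
    fun q hq => hq.2.2.2).congr fun q hq => mul_eq hq.1 hq.2.1 hq.2.2

/-- For each axiom the arrows are represented with matching indices at matching ends:
`exists_atPt_of_tgt` writes the next arrow in the index already used by the previous one. Then the
axiom is that of `𝒢`. -/
theorem isLieGroupoid_atGroupoid [Nonempty B] :
    IsLieGroupoid (IB.prod IM) ((IB.prod IB).prod IG) Q.atGroupoid where
  manifold_obj := Q.isSmoothManifold_shadow
  manifold_arr := Q.isSmoothManifold_atiyah
  src_submersion := Q.isSurjSubmersion_src
  tgt_submersion := Q.isSurjSubmersion_tgt
  contMDiff_one := Q.contMDiff_one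
  contMDiff_inv := Q.contMDiff_inv
  contMDiffOn_mul := Q.contMDiffOn_mul
  src_one x := by
    obtain ⟨i, b, hb, m, rfl⟩ := Q.exists_shadowPt x
    rw [one_shadowPt hb, src_atPt hb hb, 𝒢.isLieGroupoid.src_one]
  tgt_one x := by
    obtain ⟨i, b, hb, m, rfl⟩ := Q.exists_shadowPt x
    rw [one_shadowPt hb, tgt_atPt hb hb, 𝒢.isLieGroupoid.tgt_one]
  src_mul a a' h := by
    obtain ⟨i, b, hb, j, c, hc, g, rfl⟩ := Q.exists_atPt a
    rw [src_atPt hb hc] at h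
    obtain ⟨k, d, hd, g', rfl, hg⟩ := exists_atPt_of_tgt hc h.symm
    rw [mul_atPt hb hc hd hg.symm, src_atPt hb hd, src_atPt hc hd,
      𝒢.isLieGroupoid.src_mul _ _ hg.symm]
  tgt_mul a a' h := by
    obtain ⟨i, b, hb, j, c, hc, g, rfl⟩ := Q.exists_atPt a
    rw [src_atPt hb hc] at h
    obtain ⟨k, d, hd, g', rfl, hg⟩ := exists_atPt_of_tgt hc h.symm
    rw [mul_atPt hb hc hd hg.symm, tgt_atPt hb hd, tgt_atPt hb hc,
      𝒢.isLieGroupoid.tgt_mul _ _ hg.symm]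
  mul_assoc a a' a'' h h' := by
    have hG := 𝒢.isLieGroupoid
    obtain ⟨i, b, hb, j, c, hc, g, rfl⟩ := Q.exists_atPt a
    rw [src_atPt hb hc] at h
    obtain ⟨k, d, hd, g', rfl, hg⟩ := exists_atPt_of_tgt hc h.symm
    rw [src_atPt hc hd] at h'
    obtain ⟨l, e, he, g'', rfl, hg'⟩ := exists_atPt_of_tgt hd h'.symm
    rw [mul_atPt hb hc hd hg.symm, mul_atPt hc hd he hg'.symm,
      mul_atPt hb hd he (by rw [hG.src_mul _ _ hg.symm, hg']),
      mul_atPt hb hc he (by rw [hG.tgt_mul _ _ hg'.symm, hg]),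
      hG.mul_assoc _ _ _ hg.symm hg'.symm]
  one_mul a := by
    have hG := 𝒢.isLieGroupoid
    obtain ⟨i, b, hb, j, c, hc, g, rfl⟩ := Q.exists_atPt a
    rw [tgt_atPt hb hc, one_shadowPt hb, mul_atPt hb hb hc (hG.src_one _), hG.one_mul]
  mul_one a := by
    have hG := 𝒢.isLieGroupoid
    obtain ⟨i, b, hb, j, c, hc, g, rfl⟩ := Q.exists_atPt a
    rw [src_atPt hb hc, one_shadowPt hc, mul_atPt hb hc hc (hG.tgt_one _).symm, hG.mul_one]
  src_inv a := by
    obtain ⟨i, b, hb, j, c, hc, g, rfl⟩ := Q.exists_atPt a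
    rw [inv_atPt hb hc, src_atPt hc hb, tgt_atPt hb hc, 𝒢.isLieGroupoid.src_inv]
  tgt_inv a := by
    obtain ⟨i, b, hb, j, c, hc, g, rfl⟩ := Q.exists_atPt a
    rw [inv_atPt hb hc, tgt_atPt hc hb, src_atPt hb hc, 𝒢.isLieGroupoid.tgt_inv]
  mul_inv a := by
    have hG := 𝒢.isLieGroupoid
    obtain ⟨i, b, hb, j, c, hc, g, rfl⟩ := Q.exists_atPt a
    rw [inv_atPt hb hc, mul_atPt hb hc hb (hG.tgt_inv g).symm, hG.mul_inv, tgt_atPt hb hc,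
      one_shadowPt hb]
  inv_mul a := by
    have hG := 𝒢.isLieGroupoid
    obtain ⟨i, b, hb, j, c, hc, g, rfl⟩ := Q.exists_atPt a
    rw [inv_atPt hb hc, mul_atPt hc hb hc (hG.src_inv g), hG.inv_mul, src_atPt hb hc,
      one_shadowPt hc]

end PrincipaloidBundle

end Smoothness

/-! ### The actions of the Atiyah–Ehresmann groupoid -/

section Actions

variable {EM : Type*} [NormedAddCommGroup EM] [NormedSpace ℝ EM] {HM : Type*} [TopologicalSpace HM]
variable {EG : Type*} [NormedAddCommGroup EG] [NormedSpace ℝ EG] {HG : Type*} [TopologicalSpace HG]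
variable {EB : Type*} [NormedAddCommGroup EB] [NormedSpace ℝ EB] {HB : Type*} [TopologicalSpace HB]
variable {EP : Type*} [NormedAddCommGroup EP] [NormedSpace ℝ EP] {HP : Type*} [TopologicalSpace HP]
variable {IM : ModelWithCorners ℝ EM HM} {IG : ModelWithCorners ℝ EG HG}
variable {M : Type*} [TopologicalSpace M] [ChartedSpace HM M]
variable {G : Type*} [TopologicalSpace G] [ChartedSpace HG G]
variable {𝒢 : LieGroupoid IM M IG G}
variable {IB : ModelWithCorners ℝ EB HB} {B : Type*} [TopologicalSpace B] [ChartedSpace HB B]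
variable {IP : ModelWithCorners ℝ EP HP} {P : Type*} [TopologicalSpace P] [ChartedSpace HP P]
variable {ι : Type*} (Q : PrincipaloidBundle 𝒢 IB B IP P ι)

namespace PrincipaloidBundle

variable {Q}

theorem proj_eq_of_src_eq_duck {a : Q.Atiyah} {p : P} (h : Q.atGroupoid.src a = Q.duck p) :
    Q.proj p = Q.rightEnd a := by
  rw [← shadowProj_src, ← shadowProj_duck, h]

theorem src_eq_tgt_of_src_eq_duck {i j : ι} {a : Q.Atiyah} {p : P}
    (h : Q.atGroupoid.src a = Q.duck p) (ha : a ∈ Q.atDom i j) :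
    𝒢.src (Q.atTriv i j a).2 = 𝒢.tgt (Q.triv j p).2 := by
  have hp : Q.proj p ∈ Q.dom j := proj_eq_of_src_eq_duck h ▸ ha.2
  have h1 := src_atPt ha.1 ha.2 (Q.atTriv i j a).2
  have h2 := duck_pt hp (Q.triv j p).2
  rw [atPt_atTriv ha.1 ha.2] at h1
  rw [Q.pt_triv hp, proj_eq_of_src_eq_duck h] at h2
  exact shadowPt_inj ha.2 (h1.symm.trans (h.trans h2))

/-- This form has the indices frozen on a whole open set of arrows; it serves both the smoothness of
the action and its model form in the trident. -/
theorem act_eq {i j : ι} {a : Q.Atiyah} {p : P} (h : Q.atGroupoid.src a = Q.duck p)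
    (ha : a ∈ Q.atDom i j) :
    Q.leftP.act a p = Q.pt i (Q.leftEnd a) (𝒢.mul (Q.atTriv i j a).2 (Q.triv j p).2) := by
  have hp : Q.proj p ∈ Q.dom j := proj_eq_of_src_eq_duck h ▸ ha.2
  have h1 := act_atPt_pt ha.1 ha.2 (src_eq_tgt_of_src_eq_duck h ha)
  have h2 := Q.pt_triv hp
  rw [proj_eq_of_src_eq_duck h] at h2
  rwa [atPt_atTriv ha.1 ha.2, h2] at h1

variable (Q)

theorem contMDiffOn_leftP_act :
    ContMDiffOn (((IB.prod IB).prod IG).prod IP) IP ∞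
      (fun q : Q.Atiyah × P => Q.leftP.act q.1 q.2)
      {q | Q.atGroupoid.src q.1 = Q.leftP.moment q.2} := by
  refine contMDiffOn_of_forall_isOpen fun ⟨a, p⟩ hq => ?_
  set i := Q.index (Q.leftEnd a)
  set j := Q.index (Q.rightEnd a)
  -- No condition on the point of `P` is imposed: within the fibred product it lies over the right
  -- end of the arrow, hence over `Oⱼ`.
  refine ⟨Prod.fst ⁻¹' Q.atDom i j, (Q.isOpen_atDom i j).preimage continuous_fst,
    Q.mem_atDom_index a, ?_⟩
  have h1 := contMDiffOn_atTriv_snd (i := i) (j := j)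
    (s := {q : Q.Atiyah × P | Q.atGroupoid.src q.1 = Q.leftP.moment q.2} ∩
      Prod.fst ⁻¹' Q.atDom i j)
    (contMDiff_fst (I := (IB.prod IB).prod IG) (J := IP) (n := ∞)
      (M := Q.Atiyah) (N := P)).contMDiffOn
    (fun q hq => hq.2.1) fun q hq => hq.2.2
  have h2 := contMDiffOn_triv_snd (Q := Q) (i := j)
    (s := {q : Q.Atiyah × P | Q.atGroupoid.src q.1 = Q.leftP.moment q.2} ∩
      Prod.fst ⁻¹' Q.atDom i j)
    (contMDiff_snd (I := (IB.prod IB).prod IG) (J := IP) (n := ∞)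
      (M := Q.Atiyah) (N := P)).contMDiffOn
    fun q hq => proj_eq_of_src_eq_duck hq.1 ▸ hq.2.2
  have h3 := 𝒢.isLieGroupoid.contMDiffOn_mul.comp (h1.prodMk h2)
    fun q hq => src_eq_tgt_of_src_eq_duck hq.1 hq.2
  exact (contMDiffOn_pt (Q.contMDiff_leftEnd.comp contMDiff_fst).contMDiffOn h3
    (fun q hq => hq.2.1)).congr fun q hq => act_eq hq.1 hq.2

theorem isLeftModule_leftP :
    IsLeftModule (IB.prod IM) ((IB.prod IB).prod IG) IP Q.atGroupoid Q.leftP where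
  manifold := Q.isRightModule.manifold
  contMDiff_moment := Q.isSurjSubmersion_duck.contMDiff
  contMDiffOn_act := Q.contMDiffOn_leftP_act
  moment_act a p h := by
    change Q.atGroupoid.src a = Q.duck p at h
    change Q.duck _ = _
    obtain ⟨i, b, hb, j, c, hc, g, rfl⟩ := Q.exists_atPt a
    rw [src_atPt hb hc] at h
    obtain ⟨g', rfl, hg⟩ := exists_pt_of_duck hc h.symm
    rw [act_atPt_pt hb hc hg.symm, duck_pt hb, tgt_atPt hb hc,
      𝒢.isLieGroupoid.tgt_mul _ _ hg.symm]
  one_act p := by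
    change Q.leftP.act (Q.atGroupoid.one (Q.duck p)) p = p
    obtain ⟨i, b, hb, g, rfl⟩ := Q.exists_pt p
    rw [duck_pt hb, one_shadowPt hb, act_atPt_pt hb hb (𝒢.isLieGroupoid.src_one _),
      𝒢.isLieGroupoid.one_mul]
  act_act a a' p h h' := by
    have hG := 𝒢.isLieGroupoid
    change Q.atGroupoid.src a' = Q.duck p at h'
    obtain ⟨i, b, hb, j, c, hc, g, rfl⟩ := Q.exists_atPt a
    rw [src_atPt hb hc] at h
    obtain ⟨k, d, hd, g', rfl, hg⟩ := exists_atPt_of_tgt hc h.symm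
    rw [src_atPt hc hd] at h'
    obtain ⟨g'', rfl, hg'⟩ := exists_pt_of_duck hd h'.symm
    rw [mul_atPt hb hc hd hg.symm, act_atPt_pt hc hd hg'.symm,
      act_atPt_pt hb hd (by rw [hG.src_mul _ _ hg.symm, hg']),
      act_atPt_pt hb hc (by rw [hG.tgt_mul _ _ hg'.symm, hg]),
      hG.mul_assoc _ _ _ hg.symm hg'.symm]

/-- The action of an arrow is its target, so the module axioms are the target axioms for units and
products in `At(P)`. -/
theorem isLeftModule_leftShadow [Nonempty B] :
    IsLeftModule (IB.prod IM) ((IB.prod IB).prod IG) (IB.prod IM) Q.atGroupoid Q.leftShadow where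
  manifold := Q.isSmoothManifold_shadow
  contMDiff_moment := contMDiff_id
  contMDiffOn_act := (Q.isSurjSubmersion_tgt.contMDiff.comp contMDiff_fst).contMDiffOn
  moment_act _ _ _ := rfl
  one_act := Q.isLieGroupoid_atGroupoid.tgt_one
  act_act a a' _ h _ := (Q.isLieGroupoid_atGroupoid.tgt_mul a a' h).symm

theorem isLieGroupoidMorphism_atProj [Nonempty B] :
    IsLieGroupoidMorphism (IB.prod IM) ((IB.prod IB).prod IG) IB (IB.prod IB)
      Q.atGroupoid (pairGroupoid B) Q.atProj Q.shadowProj where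
  contMDiff_arr := Q.contMDiff_atProj
  contMDiff_obj := Q.contMDiff_shadowProj
  src_map a := (shadowProj_src a).symm
  tgt_map a := (shadowProj_tgt a).symm
  map_one _ := atProj_atPt (Q.mem_dom_index _) (Q.mem_dom_index _) _
  map_inv _ := atProj_atPt (Q.mem_dom_index _) (Q.mem_dom_index _) _
  map_mul _ _ _ := atProj_atPt (Q.mem_dom_index _) (Q.mem_dom_index _) _

theorem isLeftModuleMorphism_proj [Nonempty B] :
    IsLeftModuleMorphism (IB.prod IM) ((IB.prod IB).prod IG) IB (IB.prod IB) IP IB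
      Q.atGroupoid (pairGroupoid B) Q.leftP (pairAction B) Q.atProj Q.shadowProj Q.proj where
  isMorphism := Q.isLieGroupoidMorphism_atProj
  contMDiff := Q.contMDiff_proj
  moment_map p := (shadowProj_duck p).symm
  map_act _ _ _ := Q.proj_pt (Q.mem_dom_index _) _

/-! ### The bibundle -/

/-- The arrow of `At(P)` that takes `q` to `p`, for `p` and `q` with the same moment. -/
noncomputable def division (p q : P) : Q.Atiyah :=
  Q.atPt (Q.index (Q.proj p)) (Q.index (Q.proj q)) (Q.proj p)
    (𝒢.mul (Q.triv (Q.index (Q.proj p)) p).2 (𝒢.inv (Q.triv (Q.index (Q.proj q)) q).2)) (Q.proj q)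

/-- The arrow of `𝒢` that takes `p` to `q`, for `p` and `q` with the same sitting-duck image. -/
noncomputable def rightDivision (p q : P) : G :=
  𝒢.mul (𝒢.inv (Q.triv (Q.index (Q.proj p)) p).2) (Q.triv (Q.index (Q.proj p)) q).2

variable {Q}

theorem inv_leftMul {i j : ι} {b : B} (hi : b ∈ Q.dom i) (hj : b ∈ Q.dom j) (g : G) :
    𝒢.inv (Q.leftMul i j b g) = Q.rightMulInv i j b (𝒢.inv g) := by
  rw [leftMul, rightMulInv, 𝒢.isLieGroupoid.src_inv,
    𝒢.isLieGroupoid.inv_mul_inv _ _ (Q.src_cocycle hi hj _)]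

/-- A change of trivialisation at the first point multiplies `g · h⁻¹` on the left; one at the
second point turns, under inversion, into an inverse bisection on the right. This is the gluing of
`At(P)`. -/
theorem division_pt {i j : ι} {b c : B} (hb : b ∈ Q.dom i) (hc : c ∈ Q.dom j) {g h : G}
    (hgh : 𝒢.src g = 𝒢.src h) :
    Q.division (Q.pt i b g) (Q.pt j c h) = Q.atPt i j b (𝒢.mul g (𝒢.inv h)) c := by
  have hb' := Q.mem_dom_index b
  have hc' := Q.mem_dom_index c
  have hgh' : 𝒢.src g = 𝒢.tgt (𝒢.inv h) := by rw [𝒢.isLieGroupoid.tgt_inv, hgh]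
  rw [division, Q.proj_pt hb, Q.proj_pt hc, Q.change_eq_leftMul hb' hb, Q.change_eq_leftMul hc' hc,
    inv_leftMul hc' hc, mul_rightMulInv hc' hc (by rw [Q.src_leftMul hb' hb, hgh']),
    leftMul_mul hb' hb hgh', ← atPt_change hb hb' hc hc']

/-- In `(β ▷ g)⁻¹ · (β ▷ h)` the bisection cancels because `t g = t h`, so the quotient is a
well-defined arrow of `𝒢`. -/
theorem rightDivision_pt {i : ι} {b : B} (hb : b ∈ Q.dom i) {g h : G} (hgh : 𝒢.tgt g = 𝒢.tgt h) :
    Q.rightDivision (Q.pt i b g) (Q.pt i b h) = 𝒢.mul (𝒢.inv g) h := by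
  have hb' := Q.mem_dom_index b
  rw [rightDivision, Q.proj_pt hb, Q.change_eq_leftMul hb' hb, Q.change_eq_leftMul hb' hb,
    inv_leftMul hb' hb, rightMulInv_mul_leftMul hb' hb (by rw [𝒢.isLieGroupoid.src_inv, hgh])]

theorem duck_act {p : P} {g : G} (h : Q.right.moment p = 𝒢.tgt g) :
    Q.duck (Q.right.act p g) = Q.duck p := by
  obtain ⟨i, b, hb, g', rfl⟩ := Q.exists_pt p
  rw [Q.moment_pt hb] at h
  rw [Q.pt_mul hb _ _ h, duck_pt hb, duck_pt hb, 𝒢.isLieGroupoid.tgt_mul _ _ h]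

theorem moment_leftP_act {a : Q.Atiyah} {p : P} (h : Q.atGroupoid.src a = Q.duck p) :
    Q.right.moment (Q.leftP.act a p) = Q.right.moment p := by
  obtain ⟨i, b, hb, j, c, hc, g, rfl⟩ := Q.exists_atPt a
  rw [src_atPt hb hc] at h
  obtain ⟨g', rfl, hg⟩ := exists_pt_of_duck hc h.symm
  rw [act_atPt_pt hb hc hg.symm, Q.moment_pt hb, Q.moment_pt hc,
    𝒢.isLieGroupoid.src_mul _ _ hg.symm]

variable (Q)

theorem contMDiffOn_division :
    ContMDiffOn (IP.prod IP) ((IB.prod IB).prod IG) ∞ (fun q : P × P => Q.division q.1 q.2)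
      {q | Q.right.moment q.1 = Q.right.moment q.2} := by
  have hG := 𝒢.isLieGroupoid
  refine contMDiffOn_of_forall_isOpen fun ⟨p, p'⟩ _ => ?_
  set i := Q.index (Q.proj p)
  set j := Q.index (Q.proj p')
  set U : Set (P × P) := (Q.proj ⁻¹' Q.dom i) ×ˢ (Q.proj ⁻¹' Q.dom j)
  have hp : ContMDiff IP IB ∞ Q.proj := Q.contMDiff_proj
  refine ⟨U, ((Q.isOpen_dom i).preimage hp.continuous).prod
    ((Q.isOpen_dom j).preimage hp.continuous), ⟨Q.mem_dom_index _, Q.mem_dom_index _⟩, ?_⟩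
  have h1 := contMDiffOn_triv_snd (Q := Q) (i := i)
    (s := {q : P × P | Q.right.moment q.1 = Q.right.moment q.2} ∩ U)
    (contMDiff_fst (I := IP) (J := IP) (n := ∞) (M := P) (N := P)).contMDiffOn
    fun q hq => hq.2.1
  have h2 := contMDiffOn_triv_snd (Q := Q) (i := j)
    (s := {q : P × P | Q.right.moment q.1 = Q.right.moment q.2} ∩ U)
    (contMDiff_snd (I := IP) (J := IP) (n := ∞) (M := P) (N := P)).contMDiffOn
    fun q hq => hq.2.2
  -- The moment is the source in every trivialisation, so equal moments make `g · h⁻¹` defined even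
  -- when `i` and `j` differ.
  have key : ∀ q ∈ {q : P × P | Q.right.moment q.1 = Q.right.moment q.2} ∩ U,
      𝒢.src (Q.triv i q.1).2 = 𝒢.src (Q.triv j q.2).2 := fun q hq => by
    rw [← Q.moment_triv i _ ((Q.triv i).mem_source.2 hq.2.1),
      ← Q.moment_triv j _ ((Q.triv j).mem_source.2 hq.2.2)]
    exact hq.1
  have h3 := hG.contMDiffOn_mul.comp (h1.prodMk (hG.contMDiff_inv.comp_contMDiffOn h2))
    fun q hq => (key q hq).trans (hG.tgt_inv _).symm
  refine (contMDiffOn_atPt (Q := Q) (hp.comp contMDiff_fst).contMDiffOn h3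
    (hp.comp contMDiff_snd).contMDiffOn (fun q hq => hq.2.1) fun q hq => hq.2.2).congr
    fun q hq => ?_
  have h4 := division_pt hq.2.1 hq.2.2 (key q hq)
  rwa [Q.pt_triv hq.2.1, Q.pt_triv hq.2.2] at h4

theorem contMDiffOn_rightDivision :
    ContMDiffOn (IP.prod IP) IG ∞ (fun q : P × P => Q.rightDivision q.1 q.2)
      {q | Q.duck q.1 = Q.duck q.2} := by
  have hG := 𝒢.isLieGroupoid
  refine contMDiffOn_of_forall_isOpen fun ⟨p, p'⟩ _ => ?_
  set i := Q.index (Q.proj p)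
  set U : Set (P × P) := Prod.fst ⁻¹' (Q.proj ⁻¹' Q.dom i)
  refine ⟨U, ((Q.isOpen_dom i).preimage Q.contMDiff_proj.continuous).preimage continuous_fst,
    Q.mem_dom_index _, ?_⟩
  -- Since `D` covers the identity of `B`, points with equal image lie in one fibre, and the index
  -- of the first serves for both.
  have hpr : ∀ q ∈ {q : P × P | Q.duck q.1 = Q.duck q.2} ∩ U, Q.proj q.2 = Q.proj q.1 :=
    fun q hq => by rw [← shadowProj_duck, ← shadowProj_duck, show Q.duck q.1 = _ from hq.1]
  have h1 := contMDiffOn_triv_snd (Q := Q) (i := i)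
    (s := {q : P × P | Q.duck q.1 = Q.duck q.2} ∩ U)
    (contMDiff_fst (I := IP) (J := IP) (n := ∞) (M := P) (N := P)).contMDiffOn
    fun q hq => hq.2
  have h2 := contMDiffOn_triv_snd (Q := Q) (i := i)
    (s := {q : P × P | Q.duck q.1 = Q.duck q.2} ∩ U)
    (contMDiff_snd (I := IP) (J := IP) (n := ∞) (M := P) (N := P)).contMDiffOn
    fun q hq => hpr q hq ▸ hq.2
  have hpt : ∀ q ∈ {q : P × P | Q.duck q.1 = Q.duck q.2} ∩ U,
      Q.pt i (Q.proj q.1) (Q.triv i q.2).2 = q.2 := fun q hq => by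
    rw [← hpr q hq]; exact Q.pt_triv (hpr q hq ▸ hq.2)
  have key : ∀ q ∈ {q : P × P | Q.duck q.1 = Q.duck q.2} ∩ U,
      𝒢.tgt (Q.triv i q.1).2 = 𝒢.tgt (Q.triv i q.2).2 := fun q hq => by
    refine shadowPt_inj hq.2 ?_
    rw [← duck_pt hq.2, ← duck_pt hq.2, hpt q hq, Q.pt_triv hq.2]
    exact hq.1
  refine (hG.contMDiffOn_mul.comp ((hG.contMDiff_inv.comp_contMDiffOn h1).prodMk h2)
    fun q hq => (hG.src_inv _).trans (key q hq)).congr fun q hq => ?_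
  have h4 := rightDivision_pt hq.2 (key q hq)
  rwa [Q.pt_triv hq.2, hpt q hq] at h4

/-- The inverse is `(p, p') ↦ (division p p', p')`; in coordinates the two inverse laws are `(g · h)
· h⁻¹ = g` and `(g · h⁻¹) · h = g`. -/
theorem isDiffeoBetween_left :
    IsDiffeoBetween (((IB.prod IB).prod IG).prod IP) (IP.prod IP)
      {q : Q.Atiyah × P | Q.atGroupoid.src q.1 = Q.leftP.moment q.2}
      {q : P × P | Q.right.moment q.1 = Q.right.moment q.2}
      (fun q => (Q.leftP.act q.1 q.2, q.2)) := by
  have hG := 𝒢.isLieGroupoid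
  refine ⟨Q.contMDiffOn_leftP_act.prodMk contMDiff_snd.contMDiffOn,
    fun q hq => moment_leftP_act hq, fun q => (Q.division q.1 q.2, q.2),
    Q.contMDiffOn_division.prodMk contMDiff_snd.contMDiffOn, ?_, ?_, ?_⟩
  · rintro ⟨p, p'⟩ hq
    change Q.right.moment p = Q.right.moment p' at hq
    change Q.atGroupoid.src (Q.division p p') = Q.duck p'
    obtain ⟨i, b, hb, g, rfl⟩ := Q.exists_pt p
    obtain ⟨j, c, hc, h, rfl⟩ := Q.exists_pt p'
    rw [Q.moment_pt hb, Q.moment_pt hc] at hq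
    rw [division_pt hb hc hq, src_atPt hb hc, duck_pt hc,
      hG.src_mul _ _ (by rw [hG.tgt_inv, hq]), hG.src_inv]
  · rintro ⟨a, p⟩ hq
    change Q.atGroupoid.src a = Q.duck p at hq
    refine Prod.ext ?_ rfl
    change Q.division (Q.leftP.act a p) p = a
    obtain ⟨i, b, hb, j, c, hc, g, rfl⟩ := Q.exists_atPt a
    rw [src_atPt hb hc] at hq
    obtain ⟨h, rfl, hg⟩ := exists_pt_of_duck hc hq.symm
    rw [act_atPt_pt hb hc hg.symm, division_pt hb hc (hG.src_mul _ _ hg.symm),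
      hG.mul_assoc _ _ _ hg.symm (hG.tgt_inv h).symm, hG.mul_inv, hg, hG.mul_one]
  · rintro ⟨p, p'⟩ hq
    change Q.right.moment p = Q.right.moment p' at hq
    refine Prod.ext ?_ rfl
    change Q.leftP.act (Q.division p p') p' = p
    obtain ⟨i, b, hb, g, rfl⟩ := Q.exists_pt p
    obtain ⟨j, c, hc, h, rfl⟩ := Q.exists_pt p'
    rw [Q.moment_pt hb, Q.moment_pt hc] at hq
    have hq' : 𝒢.src g = 𝒢.tgt (𝒢.inv h) := by rw [hG.tgt_inv, hq]
    rw [division_pt hb hc hq, act_atPt_pt hb hc (by rw [hG.src_mul _ _ hq', hG.src_inv]),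
      hG.mul_assoc _ _ _ hq' (hG.src_inv h), hG.inv_mul, ← hq, hG.mul_one]

/-- The inverse is `(p, p') ↦ (p, rightDivision p p')`, through `h⁻¹ · (h · g) = g` and `g · (g⁻¹ ·
h) = h`. -/
theorem isDiffeoBetween_right :
    IsDiffeoBetween (IP.prod IG) (IP.prod IP)
      {q : P × G | Q.right.moment q.1 = 𝒢.tgt q.2} {q : P × P | Q.duck q.1 = Q.duck q.2}
      (fun q => (q.1, Q.right.act q.1 q.2)) := by
  have hG := 𝒢.isLieGroupoid
  refine ⟨contMDiff_fst.contMDiffOn.prodMk Q.isRightModule.contMDiffOn_act,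
    fun q hq => (duck_act hq).symm, fun q => (q.1, Q.rightDivision q.1 q.2),
    contMDiff_fst.contMDiffOn.prodMk Q.contMDiffOn_rightDivision, ?_, ?_, ?_⟩
  · rintro ⟨p, p'⟩ hq
    change Q.duck p = Q.duck p' at hq
    change Q.right.moment p = 𝒢.tgt (Q.rightDivision p p')
    obtain ⟨i, b, hb, g, rfl⟩ := Q.exists_pt p
    rw [duck_pt hb] at hq
    obtain ⟨h, rfl, hg⟩ := exists_pt_of_duck hb hq.symm
    rw [rightDivision_pt hb hg.symm, Q.moment_pt hb,
      hG.tgt_mul _ _ (by rw [hG.src_inv, hg]), hG.tgt_inv]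
  · rintro ⟨p, g⟩ hq
    change Q.right.moment p = 𝒢.tgt g at hq
    refine Prod.ext rfl ?_
    change Q.rightDivision p (Q.right.act p g) = g
    obtain ⟨i, b, hb, h, rfl⟩ := Q.exists_pt p
    rw [Q.moment_pt hb] at hq
    rw [Q.pt_mul hb _ _ hq, rightDivision_pt hb (hG.tgt_mul _ _ hq).symm,
      ← hG.mul_assoc _ _ _ (hG.src_inv h) hq, hG.inv_mul, hq, hG.one_mul]
  · rintro ⟨p, p'⟩ hq
    change Q.duck p = Q.duck p' at hq
    refine Prod.ext rfl ?_
    change Q.right.act p (Q.rightDivision p p') = p'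
    obtain ⟨i, b, hb, g, rfl⟩ := Q.exists_pt p
    rw [duck_pt hb] at hq
    obtain ⟨h, rfl, hg⟩ := exists_pt_of_duck hb hq.symm
    have hq' : 𝒢.src (𝒢.inv g) = 𝒢.tgt h := by rw [hG.src_inv, hg]
    rw [rightDivision_pt hb hg.symm,
      Q.pt_mul hb _ _ (by rw [hG.tgt_mul _ _ hq', hG.tgt_inv]),
      ← hG.mul_assoc _ _ _ (hG.tgt_inv g).symm hq', hG.mul_inv, ← hg, hG.one_mul]

/-- The actions are left and right multiplication in coordinates, so they commute by associativity.
-/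
theorem isPrincipalBibundle [Nonempty B] :
    IsPrincipalBibundle (IB.prod IM) ((IB.prod IB).prod IG) IM IG IP
      Q.atGroupoid 𝒢.toGroupoidMaps Q.leftP Q.right where
  commute a p g h h' := by
    have hG := 𝒢.isLieGroupoid
    change Q.atGroupoid.src a = Q.duck p at h
    obtain ⟨i, b, hb, j, c, hc, k, rfl⟩ := Q.exists_atPt a
    rw [src_atPt hb hc] at h
    obtain ⟨l, rfl, hl⟩ := exists_pt_of_duck hc h.symm
    rw [Q.moment_pt hc] at h'
    rw [act_atPt_pt hb hc hl.symm, Q.pt_mul hc _ _ h',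
      Q.pt_mul hb _ _ (by rw [hG.src_mul _ _ hl.symm, h']),
      act_atPt_pt hb hc (by rw [hG.tgt_mul _ _ h', hl]), hG.mul_assoc _ _ _ hl.symm h']
  left_moment_act _ _ h := duck_act h
  right_moment_act _ _ h := moment_leftP_act h
  left_principal :=
    { isLieGroupoid := Q.isLieGroupoid_atGroupoid
      manifold_base := 𝒢.isLieGroupoid.manifold_obj
      submersion := Q.isSurjSubmersion_moment
      isModule := Q.isLeftModule_leftP
      proj_act := fun _ _ h => moment_leftP_act h
      principal := Q.isDiffeoBetween_left }
  right_principal :=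
    { isLieGroupoid := 𝒢.isLieGroupoid
      manifold_base := Q.isSmoothManifold_shadow
      submersion := Q.isSurjSubmersion_duck
      isModule := Q.isRightModule
      proj_act := fun _ _ h => duck_act h
      principal := Q.isDiffeoBetween_right }

/-! ### The trident -/

theorem isGroupoidBundleOverPair [Nonempty B] :
    IsGroupoidBundleOverPair IB (IB.prod IM) ((IB.prod IB).prod IG) IM IG
      Q.atGroupoid 𝒢.toGroupoidMaps Q.atProj Q.shadowProj Q.atTriv Q.shadowTriv := by
  -- Surjectivity of the projections of `At(P)` and `ℱ` needs points in their typical fibres `G` and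
  -- `M`; these come from the surjectivity of `P → B`.
  have := Q.nonempty_fibre
  have : Nonempty M := ⟨𝒢.src (Classical.arbitrary G)⟩
  have hs : ∀ {i j a}, a ∈ (Q.atTriv i j).source → a ∈ Q.atDom i j :=
    fun ha => (Q.atTriv _ _).mem_source.1 ha
  exact
  { isLieGroupoid_total := Q.isLieGroupoid_atGroupoid
    isLieGroupoid_base := isLieGroupoid_pairGroupoid Q.manifold_base
    isLieGroupoid_fibre := 𝒢.isLieGroupoid
    isMorphism := Q.isLieGroupoidMorphism_atProj
    submersion_arr := isSurjSubmersion_of_trivializations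
      (e := fun x : ι × ι => Q.atTriv x.1 x.2)
      (fun x => Q.isSmoothTrivialization_atTriv x.1 x.2)
      fun b => ⟨(Q.index b.1, Q.index b.2), Q.mem_dom_index _, Q.mem_dom_index _⟩
    submersion_obj := isSurjSubmersion_of_trivializations
      Q.isSmoothTrivialization_shadowTriv fun b => ⟨_, Q.mem_dom_index b⟩
    smooth_arr := Q.isSmoothTrivialization_atTriv
    smooth_obj := Q.isSmoothTrivialization_shadowTriv
    cover := fun b => ⟨_, Q.mem_dom_index b⟩
    baseSet_arr := fun _ _ => rfl
    src_triv := fun i j a ha => by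
      have h1 := src_atPt (hs ha).1 (hs ha).2 (Q.atTriv i j a).2
      rw [atPt_atTriv (hs ha).1 (hs ha).2] at h1
      rw [h1, shadowTriv_shadowPt (hs ha).2]
      rfl
    tgt_triv := fun i j a ha => by
      have h1 := tgt_atPt (hs ha).1 (hs ha).2 (Q.atTriv i j a).2
      rw [atPt_atTriv (hs ha).1 (hs ha).2] at h1
      rw [h1, shadowTriv_shadowPt (hs ha).1]
      rfl
    one_triv := fun i x hx => by
      have hx' : Q.shadowProj x ∈ Q.dom i := (Q.shadowTriv i).mem_source.1 hx
      have h1 := one_shadowPt hx' (Q.shadowTriv i x).2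
      rw [shadowPt_shadowTriv hx'] at h1
      rw [h1, atTriv_atPt hx' hx']
    inv_triv := fun i j a ha => by
      have h1 := inv_atPt (hs ha).1 (hs ha).2 (Q.atTriv i j a).2
      rw [atPt_atTriv (hs ha).1 (hs ha).2] at h1
      rw [h1, atTriv_atPt (hs ha).2 (hs ha).1]
      rfl
    mul_triv := fun i j k a ha c hc h => by
      rw [mul_eq h (hs ha) (hs hc), atTriv_atPt (hs ha).1 (hs hc).2]
      rfl }

theorem isTrident [Nonempty B] :
    IsTrident IB (IB.prod IM) ((IB.prod IB).prod IG) IM IG IM IG IP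
      Q.atGroupoid 𝒢.toGroupoidMaps 𝒢.toGroupoidMaps Q.leftP Q.right Q.proj
      Q.atProj Q.shadowProj Q.atTriv Q.shadowTriv Q.triv where
  bibundle := Q.isPrincipalBibundle
  fibreBundle := ⟨Q.submersion, fun b => ⟨_, Q.mem_dom_index b, Q.smooth_triv _⟩⟩
  proj_right_act := Q.proj_act
  groupoidBundle := Q.isGroupoidBundleOverPair
  covers := Q.isLeftModuleMorphism_proj
  smooth_triv := Q.smooth_triv
  baseSet_triv _ := rfl
  moment_triv i p hp := by
    have hp' : Q.proj p ∈ Q.dom i := (Q.triv i).mem_source.1 hp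
    have h1 := duck_pt hp' (Q.triv i p).2
    rw [Q.pt_triv hp'] at h1
    change Q.shadowTriv i (Q.duck p) = _
    rw [h1, shadowTriv_shadowPt hp']
  act_triv i j a ha p hp h := by
    have ha' : a ∈ Q.atDom i j := (Q.atTriv _ _).mem_source.1 ha
    rw [act_eq h ha', Q.triv_pt ha'.1]
    rfl

/-! ### The Atiyah bundle -/

/-- The map `[(b₁, g, b₂, i, j)] ↦ [([(b₁, g, i)], b₂, j)]`. -/
noncomputable def toAtiyahBundle (a : Q.Atiyah) : Q.AtiyahBundle :=
  Q.atiyahBundlePt (Q.index (Q.rightEnd a))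
    (Q.pt (Q.index (Q.leftEnd a)) (Q.leftEnd a) (Q.arrow a)) (Q.rightEnd a)

/-- The inverse `[([(b₁, g, i)], b₂, j)] ↦ [(b₁, g, b₂, i, j)]` of `toAtiyahBundle`. -/
noncomputable def ofAtiyahBundle (x : Q.AtiyahBundle) : Q.Atiyah :=
  let p := (Q.atiyahBundleTriv (Q.index (Q.atiyahBundleProj x)) x).2
  Q.atPt (Q.index (Q.proj p)) (Q.index (Q.atiyahBundleProj x)) (Q.proj p)
    (Q.triv (Q.index (Q.proj p)) p).2 (Q.atiyahBundleProj x)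

variable {Q}

/-- The two ends are changed separately: the bisection at `b` is the gluing of `P`, and the inverse
bisection at `c` is its right action on `P`, which is the gluing of the associated bundle. -/
theorem toAtiyahBundle_atPt {i j : ι} {b c : B} (hb : b ∈ Q.dom i) (hc : c ∈ Q.dom j) (g : G) :
    Q.toAtiyahBundle (Q.atPt i j b g c) = Q.atiyahBundlePt j (Q.pt i b g) c := by
  have hb' := Q.mem_dom_index b
  have hc' := Q.mem_dom_index c
  rw [toAtiyahBundle, leftEnd_atPt hb hc, rightEnd_atPt hb hc, arrow_atPt hb hc,
    ← actInv_pt hc' hc hb', ← pt_change hb' hb, ← atiyahBundlePt_change hc' hc]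

theorem ofAtiyahBundle_atiyahBundlePt {i j : ι} {b c : B} (hb : b ∈ Q.dom i) (hc : c ∈ Q.dom j)
    (g : G) :
    Q.ofAtiyahBundle (Q.atiyahBundlePt j (Q.pt i b g) c) = Q.atPt i j b g c := by
  have hb' := Q.mem_dom_index b
  have hc' := Q.mem_dom_index c
  rw [ofAtiyahBundle, atiyahBundleProj_pt hc, atiyahBundlePt_change hc' hc, actInv_pt hc' hc hb,
    atiyahBundleTriv_pt hc']
  dsimp only
  rw [Q.proj_pt hb, Q.change_eq_leftMul hb' hb, Q.leftMul_rightMulInv hb' hb hc' hc,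
    ← atPt_change hb hb' hc hc']

variable (Q)

theorem exists_atiyahBundlePt (x : Q.AtiyahBundle) :
    ∃ i, ∃ b ∈ Q.dom i, ∃ j, ∃ c ∈ Q.dom j, ∃ g, x = Q.atiyahBundlePt j (Q.pt i b g) c := by
  have hx := Q.mem_dom_index (Q.atiyahBundleProj x)
  obtain ⟨i, b, hb, g, hp⟩ :=
    Q.exists_pt (Q.atiyahBundleTriv (Q.index (Q.atiyahBundleProj x)) x).2
  exact ⟨i, b, hb, _, _, hx, g, by rw [← hp, atiyahBundlePt_triv hx]⟩

theorem contMDiff_toAtiyahBundle :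
    ContMDiff ((IB.prod IB).prod IG) (IB.prod IP) ∞ Q.toAtiyahBundle := by
  refine contMDiff_of_forall_isOpen fun a => ⟨_, Q.isOpen_atDom _ _, Q.mem_atDom_index a, ?_⟩
  refine (contMDiffOn_atiyahBundlePt (contMDiffOn_pt Q.contMDiff_leftEnd.contMDiffOn
    (contMDiffOn_atTriv_snd contMDiff_id.contMDiffOn (fun _ hz => hz.1) fun _ hz => hz.2)
    fun _ hz => hz.1) Q.contMDiff_rightEnd.contMDiffOn fun _ hz => hz.2).congr fun y hy => ?_
  conv_lhs => rw [← atPt_atTriv hy.1 hy.2]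
  exact toAtiyahBundle_atPt hy.1 hy.2 _

theorem contMDiff_ofAtiyahBundle :
    ContMDiff (IB.prod IP) ((IB.prod IB).prod IG) ∞ Q.ofAtiyahBundle := by
  refine contMDiff_of_forall_isOpen fun x => ?_
  set j := Q.index (Q.atiyahBundleProj x)
  set i := Q.index (Q.proj (Q.atiyahBundleTriv j x).2)
  have hx : x ∈ (Q.atiyahBundleTriv j).source :=
    (Q.atiyahBundleTriv j).mem_source.2 (Q.mem_dom_index _)
  have h1 := (Q.isSmoothTrivialization_atiyahBundleTriv j).contMDiffOn_snd
  have h2 := Q.contMDiff_proj.comp_contMDiffOn h1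
  set U := (Q.atiyahBundleTriv j).source ∩ (fun y => Q.proj (Q.atiyahBundleTriv j y).2) ⁻¹' Q.dom i
  -- The indices are frozen in two stages: the base point of the fibre coordinate in `P` is read in
  -- the `j`-th trivialisation, so its preimage is open only inside the domain of that
  -- trivialisation.
  refine ⟨U, h2.continuousOn.isOpen_inter_preimage (Q.atiyahBundleTriv j).open_source
    (Q.isOpen_dom i), ⟨hx, Q.mem_dom_index _⟩, ?_⟩
  refine (contMDiffOn_atPt (Q := Q) (h2.mono inter_subset_left)
    (contMDiffOn_triv_snd (Q := Q) (i := i) (h1.mono inter_subset_left) fun _ hz => hz.2)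
    Q.contMDiff_atiyahBundleProj.contMDiffOn (fun _ hz => hz.2)
    fun _ hz => (Q.atiyahBundleTriv j).mem_source.1 hz.1).congr fun y hy => ?_
  have hy1 : Q.atiyahBundleProj y ∈ Q.dom j := (Q.atiyahBundleTriv j).mem_source.1 hy.1
  have hy2 : Q.proj (Q.atiyahBundleTriv j y).2 ∈ Q.dom i := hy.2
  have h3 := ofAtiyahBundle_atiyahBundlePt hy2 hy1 (Q.triv i (Q.atiyahBundleTriv j y).2).2
  rwa [Q.pt_triv hy2, atiyahBundlePt_triv hy1] at h3

/-- `At(P)` is diffeomorphic to the Atiyah bundle. -/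
noncomputable def atiyahDiffeomorph :
    Diffeomorph ((IB.prod IB).prod IG) (IB.prod IP) Q.Atiyah Q.AtiyahBundle ∞ where
  toFun := Q.toAtiyahBundle
  invFun := Q.ofAtiyahBundle
  left_inv a := by
    obtain ⟨i, b, hb, j, c, hc, g, rfl⟩ := Q.exists_atPt a
    rw [toAtiyahBundle_atPt hb hc, ofAtiyahBundle_atiyahBundlePt hb hc]
  right_inv x := by
    obtain ⟨i, b, hb, j, c, hc, g, rfl⟩ := Q.exists_atiyahBundlePt x
    rw [ofAtiyahBundle_atiyahBundlePt hb hc, toAtiyahBundle_atPt hb hc]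
  contMDiff_toFun := Q.contMDiff_toAtiyahBundle
  contMDiff_invFun := Q.contMDiff_ofAtiyahBundle

end PrincipaloidBundle

end Actions

end Principaloid

/-! ### Assembly of the theorem -/

theorem mainTheorem10
    {EM : Type*} [NormedAddCommGroup EM] [NormedSpace ℝ EM] {HM : Type*} [TopologicalSpace HM]
    {EG : Type*} [NormedAddCommGroup EG] [NormedSpace ℝ EG] {HG : Type*} [TopologicalSpace HG]
    {EB : Type*} [NormedAddCommGroup EB] [NormedSpace ℝ EB] {HB : Type*} [TopologicalSpace HB]
    {EP : Type*} [NormedAddCommGroup EP] [NormedSpace ℝ EP] {HP : Type*} [TopologicalSpace HP]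
    {IM : ModelWithCorners ℝ EM HM} {IG : ModelWithCorners ℝ EG HG}
    {IB : ModelWithCorners ℝ EB HB} {IP : ModelWithCorners ℝ EP HP}
    {M : Type*} [TopologicalSpace M] [ChartedSpace HM M]
    {G : Type*} [TopologicalSpace G] [ChartedSpace HG G]
    {B : Type*} [TopologicalSpace B] [ChartedSpace HB B] [Nonempty B]
    {P : Type*} [TopologicalSpace P] [ChartedSpace HP P]
    {ι : Type*} (𝒢 : Principaloid.LieGroupoid IM M IG G)
    (Q : Principaloid.PrincipaloidBundle 𝒢 IB B IP P ι) :
    -- the resolved model of `At(P)` is the Atiyah bundle, and it is a Lie groupoid over `ℱ`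
    (∃ Φ : Diffeomorph ((IB.prod IB).prod IG) (IB.prod IP) Q.Atiyah Q.AtiyahBundle ∞,
      ∀ i j, ∀ b₁ ∈ Q.dom i, ∀ b₂ ∈ Q.dom j, ∀ g,
        Φ (Q.atPt i j b₁ g b₂) = Q.atiyahBundlePt j (Q.pt i b₁ g) b₂) ∧
    Principaloid.IsLieGroupoid (IB.prod IM) ((IB.prod IB).prod IG) Q.atGroupoid ∧
    -- `P` is a left `At(P)`-module with moment map `D`
    Principaloid.IsLeftModule (IB.prod IM) ((IB.prod IB).prod IG) IP Q.atGroupoid Q.leftP ∧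
    Q.leftP.moment = Q.duck ∧
    (∀ i j k, ∀ b₁ ∈ Q.dom i, ∀ b₂ ∈ Q.dom j ∩ Q.dom k, ∀ g h,
      Q.atGroupoid.src (Q.atPt i j b₁ g b₂) = Q.duck (Q.pt k b₂ h) →
      Q.leftP.act (Q.atPt i j b₁ g b₂) (Q.pt k b₂ h) =
        Q.pt i b₁ (𝒢.mul g (Q.leftMul j k b₂ h))) ∧
    -- this structure covers the left `Pair(B)`-module `B`
    Principaloid.IsLeftModule IB (IB.prod IB) IB (Principaloid.pairGroupoid B)
      (Principaloid.pairAction B) ∧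
    Principaloid.IsLeftModuleMorphism (IB.prod IM) ((IB.prod IB).prod IG) IB (IB.prod IB) IP IB
      Q.atGroupoid (Principaloid.pairGroupoid B) Q.leftP (Principaloid.pairAction B)
      Q.atProj Q.shadowProj Q.proj ∧
    -- `ℱ` is a left `At(P)`-module with moment map the identity
    Principaloid.IsLeftModule (IB.prod IM) ((IB.prod IB).prod IG) (IB.prod IM)
      Q.atGroupoid Q.leftShadow ∧
    Q.leftShadow.moment = id ∧
    (∀ i j k, ∀ b₁ ∈ Q.dom i, ∀ b₂ ∈ Q.dom j ∩ Q.dom k, ∀ g m,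
      Q.atGroupoid.src (Q.atPt i j b₁ g b₂) = Q.shadowPt k b₂ m →
      Q.leftShadow.act (Q.atPt i j b₁ g b₂) (Q.shadowPt k b₂ m) = Q.shadowPt i b₁ (𝒢.tgt g)) ∧
    -- `D` intertwines the two actions
    Q.leftP.moment = Q.leftShadow.moment ∘ Q.duck ∧
    (∀ a p, Q.atGroupoid.src a = Q.leftP.moment p →
      Q.leftShadow.act a (Q.duck p) = Q.duck (Q.leftP.act a p)) ∧
    -- `(At(P), P, 𝒢; B, 𝒢)` is a trident
    Principaloid.IsTrident IB (IB.prod IM) ((IB.prod IB).prod IG) IM IG IM IG IP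
      Q.atGroupoid 𝒢.toGroupoidMaps 𝒢.toGroupoidMaps Q.leftP Q.right Q.proj
      Q.atProj Q.shadowProj Q.atTriv Q.shadowTriv Q.triv := by
  open Principaloid.PrincipaloidBundle in
  refine ⟨⟨Q.atiyahDiffeomorph, fun i j b₁ hb₁ b₂ hb₂ g => toAtiyahBundle_atPt hb₁ hb₂ g⟩,
    Q.isLieGroupoid_atGroupoid, Q.isLeftModule_leftP, rfl, fun i j k b₁ hb₁ b₂ hb₂ g h hgh => ?_,
    Principaloid.isLeftModule_pairAction Q.manifold_base, Q.isLeftModuleMorphism_proj,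
    Q.isLeftModule_leftShadow, rfl, fun i j k b₁ hb₁ b₂ hb₂ g _ _ => tgt_atPt hb₁ hb₂.1 g,
    rfl, fun a p h => (Q.isLeftModule_leftP.moment_act a p h).symm, Q.isTrident⟩
  -- The point is rewritten in the index `j` of the right end of the arrow, where matching of
  -- moments becomes composability in `𝒢`.
  rw [pt_change hb₂.1 hb₂.2] at hgh ⊢
  rw [src_atPt hb₁ hb₂.1, duck_pt hb₂.1] at hgh
  exact act_atPt_pt hb₁ hb₂.1 (shadowPt_inj hb₂.1 hgh)
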